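/- **Wedges and the class $\mathcal M_{n,n}$.** Let $X_n=\bigvee_{i=1}^n S^1_i$ be a wedge of $n$ oriented circles joined at a point $b$. A map $h:X_n\to X_n$ is piecewise monotone if $X_n$ is a union of finitely many arcs $A$ such that every set $A\cap h^{-1}(y)$ is connected or empty. Let $\mathcal M_{n,n}$ be the set of continuous piecewise monotone surjections $f:X_n\to X_n$ with $f(b)=b$ that are constant on no circle $S^1_i$ and satisfy $f(c)=b$ for every $c$ such that $f$ is injective on no neighbourhood of $c$. Write $\varprojlim f=\{(x_0,x_1,\dots)\in\prod_{k\ge0} X_n: f(x_{k+1})=x_k\ \forall k\}$ with the topology of the product, and $\underline b=(b,b,\dots)$. **Patterns.** Let $\mathcal A_n=\{a_1,\dots,a_n,\bar a_1,\dots,\bar a_n\}$, and put $\overline{b_1\cdots b_k}=\bar b_k\cdots\bar b_1$ for words, with $\bar{\bar a}=a$. A map $f\in\mathcal M_{n,n}$ follows the pattern of a substitution $\chi$, which assigns to each letter of $\mathcal A_n$ a word in $\mathcal A_n$ and satisfies $\chi(\bar a_i)=\overline{\chi(a_i)}$, if for each $i$ with $\chi(a_i)=b_1\cdots b_k$ the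 set $S^1_i\setminus f^{-1}(b)$ has exactly $k$ components, $J_1<\dots<J_k$ in the order of $S^1_i$, and $f$ maps $J_j$ homeomorphically onto $S^1_\ell\setminus\{b\}$, preserving the orientation if $b_j=a_\ell$ and reversing it if $b_j=\bar a_\ell$. **Hyperbolic systems with Markov rectangles.** Let $F:M\to M$ be a $C^1$ diffeomorphism of a Riemannian manifold $M$ without boundary of dimension $k\ge1$. For $z\in M$ let $W^u(z)=\{w: d(F^{-N}w,F^{-N}z)\to0 \text{ as } N\to\infty\}$. Let $\Lambda_F$ be a zero-dimensional compact hyperbolic $F$-invariant set with one-dimensional unstable bundle, and put $W^u(\Lambda_F)=\bigcup_{z\in\Lambda_F}W^u(z)$ with the subspace topology of $M$. Let $R_1,\dots,R_n\subset M$ be pairwise disjoint sets whose interiors cover $\Lambda_F$, put $\mathcal R=\bigcup_i R_i$, and suppose that: - R1) each $R_i$ is parametrized by a homeomorphism $\phi_i:[-1,1]\times[-1,1]^{k-1}\to R_i$; - R2) $\Lambda_F=\bigcap_{\ell\in\mathbb Z}F^\ell(\mathcal R)$ and $R_i\cap\Lambda_F\ne\emptyset$ for each $i$; - R3) if $z=\phi_i(t,x)\in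 R_i$ and $F(z)=\phi_j(t',x')\in R_j$, then $F(\phi_i(\{t\}\times[-1,1]^{k-1}))\subset\phi_j(\{t'\}\times[-1,1]^{k-1})$; - R4) for $z\in\Lambda_F\cap R_i$ let $W^u(z,R_i)$ be the component of $W^u(z)\cap R_i$ containing $z$; then $W^u(z,R_i)$ meets each $\phi_i(\{t\}\times[-1,1]^{k-1})$ in exactly one point, and if $F(z)\in R_j$ then $F(W^u(z,R_i))\supset W^u(F(z),R_j)$; - R5) if $z\in\mathcal R$ and $F(z)\notin\mathcal R$, then $F^\ell(z)\notin\mathcal R$ for all $\ell\ge1$. **The substitution $\chi_F$.** Let $L_i=[-1,1]\times\{i\}$ and $P_i(\phi_i(t,x))=(t,i)$. By R3), $f(P_i(z))=P_j(F(z))$ for $z\in R_i$, $F(z)\in R_j$ defines a map $f$ from $\bigcup_iP_i(R_i\cap F^{-1}(\mathcal R))$ to $\bigcup_jL_j$. The substitution $\chi_F$ is given by $\chi_F(a_i)=b_1\cdots b_{k_i}$ and $\chi_F(\bar a_i)=\overline{\chi_F(a_i)}$, where $J^i_1<\dots<J^i_{k_i}$ are the components of $P_i(R_i\cap F^{-1}(\mathcal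 R))$, and $b_j=a_\ell$ (respectively $b_j=\bar a_\ell$) if $f$ maps $J^i_j$ onto $L_\ell$ and is monotone and orientation preserving (respectively reversing) on $J^i_j$. **Proposition 2.5.** If $(M,F,\Lambda_F,\{R_i\}_{i=1}^n)$ is as above, satisfying R1)–R5), and $f'\in\mathcal M_{n,n}$ follows the pattern of $\chi_F$, then $\varprojlim f'\setminus\{\underline b\}$ is homeomorphic to $W^u(\Lambda_F)$. -/

import Mathlib

open Set Filter Topology Manifold Bundle
open scoped ContDiff

namespace BJV

/-! ### Wedges of circles and the maps between them -/

/-- The wedge `X_n` of `n` oriented circles, realized as the one-point compactification of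
`n` disjoint copies of the real line. The added point is the common point `b`; the copy
`{i} × ℝ` is the `i`-th circle without `b`, oriented by the usual order of `ℝ`. -/
abbrev Wedge (n : ℕ) : Type := OnePoint (Fin n × ℝ)

/-- The point `b` at which the circles are joined. -/
def base (n : ℕ) : Wedge n := OnePoint.infty

/-- The point with parameter `t` of the `i`-th circle without `b`. -/
def pt {n : ℕ} (i : Fin n) (t : ℝ) : Wedge n := OnePoint.some (i, t)

/-- The `i`-th circle of the wedge, a closed subset containing `b`. -/
def circle {n : ℕ} (i : Fin n) : Set (Wedge n) := insert (base n) (range (pt i))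

/-- An arc: a subset homeomorphic to `[0, 1]`. -/
def IsArc {X : Type*} [TopologicalSpace X] (A : Set X) : Prop :=
  ∃ γ : unitInterval → X, IsEmbedding γ ∧ range γ = A

/-- `h` restricted to `A` is monotone in the sense of continuum theory:
point preimages (in `A`) are connected or empty. -/
def MonotoneRestr {X Y : Type*} [TopologicalSpace X] (h : X → Y) (A : Set X) : Prop :=
  ∀ y, IsPreconnected (A ∩ h ⁻¹' {y})

/-- The domain is a union of finitely many arcs, restricted to each of which `h` is monotone. -/
def PiecewiseMonotone {X Y : Type*} [TopologicalSpace X] (h : X → Y) : Prop :=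
  ∃ 𝒜 : Set (Set X), 𝒜.Finite ∧ (∀ A ∈ 𝒜, IsArc A ∧ MonotoneRestr h A) ∧ ⋃₀ 𝒜 = univ

/-- `c` is a critical point of `h`: `h` is one-to-one in no neighborhood of `c`. -/
def IsCriticalPt {X Y : Type*} [TopologicalSpace X] (h : X → Y) (c : X) : Prop :=
  ∀ U ∈ 𝓝 c, ¬ InjOn h U

/-- The class `𝓜_{n,m}` of maps `X_n → X_m`. -/
structure MemM {n m : ℕ} (f : Wedge n → Wedge m) : Prop where
  continuous : Continuous f
  piecewiseMonotone : PiecewiseMonotone f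
  map_base : f (base n) = base m
  critical_value : ∀ c, IsCriticalPt f c → f c = base m
  surjective : Function.Surjective f
  not_constant : ∀ i : Fin n, ¬ ∃ v, ∀ x ∈ circle i, f x = v

/-- The inverse limit of a single bonding map, with the topology of the product. -/
def invLimit {X : Type*} (f : X → X) : Set (ℕ → X) := {x | ∀ k, f (x (k + 1)) = x k}

/-- The point `(b, b, b, …)`. -/
def basePoint (n : ℕ) : ℕ → Wedge n := fun _ => base n

/-! ### Substitutions -/

/-- The alphabet `𝒜_n = {a_1, …, a_n, ā_1, …, ā_n}`: `(i, true)` is the letter `a_i` and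
`(i, false)` the letter `ā_i`. -/
abbrev Letter (n : ℕ) : Type := Fin n × Bool

/-- The reversed word `b̄_k … b̄_1` of the word `b_1 … b_k`, where `ā̄ = a`. -/
def barWord {n : ℕ} (w : List (Letter n)) : List (Letter n) :=
  (w.map fun c => (c.1, !c.2)).reverse

/-- `J 0 < J 1 < … < J (k - 1)` is the list of all connected components of `D`,
in the order of the ambient line or interval. -/
def IsOrderedComponents {α : Type*} [LinearOrder α] [TopologicalSpace α] (D : Set α) {k : ℕ}
    (J : Fin k → Set α) : Prop :=
  (∀ C : Set α, (∃ j, J j = C) ↔ ∃ t ∈ D, C = connectedComponentIn D t) ∧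
    ∀ j j', j < j' → ∀ s ∈ J j, ∀ t ∈ J j', s < t

/-- `f` follows the pattern `χ`, that is, `χ` is the substitution `χ_f` of `f`: if
`χ (a_i) = b_1 … b_k`, then the `i`-th circle minus `f ⁻¹ {b}` has exactly `k` components
`J_1 < … < J_k`, and `f` maps `J_j` homeomorphically onto the `ℓ`-th circle minus `b`,
preserving the orientation if `b_j = a_ℓ` and reversing it if `b_j = ā_ℓ`. -/
def FollowsPattern {n m : ℕ} (f : Wedge n → Wedge m) (χ : Letter n → List (Letter m)) : Prop :=
  ∀ i : Fin n,
    (∃ J : Fin (χ (i, true)).length → Set ℝ,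
      IsOrderedComponents {t : ℝ | f (pt i t) ≠ base m} J ∧
      ∀ j, ∃ g : ℝ → ℝ,
        (∀ t ∈ J j, f (pt i t) = pt ((χ (i, true)).get j).1 (g t)) ∧
        g '' J j = univ ∧
        (((χ (i, true)).get j).2 = true → StrictMonoOn g (J j)) ∧
        (((χ (i, true)).get j).2 = false → StrictAntiOn g (J j))) ∧
    χ (i, false) = barWord (χ (i, true))

/-! ### Hyperbolic sets and unstable manifolds -/

section Dynamics

variable {k : ℕ} {M : Type*} [EMetricSpace M] [ChartedSpace (EuclideanSpace ℝ (Fin k)) M]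

/-- `Λ` is a hyperbolic set of the diffeomorphism `F` of the Riemannian manifold `M`, with
one-dimensional unstable bundle: it is compact and invariant, and over it the tangent bundle
splits into invariant subspaces `Es x`, `Eu x`, the first uniformly contracted by forward and
the second, of dimension one, by backward iteration. -/
def IsHyperbolicSet [RiemannianBundle (fun x : M => TangentSpace (𝓡 k) x)]
    (F : M ≃ₘ^1⟮𝓡 k, 𝓡 k⟯ M) (Λ : Set M) : Prop :=
  IsCompact Λ ∧ F '' Λ = Λ ∧
  ∃ (Es Eu : ∀ x : M, Submodule ℝ (TangentSpace (𝓡 k) x)) (C lam : ℝ),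
    0 < C ∧ 0 < lam ∧ lam < 1 ∧
    ∀ x ∈ Λ,
      IsCompl (Es x) (Eu x) ∧
      Module.finrank ℝ (Eu x) = 1 ∧
      (Es x).map (mfderiv (𝓡 k) (𝓡 k) F x).toLinearMap = Es (F x) ∧
      (Eu x).map (mfderiv (𝓡 k) (𝓡 k) F x).toLinearMap = Eu (F x) ∧
      (∀ v ∈ Es x, ∀ N : ℕ, ‖mfderiv (𝓡 k) (𝓡 k) (F^[N]) x v‖ ≤ C * lam ^ N * ‖v‖) ∧
      (∀ v ∈ Eu x, ∀ N : ℕ, ‖mfderiv (𝓡 k) (𝓡 k) (F.symm^[N]) x v‖ ≤ C * lam ^ N * ‖v‖)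

/-- The unstable manifold `W^u(z)`: the points whose backward orbit is asymptotic to that
of `z`. -/
def Wu (F : M ≃ₘ^1⟮𝓡 k, 𝓡 k⟯ M) (z : M) : Set M :=
  {w | Tendsto (fun N : ℕ => edist (F.symm^[N] w) (F.symm^[N] z)) atTop (𝓝 0)}

/-- The unstable manifold `W^u(Λ)` of the set `Λ`. -/
def WuSet (F : M ≃ₘ^1⟮𝓡 k, 𝓡 k⟯ M) (Λ : Set M) : Set M := ⋃ z ∈ Λ, Wu F z

end Dynamics

/-! ### Markov rectangles -/

/-- The interval `[-1, 1]`. -/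
abbrev Itv : Type := Icc (-1 : ℝ) 1

/-- The model rectangle `[-1, 1] × [-1, 1]^d`. -/
abbrev Box (d : ℕ) : Type := Itv × (Fin d → Itv)

section Rectangles

variable {n d : ℕ} {M : Type*}

/-- The union of the rectangles `R_i = φ_i ([-1, 1] × [-1, 1]^d)`. -/
def rects (φ : Fin n → Box d → M) : Set M := ⋃ i, range (φ i)

/-- The fiber `φ_i ({t} × [-1, 1]^d)`. -/
def fiber (φ : Fin n → Box d → M) (i : Fin n) (t : Itv) : Set M :=
  range fun x : Fin d → Itv => φ i (t, x)

/-- `W^u(z, R_i)`: the component of `W^u(z) ∩ R_i` containing `z`. -/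
def WuRect [EMetricSpace M] [ChartedSpace (EuclideanSpace ℝ (Fin (d + 1))) M]
    (F : M ≃ₘ^1⟮𝓡 (d + 1), 𝓡 (d + 1)⟯ M) (φ : Fin n → Box d → M) (z : M) (i : Fin n) : Set M :=
  connectedComponentIn (Wu F z ∩ range (φ i)) z

/-- `F` is a diffeomorphism of a manifold of dimension `d + 1`, `Λ` is a zero-dimensional
hyperbolic set of `F` with one-dimensional unstable manifold, and the pairwise disjoint
rectangles `R_i = range (φ i)`, whose interiors cover `Λ`, satisfy R1)-R5). -/
structure IsMarkovSystem [EMetricSpace M] [ChartedSpace (EuclideanSpace ℝ (Fin (d + 1))) M]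
    [RiemannianBundle (fun x : M => TangentSpace (𝓡 (d + 1)) x)]
    (F : M ≃ₘ^1⟮𝓡 (d + 1), 𝓡 (d + 1)⟯ M) (Λ : Set M) (φ : Fin n → Box d → M) : Prop where
  hyperbolic : IsHyperbolicSet F Λ
  zero_dim : HasSmallInductiveDimensionLE Λ 0
  disjoint : ∀ i j, i ≠ j → Disjoint (range (φ i)) (range (φ j))
  subset_interior : Λ ⊆ ⋃ i, interior (range (φ i))
  r1 : ∀ i, IsEmbedding (φ i)
  r2_eq : Λ = ⋂ l : ℤ, ⇑((F.toEquiv : Equiv.Perm M) ^ l) '' rects φ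
  r2_nonempty : ∀ i, (range (φ i) ∩ Λ).Nonempty
  r3 : ∀ i j t t' x x', F (φ i (t, x)) = φ j (t', x') → F '' fiber φ i t ⊆ fiber φ j t'
  r4_fiber : ∀ i, ∀ z ∈ Λ, z ∈ range (φ i) → ∀ t, ∃! w, w ∈ WuRect F φ z i ∩ fiber φ i t
  r4_image : ∀ i j, ∀ z ∈ Λ, z ∈ range (φ i) → F z ∈ range (φ j) →
    WuRect F φ (F z) j ⊆ F '' WuRect F φ z i
  r5 : ∀ z ∈ rects φ, F z ∉ rects φ → ∀ l : ℕ, 1 ≤ l → F^[l] z ∉ rects φ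

/-- The map induced by `F` on the first coordinates, as a relation: `f (t, i) = (t', j)` if `F`
maps some point of the fiber over `(t, i)` into the fiber over `(t', j)`. -/
def Induces (F : M → M) (φ : Fin n → Box d → M) (i : Fin n) (t : Itv) (j : Fin n) (t' : Itv) :
    Prop :=
  ∃ x x', F (φ i (t, x)) = φ j (t', x')

/-- The set `P_i (R_i ∩ F ⁻¹ (⋃ R_j))` on which the induced map is defined. -/
def inducedDomain (F : M → M) (φ : Fin n → Box d → M) (i : Fin n) : Set Itv :=
  {t | ∃ x, F (φ i (t, x)) ∈ rects φ}

/-- `χ` is the substitution `χ_F` of the system: if `χ (a_i) = b_1 … b_k`, then the domain of the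
induced map `f` in `L_i = [-1, 1] × {i}` has exactly `k` components `J_1 < … < J_k`, and `f` maps
`J_j` onto `L_ℓ`, preserving the orientation if `b_j = a_ℓ` and reversing it if `b_j = ā_ℓ`. -/
def IsSystemPattern (F : M → M) (φ : Fin n → Box d → M) (χ : Letter n → List (Letter n)) : Prop :=
  ∀ i : Fin n,
    (∃ J : Fin (χ (i, true)).length → Set Itv,
      IsOrderedComponents (inducedDomain F φ i) J ∧
      ∀ j, ∃ g : Itv → Itv,
        (∀ t ∈ J j, Induces F φ i t ((χ (i, true)).get j).1 (g t)) ∧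
        g '' J j = univ ∧
        (((χ (i, true)).get j).2 = true → MonotoneOn g (J j)) ∧
        (((χ (i, true)).get j).2 = false → AntitoneOn g (J j))) ∧
    χ (i, false) = barWord (χ (i, true))

end Rectangles

end BJV

namespace BJV

/-! ### Extension of strictly increasing functions to order isomorphisms of the line -/

/-! Both spaces carry one structure, which the substitution alone determines. Let Σ be the space of
admissible backward itineraries (`Itinerary`). A lamination (`IsLamination`) is a direct limit of
copies of Σ × ℝ under (σ, x) ↦ (shift σ, q_{σ 0} x), where the q_s are embeddings of the line whose
images are ordered, and whose orientations are prescribed, as in the words of the substitution. The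
homeomorphism T carries each copy to the next.

Rigidity (`IsLamination.nonempty_homeomorph`). Two families q, q' with the same combinatorics need
not be conjugate: neighbouring images may touch in one family and leave a gap in the other. On
compact intervals this obstruction disappears, because the sets q_s[-a, a] are always separated by
genuine gaps. So one chooses radii a_N growing so fast that every point of every copy enters the
part of radius a_M of some later copy M (`exists_radii`), and builds inductively order isomorphisms
H_N of the line, one for each circle, with H_{N+1} ∘ q_s = q'_s ∘ H_N on [-a_N, a_N]
(`exists_intertwining`). These glue to a homeomorphism, which need not commute with T and T'.

Inverse limit (`FollowsPattern.exists_lamination`). A thread other than the base thread has x_N ≠ b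
for some N, hence for all larger indices, since b is fixed. Threads with x_0 ≠ b are coded by the
parameter of x_0 and the branches used at the backward steps; the shift spreads this chart over the
space.

Unstable set (`IsRectSystem.exists_lamination`). W^u(Λ) consists of the points whose backward orbit
is eventually in the rectangles. Those with their whole backward orbit there correspond to Σ × [-1,
1]. Existence for given itinerary and first coordinate is a nested intersection of images of fibers
(`exists_mem_fiber`). For uniqueness (`eq_of_mem_fiber`): points with a given two-sided itinerary
form a connected subset of Λ, so by zero-dimensionality there is at most one; by compactness, points
with the same past are then backward asymptotic; and the points of a rectangle with a given past
form a connected set, which therefore lies in a single W^u(z, R_i) and meets each fiber at most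
once. R5 makes the chart open in W^u(Λ).

The chart uses the open interval (-1, 1), so no backward orbit may remain on boundary fibers t = ±1.
Otherwise some boundary fiber is mapped into itself by an iterate of F and shrinks to a periodic
point x of Λ, and the points that stay near x lie on this fiber. At a saddle with one unstable
direction the points that stay nearby separate small neighbourhoods
(`IsSaddleChart.not_isPreconnected_diff`), whereas a face does not separate a box
(`exists_preconnected_diff_fiber`). Since x is interior to its rectangle, this is a contradiction.
-/

theorem exists_orderIso_glue (H K : ℝ ≃o ℝ) (r : ℝ) (h : H r = K r) :
    ∃ G : ℝ ≃o ℝ, (∀ x ≤ r, G x = H x) ∧ ∀ x, r ≤ x → G x = K x := by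
  classical
  let f : ℝ → ℝ := fun x => if x ≤ r then H x else K x
  have hK : ∀ x, r ≤ x → f x = K x := by
    intro x hx
    rcases hx.eq_or_lt with rfl | hx
    · simp [f, h]
    · simp [f, not_le.2 hx]
  have hH : ∀ x ≤ r, f x = H x := fun x hx => by simp [f, hx]
  have hmono : StrictMono f := by
    intro x y hxy
    rcases le_or_gt y r with hy | hy
    · rw [hH y hy, hH x (hxy.le.trans hy)]; exact H.strictMono hxy
    · rw [hK y hy.le]
      rcases le_or_gt x r with hx | hx
      · rw [hH x hx]
        calc H x ≤ H r := H.monotone hx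
          _ = K r := h
          _ < K y := K.strictMono hy
      · rw [hK x hx.le]; exact K.strictMono hxy
  have hsurj : Function.Surjective f := by
    intro y
    rcases le_total y (H r) with hy | hy
    · refine ⟨H.symm y, ?_⟩
      rw [hH _ (by rw [← H.symm_apply_apply r]; exact H.symm.monotone hy)]; simp
    · refine ⟨K.symm y, ?_⟩
      rw [hK _ (by rw [← K.symm_apply_apply r, ← h]; exact K.symm.monotone hy)]; simp
  exact ⟨hmono.orderIsoOfSurjective f hsurj, hH, hK⟩

theorem exists_orderIso_through {x x' y y' : ℝ} (hx : x < x') (hy : y < y') :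
    ∃ G : ℝ ≃o ℝ, G x = y ∧ G x' = y' := by
  have hc : 0 < (y' - y) / (x' - x) := div_pos (sub_pos.2 hy) (sub_pos.2 hx)
  have h0 : x' - x ≠ 0 := (sub_pos.2 hx).ne'
  refine ⟨StrictMono.orderIsoOfSurjective (fun t => y + (y' - y) / (x' - x) * (t - x)) ?_ ?_, ?_, ?_⟩
  · intro s t hst
    have := mul_lt_mul_of_pos_left (sub_lt_sub_right hst x) hc
    dsimp only
    linarith
  · intro z
    refine ⟨x + (z - y) / ((y' - y) / (x' - x)), ?_⟩
    dsimp only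
    rw [add_sub_cancel_left, mul_div_cancel₀ _ hc.ne']; ring
  · change y + (y' - y) / (x' - x) * (x - x) = y
    rw [sub_self, mul_zero, add_zero]
  · change y + (y' - y) / (x' - x) * (x' - x) = y'
    rw [div_mul_cancel₀ _ h0, add_sub_cancel]

/-- Compose `h` with the retraction of the line onto `[l, r]` and continue with slope one outside.
The retraction is 1-Lipschitz, so the added term is nondecreasing, and it makes the sum unbounded in
both directions. -/
theorem exists_orderIso_extend {l r : ℝ} (hlr : l ≤ r) {h : ℝ → ℝ} (hm : StrictMonoOn h (Icc l r))
    (hc : ContinuousOn h (Icc l r)) : ∃ G : ℝ ≃o ℝ, ∀ x ∈ Icc l r, G x = h x := by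
  let p : ℝ → ℝ := fun x => max l (min r x)
  have hp : ∀ x, p x ∈ Icc l r := fun x => ⟨le_max_left _ _, max_le hlr (min_le_left _ _)⟩
  have hpc : Continuous p := by fun_prop
  have hpm : Monotone p := fun x y h => max_le_max le_rfl (min_le_min le_rfl h)
  have hpid : ∀ x ∈ Icc l r, p x = x := fun x hx => by simp [p, hx.1, hx.2]
  have hsub : ∀ x y, x ≤ y → p y - p x ≤ y - x := by
    intro x y hxy
    simp only [p]
    rcases max_cases l (min r y) with ⟨h1, h2⟩ | ⟨h1, h2⟩ <;>
    rcases max_cases l (min r x) with ⟨h3, h4⟩ | ⟨h3, h4⟩ <;>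
    rcases min_cases r y with ⟨h5, h6⟩ | ⟨h5, h6⟩ <;>
    rcases min_cases r x with ⟨h7, h8⟩ | ⟨h7, h8⟩ <;> linarith
  let f : ℝ → ℝ := fun x => h (p x) + (x - p x)
  have hf : Continuous f := (hc.comp_continuous hpc hp).add (continuous_id.sub hpc)
  have hle : ∀ x, h (p x) ∈ Icc (h l) (h r) := fun x =>
    ⟨hm.monotoneOn ⟨le_rfl, hlr⟩ (hp x) (hp x).1, hm.monotoneOn (hp x) ⟨hlr, le_rfl⟩ (hp x).2⟩
  have hmono : StrictMono f := by
    intro x y hxy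
    have h1 := hsub x y hxy.le
    rcases (hpm hxy.le).eq_or_lt with h2 | h2
    · simp only [f]; rw [h2]; linarith
    · have := hm (hp x) (hp y) h2
      simp only [f]; linarith
  have hsurj : Function.Surjective f := by
    refine hf.surjective ?_ ?_
    · refine tendsto_atTop_mono (g := f) (f := fun x => x + (h l - r)) (fun x => ?_)
        (tendsto_atTop_add_const_right _ _ tendsto_id)
      have := (hle x).1; have := (hp x).2
      simp only [f]; linarith
    · refine tendsto_atBot_mono (g := f) (f := fun x => x + (h r - l)) (fun x => ?_)
        (tendsto_atBot_add_const_right _ _ tendsto_id)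
      have := (hle x).2; have := (hp x).1
      simp only [f]; linarith
  refine ⟨hmono.orderIsoOfSurjective f hsurj, fun x hx => ?_⟩
  change f x = h x
  simp [f, hpid x hx]

/-- Strictly increasing continuous functions on finitely many consecutive compact intervals, with
consecutive images, have a common extension to an order isomorphism of the line. -/
theorem exists_orderIso_extend_family (l r : ℕ → ℝ) (h : ℕ → ℝ → ℝ) (K : ℕ)
    (hlr : ∀ j ≤ K, l j ≤ r j) (hm : ∀ j ≤ K, StrictMonoOn (h j) (Icc (l j) (r j)))
    (hc : ∀ j ≤ K, ContinuousOn (h j) (Icc (l j) (r j)))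
    (hr : ∀ j < K, r j < l (j + 1)) (hv : ∀ j < K, h j (r j) < h (j + 1) (l (j + 1))) :
    ∃ G : ℝ ≃o ℝ, ∀ j ≤ K, ∀ x ∈ Icc (l j) (r j), G x = h j x := by
  induction K with
  | zero =>
    obtain ⟨G, hG⟩ := exists_orderIso_extend (hlr 0 le_rfl) (hm 0 le_rfl) (hc 0 le_rfl)
    refine ⟨G, fun j hj => ?_⟩
    obtain rfl : j = 0 := by omega
    exact hG
  | succ K ih =>
    obtain ⟨G, hG⟩ := ih (fun j hj => hlr j (by omega)) (fun j hj => hm j (by omega))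
      (fun j hj => hc j (by omega)) (fun j hj => hr j (by omega)) (fun j hj => hv j (by omega))
    -- `A` bridges the gap between the last interval treated and the new one; the extension is glued
    -- from `G`, `A` and `B`.
    obtain ⟨A, hA1, hA2⟩ := exists_orderIso_through (hr K (by omega)) (hv K (by omega))
    obtain ⟨B, hB⟩ := exists_orderIso_extend (hlr (K + 1) le_rfl) (hm (K + 1) le_rfl)
      (hc (K + 1) le_rfl)
    have hrK : ∀ j ≤ K, r j ≤ r K := by
      intro j hj
      have key : ∀ k, j ≤ k → k ≤ K → r j ≤ r k := by
        intro k hjk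
        induction k, hjk using Nat.le_induction with
        | base => exact fun _ => le_rfl
        | succ m hm' ihm =>
          intro hk
          have h1 := hr m (by omega)
          have h2 := hlr (m + 1) (by omega)
          have h3 := ihm (by omega)
          linarith
      exact key K hj le_rfl
    have hend := hG K le_rfl (r K) ⟨hlr K (by omega), le_rfl⟩
    obtain ⟨C, hC1, hC2⟩ := exists_orderIso_glue G A (r K) (by rw [hA1, hend])
    obtain ⟨D, hD1, hD2⟩ := exists_orderIso_glue C B (l (K + 1)) (by
      rw [hC2 _ (hr K (by omega)).le, hA2, hB _ ⟨le_rfl, hlr _ le_rfl⟩])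
    refine ⟨D, fun j hj x hx => ?_⟩
    rcases Nat.lt_or_ge K j with h1 | h1
    · obtain rfl : j = K + 1 := by omega
      rw [hD2 x hx.1, hB x hx]
    · have h2 : x ≤ r K := hx.2.trans (hrK j h1)
      rw [hD1 x (h2.trans (hr K (by omega)).le), hC1 x h2, hG j h1 x hx]

/-! ### Laminations generated by a system of interval embeddings -/

/-- The occurrences of letters in the words of a substitution whose `i`-th word has
length `len i`. -/
abbrev Cell {n : ℕ} (len : Fin n → ℕ) : Type := Σ i, Fin (len i)

/-- The admissible backward itineraries. -/
abbrev Itinerary {n : ℕ} {len : Fin n → ℕ} (tgt : Cell len → Fin n) : Type :=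
  {σ : ℕ → Cell len // ∀ l, (σ l).1 = tgt (σ (l + 1))}

/-- The itinerary without its first symbol. -/
def Itinerary.shift {n : ℕ} {len : Fin n → ℕ} {tgt : Cell len → Fin n} (σ : Itinerary tgt) :
    Itinerary tgt := ⟨fun l => σ.1 (l + 1), fun l => σ.2 (l + 1)⟩

/-- The iterates of a point of the line under the branches prescribed by `σ`. -/
def lineIter {S : Type*} (q : S → ℝ → ℝ) (σ : ℕ → S) (x : ℝ) : ℕ → ℝ
  | 0 => x
  | m + 1 => q (σ m) (lineIter q σ x m)

theorem lineIter_shift {S : Type*} (q : S → ℝ → ℝ) (σ : ℕ → S) (x : ℝ) (m : ℕ) :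
    lineIter q (fun l => σ (l + 1)) (q (σ 0) x) m = lineIter q σ x (m + 1) := by
  induction m with
  | zero => rfl
  | succ m ih => simp only [lineIter, ih]

variable {n : ℕ} {len : Fin n → ℕ}

/-- A system of embeddings of the line into itself, one for each cell, increasing or decreasing
as prescribed, the embeddings with the same source having consecutive images. -/
structure IsLineSystem (ori : Cell len → Bool) (q : Cell len → ℝ → ℝ) : Prop where
  mono : ∀ s, ori s = true → StrictMono (q s)
  anti : ∀ s, ori s = false → StrictAnti (q s)
  emb : ∀ s, IsEmbedding (q s)
  order : ∀ i (j j' : Fin (len i)), j < j' → ∀ x y, q ⟨i, j⟩ x < q ⟨i, j'⟩ y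

/-- `Y` is the increasing union of the images under `T ^ N` of the open set parametrized by `E`,
which is a product of the space of itineraries and the line. -/
structure IsLamination {Y : Type*} [TopologicalSpace Y] (tgt : Cell len → Fin n)
    (q : Cell len → ℝ → ℝ) (T : Y ≃ₜ Y) (E : Itinerary tgt × ℝ → Y) : Prop where
  isOpenEmbedding : IsOpenEmbedding E
  cover : ∀ y, ∃ N : ℕ, ∃ p, T^[N] (E p) = y
  step : ∀ σ x, T (E (σ.shift, q (σ.1 0) x)) = E (σ, x)

theorem IsLineSystem.exists_bound {ori : Cell len → Bool} {q : Cell len → ℝ → ℝ}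
    (hq : IsLineSystem ori q) (r : ℝ) : ∃ B : ℝ, 0 ≤ B ∧ ∀ s x, |x| ≤ r → |q s x| ≤ B := by
  have h1 : ∀ s, ∃ B : ℝ, 0 ≤ B ∧ ∀ x, |x| ≤ r → |q s x| ≤ B := by
    intro s
    obtain ⟨B, hB⟩ := (isCompact_Icc (a := -r) (b := r)).exists_bound_of_continuousOn
      (hq.emb s).continuous.continuousOn
    exact ⟨|B|, abs_nonneg _, fun x hx => (hB x (abs_le.1 hx)).trans (le_abs_self B)⟩
  choose B hB0 hB using h1
  refine ⟨∑ s, B s, Finset.sum_nonneg fun s _ => hB0 s, fun s x hx => (hB s x hx).trans ?_⟩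
  exact Finset.single_le_sum (fun s _ => hB0 s) (Finset.mem_univ s)

/-- The radii must dominate one step of the branches and also overtake every orbit, whatever level
`k` it starts from. Common bounds `B` for all branches control all orbits issuing from `[-r, r]` at
once, and these countably many bounds are overtaken diagonally. -/
theorem IsLineSystem.exists_radii {ori : Cell len → Bool} {q : Cell len → ℝ → ℝ}
    (hq : IsLineSystem ori q) : ∃ a : ℕ → ℝ, (∀ N, 0 < a N) ∧
      (∀ N s x, |x| ≤ a N → |q s x| < a (N + 1)) ∧
      ∀ k (σ : ℕ → Cell len) x, ∃ m, |lineIter q σ x m| < a (k + m) := by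
  choose B hB0 hB using hq.exists_bound
  -- The summand `B aN` gives the one-step estimate. With `N = k + M`, the term `m = M + 1` of the
  -- sum overtakes the orbits with `|x| ≤ M` that start at level `k`.
  let a : ℕ → ℝ := fun N => Nat.rec 1
    (fun N aN => 1 + B aN + ∑ m ∈ Finset.range (N + 2), |B^[m] (N + 1)|) N
  have ha : ∀ N, a (N + 1) = 1 + B (a N) + ∑ m ∈ Finset.range (N + 2), |B^[m] ((N : ℝ) + 1)| :=
    fun N => rfl
  have hs : ∀ N : ℕ, 0 ≤ ∑ m ∈ Finset.range (N + 2), |B^[m] ((N : ℝ) + 1)| := fun N =>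
    Finset.sum_nonneg fun _ _ => abs_nonneg _
  have hpos : ∀ N, 0 < a N := by
    rintro (_ | N)
    · exact one_pos
    · rw [ha]; have := hB0 (a N); have := hs N; linarith
  refine ⟨a, hpos, fun N s x hx => ?_, fun k σ x => ?_⟩
  · have := hB _ s x hx
    have := hs N
    rw [ha]; linarith
  · obtain ⟨M, hM⟩ := exists_nat_ge |x|
    have hit : ∀ m, |lineIter q σ x m| ≤ B^[m] ((k + M : ℕ) + 1 : ℝ) := by
      intro m
      induction m with
      | zero => simp only [lineIter, Function.iterate_zero, id]; push_cast; linarith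
      | succ m ih =>
        rw [Function.iterate_succ_apply']
        exact hB _ _ _ ih
    refine ⟨M + 1, (hit _).trans_lt ?_⟩
    have h1 : k + (M + 1) = (k + M) + 1 := by ring
    rw [h1, ha]
    have h2 := Finset.single_le_sum (f := fun m => |B^[m] (((k + M : ℕ) : ℝ) + 1)|)
      (s := Finset.range (k + M + 2)) (fun _ _ => abs_nonneg _)
      (Finset.mem_range.2 (show M + 1 < k + M + 2 by omega))
    have h3 := hB0 (a (k + M))
    have h4 := le_abs_self (B^[M + 1] (((k + M : ℕ) : ℝ) + 1))
    linarith

theorem abs_orderIso_le {H : ℝ ≃o ℝ} {a a' x : ℝ} (h1 : H a = a') (h2 : H (-a) = -a')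
    (hx : |x| ≤ a) : |H x| ≤ a' := by
  rw [abs_le] at hx ⊢
  subst h1
  exact ⟨h2 ▸ H.monotone hx.1, H.monotone hx.2⟩

theorem abs_orderIso_lt {H : ℝ ≃o ℝ} {a a' x : ℝ} (h1 : H a = a') (h2 : H (-a) = -a')
    (hx : |x| < a) : |H x| < a' := by
  rw [abs_lt] at hx ⊢
  subst h1
  exact ⟨h2 ▸ H.strictMono hx.1, H.strictMono hx.2⟩

/-- The forced map on `q s [-a, a]` is `q' s ∘ H ∘ (q s)⁻¹`. It is increasing even if `s` reverses
orientation, because `q' s` then reverses it too. -/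
theorem IsLineSystem.exists_interval_map {ori : Cell len → Bool} {q q' : Cell len → ℝ → ℝ}
    (hq : IsLineSystem ori q) (hq' : IsLineSystem ori q') (s : Cell len) {a : ℝ} (ha : 0 < a)
    (H : ℝ ≃o ℝ) : ∃ (l r : ℝ) (h : ℝ → ℝ), l ≤ r ∧ StrictMonoOn h (Icc l r) ∧
      ContinuousOn h (Icc l r) ∧ (∀ x, |x| ≤ a → q s x ∈ Icc l r ∧ h (q s x) = q' s (H x)) ∧
      ∀ y ∈ Icc l r, ∃ x, |x| ≤ a ∧ q s x = y := by
  have hinj := (hq.emb s).injective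
  have hinv : ∀ x, Function.invFun (q s) (q s x) = x := Function.leftInverse_invFun hinj
  have haa : -a ≤ a := by linarith
  have hsub : ∀ y ∈ Icc (q s (-a) ⊓ q s a) (q s (-a) ⊔ q s a), ∃ x, |x| ≤ a ∧ q s x = y := by
    intro y hy
    obtain ⟨x, hx, rfl⟩ := intermediate_value_uIcc (f := q s) (a := -a) (b := a)
      (hq.emb s).continuous.continuousOn hy
    rw [uIcc_of_le haa] at hx
    exact ⟨x, abs_le.2 hx, rfl⟩
  have hinvc : ContinuousOn (Function.invFun (q s)) (range (q s)) := by
    rw [continuousOn_iff_continuous_domRestrict]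
    convert (hq.emb s).toHomeomorph.symm.continuous using 1
    ext ⟨_, x, rfl⟩
    rw [domRestrict_apply, hinv]
    exact ((hq.emb s).toHomeomorph.symm_apply_apply x).symm
  refine ⟨_, _, fun y => q' s (H (Function.invFun (q s) y)), inf_le_sup, ?_, ?_, ?_, hsub⟩
  · intro y hy z hz hyz
    obtain ⟨u, -, rfl⟩ := hsub y hy
    obtain ⟨v, -, rfl⟩ := hsub z hz
    simp only [hinv]
    cases hs : ori s with
    | true => exact (hq'.mono s hs) (H.strictMono ((hq.mono s hs).lt_iff_lt.1 hyz))
    | false => exact (hq'.anti s hs) (H.strictMono ((hq.anti s hs).lt_iff_gt.1 hyz))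
  · refine ((hq'.emb s).continuous.comp H.continuous).comp_continuousOn (hinvc.mono ?_)
    intro y hy
    obtain ⟨u, -, rfl⟩ := hsub y hy
    exact mem_range_self u
  · intro x hx
    refine ⟨?_, by simp only [hinv]⟩
    rw [abs_le] at hx
    cases hs : ori s with
    | true =>
      have hm := (hq.mono s hs).monotone
      exact ⟨inf_le_left.trans (hm hx.1), (hm hx.2).trans le_sup_right⟩
    | false =>
      have hm := (hq.anti s hs).antitone
      exact ⟨inf_le_right.trans (hm hx.2), (hm hx.1).trans le_sup_left⟩

/-- The values are forced on the pieces `q s [-a, a]`, for all occurrences `s` in the `i`-th word.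
These compact pieces, and their images, are separated by nondegenerate gaps, so an increasing
extension exists. Sending `±b` to `±b'` keeps the radii matched for the next step. -/
theorem IsLineSystem.exists_orderIso_step {ori : Cell len → Bool} {q q' : Cell len → ℝ → ℝ}
    (hq : IsLineSystem ori q) (hq' : IsLineSystem ori q') (tgt : Cell len → Fin n)
    {a b a' b' : ℝ} (ha : 0 < a) (hb : 0 < b) (hb' : 0 < b')
    (hab : ∀ s x, |x| ≤ a → |q s x| < b) (hab' : ∀ s x, |x| ≤ a' → |q' s x| < b')
    (H : Fin n → ℝ ≃o ℝ) (hH : ∀ i, H i a = a' ∧ H i (-a) = -a') (i : Fin n) :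
    ∃ G : ℝ ≃o ℝ, (G b = b' ∧ G (-b) = -b') ∧
      ∀ (j : Fin (len i)) x, |x| ≤ a → G (q ⟨i, j⟩ x) = q' ⟨i, j⟩ (H (tgt ⟨i, j⟩) x) := by
  choose l r h hlr hm hc hqh hqs using fun j : Fin (len i) =>
    hq.exists_interval_map hq' ⟨i, j⟩ ha (H (tgt ⟨i, j⟩))
  -- Index `0` stands for the point `-b`, indices `1, …, len i` for the cells shifted by one, and
  -- index `len i + 1` for the point `b`.
  let L : ℕ → ℝ := fun m => Nat.casesOn m (-b) fun m => if hm : m < len i then l ⟨m, hm⟩ else b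
  let R : ℕ → ℝ := fun m => Nat.casesOn m (-b) fun m => if hm : m < len i then r ⟨m, hm⟩ else b
  let V : ℕ → ℝ → ℝ := fun m => Nat.casesOn m (fun _ => -b') fun m =>
    if hm : m < len i then h ⟨m, hm⟩ else fun _ => b'
  have hL : ∀ m (hm : m < len i), L (m + 1) = l ⟨m, hm⟩ := fun m hm => dif_pos hm
  have hR : ∀ m (hm : m < len i), R (m + 1) = r ⟨m, hm⟩ := fun m hm => dif_pos hm
  have hV : ∀ m (hm : m < len i), V (m + 1) = h ⟨m, hm⟩ := fun m hm => dif_pos hm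
  have hL' : L (len i + 1) = b := dif_neg (lt_irrefl _)
  have hR' : R (len i + 1) = b := dif_neg (lt_irrefl _)
  have hV' : V (len i + 1) = fun _ => b' := dif_neg (lt_irrefl _)
  have hcases : ∀ m ≤ len i + 1, m = 0 ∨ (∃ m', ∃ _ : m' < len i, m = m' + 1) ∨ m = len i + 1 := by
    intro m hm
    rcases m with _ | m
    · exact Or.inl rfl
    · rcases Nat.lt_or_ge m (len i) with h1 | h1
      · exact Or.inr (Or.inl ⟨m, h1, rfl⟩)
      · exact Or.inr (Or.inr (by omega))
  have hval : ∀ j, ∀ y ∈ Icc (l j) (r j), |y| < b ∧ |h j y| < b' ∧ (∃ x, y = q ⟨i, j⟩ x) ∧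
      ∃ x, h j y = q' ⟨i, j⟩ x := by
    intro j y hy
    obtain ⟨x, hx, rfl⟩ := hqs j y hy
    rw [(hqh j x hx).2]
    exact ⟨hab _ _ hx, hab' _ _ (abs_orderIso_le (hH _).1 (hH _).2 hx), ⟨x, rfl⟩, ⟨_, rfl⟩⟩
  have hvl : ∀ j, l j ∈ Icc (l j) (r j) := fun j => ⟨le_rfl, hlr j⟩
  have hvr : ∀ j, r j ∈ Icc (l j) (r j) := fun j => ⟨hlr j, le_rfl⟩
  obtain ⟨G, hG⟩ := exists_orderIso_extend_family L R V (len i + 1)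
    (fun m hm => by
      rcases hcases m hm with rfl | ⟨m', h', rfl⟩ | rfl
      · exact le_rfl
      · rw [hL _ h', hR _ h']; exact hlr _
      · rw [hL', hR'])
    (fun m hm' => by
      rcases hcases m hm' with rfl | ⟨m', h', rfl⟩ | rfl
      · exact Set.Subsingleton.strictMonoOn _ (by simp [L, R])
      · rw [hL _ h', hR _ h', hV _ h']; exact hm _
      · rw [hL', hR', Icc_self]; exact Set.Subsingleton.strictMonoOn _ subsingleton_singleton)
    (fun m hm' => by
      rcases hcases m hm' with rfl | ⟨m', h', rfl⟩ | rfl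
      · exact continuousOn_const
      · rw [hL _ h', hR _ h', hV _ h']; exact hc _
      · rw [hV']; exact continuousOn_const)
    (fun m hm' => by
      rcases hcases m hm'.le with rfl | ⟨m', h', rfl⟩ | rfl
      · change -b < _
        rcases Nat.lt_or_ge 0 (len i) with h1 | h1
        · rw [hL _ h1]; exact (abs_lt.1 (hval _ _ (hvl _)).1).1
        · have : len i = 0 := by omega
          rw [← this, hL']; linarith
      · rw [hR _ h']
        rcases Nat.lt_or_ge (m' + 1) (len i) with h1 | h1
        · rw [hL _ h1]
          obtain ⟨x, hx⟩ := (hval _ _ (hvr ⟨m', h'⟩)).2.2.1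
          obtain ⟨y, hy⟩ := (hval _ _ (hvl ⟨m' + 1, h1⟩)).2.2.1
          rw [hx, hy]
          exact hq.order _ _ _ (Fin.mk_lt_mk.2 (Nat.lt_succ_self _)) _ _
        · have : m' + 1 = len i := by omega
          rw [this, hL']; exact (abs_lt.1 (hval _ _ (hvr _)).1).2
      · omega)
    (fun m hm' => by
      rcases hcases m hm'.le with rfl | ⟨m', h', rfl⟩ | rfl
      · change -b' < _
        rcases Nat.lt_or_ge 0 (len i) with h1 | h1
        · rw [hL _ h1, hV _ h1]; exact (abs_lt.1 (hval _ _ (hvl _)).2.1).1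
        · have : len i = 0 := by omega
          rw [← this, hV']; simp only; linarith
      · rw [hR _ h', hV _ h']
        rcases Nat.lt_or_ge (m' + 1) (len i) with h1 | h1
        · rw [hL _ h1, hV _ h1]
          obtain ⟨x, hx⟩ := (hval _ _ (hvr ⟨m', h'⟩)).2.2.2
          obtain ⟨y, hy⟩ := (hval _ _ (hvl ⟨m' + 1, h1⟩)).2.2.2
          rw [hx, hy]
          exact hq'.order _ _ _ (Fin.mk_lt_mk.2 (Nat.lt_succ_self _)) _ _
        · have : m' + 1 = len i := by omega
          rw [this, hV']; exact (abs_lt.1 (hval _ _ (hvr _)).2.1).2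
      · omega)
  refine ⟨G, ⟨?_, hG 0 (by omega) (-b) ⟨le_rfl, le_rfl⟩⟩, fun j x hx => ?_⟩
  · have := hG (len i + 1) le_rfl b ⟨hL'.le, hR'.ge⟩
    rw [this, hV']
  · have := hG (j + 1) (by omega) (q ⟨i, j⟩ x) (by rw [hL _ j.2, hR _ j.2]; exact (hqh j x hx).1)
    rw [this, hV _ j.2]
    exact (hqh j x hx).2

theorem IsLineSystem.exists_intertwining {ori : Cell len → Bool} {q q' : Cell len → ℝ → ℝ}
    (hq : IsLineSystem ori q) (hq' : IsLineSystem ori q') (tgt : Cell len → Fin n)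
    {a a' : ℕ → ℝ} (ha : ∀ N, 0 < a N) (ha' : ∀ N, 0 < a' N)
    (hab : ∀ N s x, |x| ≤ a N → |q s x| < a (N + 1))
    (hab' : ∀ N s x, |x| ≤ a' N → |q' s x| < a' (N + 1)) :
    ∃ H : ℕ → Fin n → ℝ ≃o ℝ, (∀ N i, H N i (a N) = a' N ∧ H N i (-a N) = -a' N) ∧
      ∀ N s x, |x| ≤ a N → H (N + 1) s.1 (q s x) = q' s (H N (tgt s) x) := by
  have h0 : ∃ G : ℝ ≃o ℝ, G (a 0) = a' 0 ∧ G (-a 0) = -a' 0 := by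
    have h1 := ha 0; have h2 := ha' 0
    obtain ⟨G, hG1, hG2⟩ := exists_orderIso_through (x := -a 0) (x' := a 0) (y := -a' 0)
      (y' := a' 0) (by linarith) (by linarith)
    exact ⟨G, hG2, hG1⟩
  obtain ⟨G0, hG0⟩ := h0
  -- `choose!` makes `next` total, so the recursion need not carry the condition at `±a N`; it is
  -- recovered by induction in `hH`.
  choose! next hnext1 hnext2 using fun (N : ℕ) (H : Fin n → ℝ ≃o ℝ)
      (hH : ∀ i, H i (a N) = a' N ∧ H i (-a N) = -a' N) (i : Fin n) =>
    hq.exists_orderIso_step hq' tgt (ha N) (ha (N + 1)) (ha' (N + 1)) (hab N) (hab' N) H hH i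
  let H : ℕ → Fin n → ℝ ≃o ℝ := fun N => Nat.rec (fun _ => G0) (fun N H i => next N H i) N
  have hH : ∀ N i, H N i (a N) = a' N ∧ H N i (-a N) = -a' N := by
    intro N
    induction N with
    | zero => exact fun _ => hG0
    | succ N ih => exact fun i => hnext1 N (H N) ih i
  exact ⟨H, hH, fun N s x hx => hnext2 N (H N) (hH N) s.1 s.2 x hx⟩

/-! ### Homeomorphisms between laminations with the same combinatorics -/

section Lamination

variable {Y : Type*} [TopologicalSpace Y] {tgt : Cell len → Fin n} {ori : Cell len → Bool}
  {q : Cell len → ℝ → ℝ} {T : Y ≃ₜ Y} {E : Itinerary tgt × ℝ → Y}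

theorem IsLamination.iterate_step (h : IsLamination tgt q T E) (N : ℕ) (σ : Itinerary tgt)
    (x : ℝ) : T^[N + 1] (E (σ.shift, q (σ.1 0) x)) = T^[N] (E (σ, x)) := by
  rw [Function.iterate_succ_apply, h.step]

theorem isOpenEmbedding_iterate_comp (h : IsLamination tgt q T E) (N : ℕ) :
    IsOpenEmbedding (T^[N] ∘ E) := by
  induction N with
  | zero => exact h.isOpenEmbedding
  | succ N ih =>
    rw [Function.iterate_succ', Function.comp_assoc]
    exact T.isOpenEmbedding.comp ih

/-- Every point lies in the part of the `N`-th chart of radius `a N` for some `N`. -/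
theorem IsLamination.exists_mem (h : IsLamination tgt q T E) {a : ℕ → ℝ}
    (hex : ∀ k (σ : ℕ → Cell len) x, ∃ m, |lineIter q σ x m| < a (k + m)) (y : Y) :
    ∃ N σ x, |x| < a N ∧ T^[N] (E (σ, x)) = y := by
  obtain ⟨N, ⟨σ, x⟩, rfl⟩ := h.cover y
  obtain ⟨m, hm⟩ := hex N σ.1 x
  -- Climbing `m` charts replaces the line coordinate by its `m`-th iterate under the branches of
  -- the itinerary.
  have key : ∀ m N (σ : Itinerary tgt) x, ∃ σ' : Itinerary tgt,
      T^[N + m] (E (σ', lineIter q σ.1 x m)) = T^[N] (E (σ, x)) := by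
    intro m
    induction m with
    | zero => exact fun N σ x => ⟨σ, rfl⟩
    | succ m ih =>
      intro N σ x
      obtain ⟨σ', h'⟩ := ih (N + 1) σ.shift (q (σ.1 0) x)
      refine ⟨σ', ?_⟩
      rw [← h.iterate_step N σ x, ← h', show N + (m + 1) = N + 1 + m by ring]
      exact congrArg (fun t => T^[N + 1 + m] (E (σ', t))) (lineIter_shift q σ.1 x m).symm
  obtain ⟨σ', h'⟩ := key m N σ x
  exact ⟨N + m, σ', _, hm, h'⟩

variable {Y' : Type*} [TopologicalSpace Y'] {q' : Cell len → ℝ → ℝ} {T' : Y' ≃ₜ Y'}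
  {E' : Itinerary tgt × ℝ → Y'}

/-- On the part of radius `a N` of the `N`-th chart the map is `H N` in the line coordinate. The
relation `hH` says that the formulas agree when a point is rewritten in the next chart. -/
theorem IsLamination.exists_continuous_map (h : IsLamination tgt q T E)
    (h' : IsLamination tgt q' T' E') {a : ℕ → ℝ}
    (hab : ∀ N s x, |x| ≤ a N → |q s x| < a (N + 1))
    (hex : ∀ k (σ : ℕ → Cell len) x, ∃ m, |lineIter q σ x m| < a (k + m))
    (H : ℕ → Fin n → ℝ ≃o ℝ)
    (hH : ∀ N s x, |x| ≤ a N → H (N + 1) s.1 (q s x) = q' s (H N (tgt s) x)) :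
    ∃ Φ : Y → Y', Continuous Φ ∧ ∀ N σ x, |x| < a N →
      Φ (T^[N] (E (σ, x))) = T'^[N] (E' (σ, H N (tgt (σ.1 0)) x)) := by
  choose N σ x hx hy using h.exists_mem hex
  let Φ : Y → Y' := fun y => T'^[N y] (E' (σ y, H (N y) (tgt ((σ y).1 0)) (x y)))
  have hup : ∀ k M (σ : Itinerary tgt) x, |x| < a M → ∃ (σ₁ : Itinerary tgt) (x₁ : ℝ),
      |x₁| < a (M + k) ∧ T^[M + k] (E (σ₁, x₁)) = T^[M] (E (σ, x)) ∧
      T'^[M + k] (E' (σ₁, H (M + k) (tgt (σ₁.1 0)) x₁)) =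
        T'^[M] (E' (σ, H M (tgt (σ.1 0)) x)) := by
    intro k
    induction k with
    | zero => exact fun M σ x hx => ⟨σ, x, hx, rfl, rfl⟩
    | succ k ih =>
      intro M σ x hx
      obtain ⟨σ₁, x₁, h1, h2, h3⟩ := ih (M + 1) σ.shift (q (σ.1 0) x) (hab _ _ _ hx.le)
      rw [show M + 1 + k = M + (k + 1) by ring] at h1 h2 h3
      refine ⟨σ₁, x₁, h1, h2.trans (h.iterate_step M σ x), h3.trans ?_⟩
      rw [← h'.iterate_step M σ, ← hH M _ x hx.le, σ.2 0]
      rfl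
  -- Two representations of a point are both raised to the chart `M + M'`, where they coincide by
  -- injectivity.
  have hwd : ∀ M σ x M' σ' x', |x| < a M → |x'| < a M' →
      T^[M] (E (σ, x)) = T^[M'] (E (σ', x')) →
      T'^[M] (E' (σ, H M (tgt (σ.1 0)) x)) = T'^[M'] (E' (σ', H M' (tgt (σ'.1 0)) x')) := by
    intro M σ x M' σ' x' hx hx' he
    obtain ⟨σ₁, x₁, -, h2, h3⟩ := hup M' M σ x hx
    obtain ⟨σ₂, x₂, -, h5, h6⟩ := hup M M' σ' x' hx'
    rw [add_comm M' M] at h5 h6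
    have := (isOpenEmbedding_iterate_comp h (M + M')).injective
      (a₁ := (σ₁, x₁)) (a₂ := (σ₂, x₂)) (h2.trans (he.trans h5.symm))
    obtain ⟨rfl, rfl⟩ := Prod.mk.inj this
    rw [← h3, ← h6]
  have hΦ : ∀ M σ x, |x| < a M →
      Φ (T^[M] (E (σ, x))) = T'^[M] (E' (σ, H M (tgt (σ.1 0)) x)) := fun M σ₀ x₀ hx₀ =>
    hwd _ _ _ _ _ _ (hx _) hx₀ (hy _)
  refine ⟨Φ, ?_, hΦ⟩
  rw [continuous_iff_continuousAt]
  intro y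
  have hcont : Continuous fun p : Itinerary tgt × ℝ =>
      T'^[N y] (E' (p.1, H (N y) (tgt (p.1.1 0)) p.2)) := by
    refine (isOpenEmbedding_iterate_comp h' (N y)).continuous.comp
      (continuous_fst.prodMk ?_)
    have h1 : Continuous fun p : Fin n × ℝ => H (N y) p.1 p.2 :=
      continuous_prod_of_discrete_left.2 fun i => (H (N y) i).continuous
    have h2 : Continuous fun p : Itinerary tgt × ℝ => tgt (p.1.1 0) :=
      (continuous_of_discreteTopology (f := tgt)).comp
        ((continuous_apply 0).comp (continuous_subtype_val.comp continuous_fst))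
    exact h1.comp (h2.prodMk continuous_snd)
  have h3 := (isOpenEmbedding_iterate_comp h (N y)).continuousAt_iff (g := Φ) (x := (σ y, x y))
  simp only [Function.comp_apply, hy] at h3
  rw [← h3]
  refine hcont.continuousAt.congr ?_
  have : {p : Itinerary tgt × ℝ | |p.2| < a (N y)} ∈ 𝓝 (σ y, x y) :=
    (isOpen_lt (by fun_prop) continuous_const).mem_nhds (hx y)
  filter_upwards [this] with p hp
  exact (hΦ (N y) p.1 p.2 hp).symm

/-- Two laminations with the same combinatorics are homeomorphic. -/
theorem IsLamination.nonempty_homeomorph (hq : IsLineSystem ori q) (hq' : IsLineSystem ori q')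
    (h : IsLamination tgt q T E) (h' : IsLamination tgt q' T' E') : Nonempty (Y ≃ₜ Y') := by
  obtain ⟨a, ha, hab, hex⟩ := hq.exists_radii
  obtain ⟨a', ha', hab', hex'⟩ := hq'.exists_radii
  obtain ⟨H, hH1, hH2⟩ := hq.exists_intertwining hq' tgt ha ha' hab hab'
  have hs1 : ∀ N i, (H N i).symm (a' N) = a N ∧ (H N i).symm (-a' N) = -a N := fun N i =>
    ⟨by rw [← (hH1 N i).1, OrderIso.symm_apply_apply],
      by rw [← (hH1 N i).2, OrderIso.symm_apply_apply]⟩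
  obtain ⟨Φ, hΦc, hΦ⟩ := h.exists_continuous_map h' hab hex H hH2
  obtain ⟨Ψ, hΨc, hΨ⟩ := h'.exists_continuous_map h hab' hex' (fun N i => (H N i).symm) (by
    intro N s x hx
    have h1 := abs_orderIso_le (hs1 N (tgt s)).1 (hs1 N (tgt s)).2 hx
    have h2 := hH2 N s _ h1
    rw [OrderIso.apply_symm_apply] at h2
    rw [← h2, OrderIso.symm_apply_apply])
  refine ⟨⟨⟨Φ, Ψ, fun y => ?_, fun y => ?_⟩, hΦc, hΨc⟩⟩
  · obtain ⟨N, σ, x, hx, rfl⟩ := h.exists_mem hex y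
    rw [hΦ N σ x hx, hΨ N σ _ (abs_orderIso_lt (hH1 _ _).1 (hH1 _ _).2 hx),
      OrderIso.symm_apply_apply]
  · obtain ⟨N, σ, x, hx, rfl⟩ := h'.exists_mem hex' y
    rw [hΨ N σ x hx, hΦ N σ _ (abs_orderIso_lt (hs1 _ _).1 (hs1 _ _).2 hx),
      OrderIso.apply_symm_apply]

end Lamination

/-- A continuous map of `Itinerary tgt × ℝ` with open range, for which the symbols of the itinerary
and the coordinate are determined by open conditions, is an open embedding. -/
theorem isOpenEmbedding_of_code {Y : Type*} [TopologicalSpace Y] {tgt : Cell len → Fin n}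
    {E : Itinerary tgt × ℝ → Y} (hE : Continuous E) (hr : IsOpen (range E))
    (hc : ∀ k s, ∃ O : Set Y, IsOpen O ∧ ∀ σ x, E (σ, x) ∈ O ↔ σ.1 k = s)
    (hp : ∀ W : Set ℝ, IsOpen W → ∃ O : Set Y, IsOpen O ∧ ∀ σ x, E (σ, x) ∈ O ↔ x ∈ W) :
    IsOpenEmbedding E := by
  choose O hO hOE using hc
  choose! P hP hPE using hp
  have hinj : Function.Injective E := by
    rintro ⟨σ, x⟩ ⟨σ', x'⟩ h
    have h1 : σ = σ' := Subtype.ext (funext fun k =>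
      ((hOE k (σ'.1 k) σ x).1 (h ▸ (hOE k _ σ' x').2 rfl)))
    have h2 : x = x' := by
      by_contra hne
      have h3 := (hPE {x}ᶜ isOpen_compl_singleton σ x)
      rw [h, hPE _ isOpen_compl_singleton] at h3
      exact h3.1 (fun h4 => hne h4.symm) rfl
    rw [h1, h2]
  choose L hL using fun y : range E => y.2
  have hinv : ∀ z, L ⟨E z, mem_range_self z⟩ = z := fun z => hinj (hL _)
  have hLc : Continuous L := by
    refine Continuous.prodMk (f := fun y => (L y).1) (g := fun y => (L y).2) ?_ ?_
    · refine Continuous.subtype_mk (continuous_pi fun k => ?_) _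
      refine continuous_discrete_rng.2 fun s => ?_
      convert (hO k s).preimage continuous_subtype_val using 1
      ext ⟨_, z, rfl⟩
      rw [mem_preimage, mem_preimage, hOE k s z.1 z.2, hinv]
      rfl
    · refine continuous_def.2 fun W hW => ?_
      convert (hP W hW).preimage continuous_subtype_val using 1
      ext ⟨_, z, rfl⟩
      rw [mem_preimage, mem_preimage, hPE W hW z.1 z.2, hinv]
  refine IsOpenEmbedding.of_continuous_injective_isOpenMap hE hinj fun U hU => ?_
  have h1 := hr.isOpenEmbedding_subtypeVal.isOpenMap _ (hU.preimage hLc)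
  convert h1 using 1
  ext y
  constructor
  · rintro ⟨z, hz, rfl⟩
    exact ⟨⟨E z, mem_range_self z⟩, by simpa [hinv] using hz, rfl⟩
  · rintro ⟨⟨_, z, rfl⟩, hz, rfl⟩
    exact ⟨z, by simpa [hinv] using hz, rfl⟩

theorem continuous_lineIter {tgt : Cell len → Fin n} {q : Cell len → ℝ → ℝ}
    (hq : ∀ s, Continuous (q s)) (k : ℕ) :
    Continuous fun p : Itinerary tgt × ℝ => lineIter q p.1.1 p.2 k := by
  induction k with
  | zero => exact continuous_snd
  | succ k ih =>
    have h1 : Continuous fun p : Cell len × ℝ => q p.1 p.2 :=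
      continuous_prod_of_discrete_left.2 hq
    exact h1.comp (((continuous_apply k).comp (continuous_subtype_val.comp continuous_fst)).prodMk
      ih)

/-- The inverse of a strictly monotone map of an interval onto the line. -/
theorem exists_inverse_branch {g : ℝ → ℝ} {J : Set ℝ} (hJ : OrdConnected J) (hg : g '' J = univ)
    (b : Bool) (hmono : b = true → StrictMonoOn g J) (hanti : b = false → StrictAntiOn g J) :
    ∃ q : ℝ → ℝ, IsEmbedding q ∧ range q = J ∧ (∀ y, g (q y) = y) ∧ (∀ t ∈ J, q (g t) = t) ∧
      (b = true → StrictMono q) ∧ (b = false → StrictAnti q) := by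
  choose q hqJ hgq using fun y => (hg.symm ▸ mem_univ y : y ∈ g '' J)
  have hinj : InjOn g J := by
    cases b with
    | true => exact (hmono rfl).injOn
    | false => exact (hanti rfl).injOn
  have hqg : ∀ t ∈ J, q (g t) = t := fun t ht => hinj (hqJ _) ht (hgq _)
  have hr : range q = J := by
    ext t
    exact ⟨fun ⟨y, hy⟩ => hy ▸ hqJ y, fun ht => ⟨g t, hqg t ht⟩⟩
  have h1 : b = true → StrictMono q := fun hb y z hyz => by
    rw [← (hmono hb).lt_iff_lt (hqJ y) (hqJ z), hgq, hgq]; exact hyz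
  have h2 : b = false → StrictAnti q := fun hb y z hyz => by
    rw [← (hanti hb).lt_iff_gt (hqJ y) (hqJ z), hgq, hgq]; exact hyz
  refine ⟨q, ?_, hr, hgq, hqg, h1, h2⟩
  cases b with
  | true => exact (h1 rfl).isEmbedding_of_ordConnected (hr ▸ hJ)
  | false =>
    -- A reflection of the line reduces the decreasing case to the increasing one.
    have h3 : StrictMono fun y => q (-y) := fun y z hyz => h2 rfl (neg_lt_neg hyz)
    have h4 : range (fun y => q (-y)) = J := by
      rw [← hr]; exact (neg_surjective (G := ℝ)).range_comp q
    have h5 := (h3.isEmbedding_of_ordConnected (h4 ▸ hJ)).comp (Homeomorph.neg ℝ).isEmbedding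
    convert h5 using 1
    ext y
    simp

/-! ### The inverse limit of a map of the wedge -/

/-- The lengths of the words of a substitution. -/
abbrev wordLen {n : ℕ} (χ : Letter n → List (Letter n)) (i : Fin n) : ℕ := (χ (i, true)).length

/-- The letter of a substitution at a given place, without its orientation. -/
def letterTgt {n : ℕ} (χ : Letter n → List (Letter n)) (s : Cell (wordLen χ)) : Fin n :=
  ((χ (s.1, true)).get s.2).1

/-- The orientation of the letter of a substitution at a given place. -/
def letterOri {n : ℕ} (χ : Letter n → List (Letter n)) (s : Cell (wordLen χ)) : Bool :=
  ((χ (s.1, true)).get s.2).2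

variable {n : ℕ}

theorem pt_injective {i j : Fin n} {s t : ℝ} (h : pt i s = pt j t) : i = j ∧ s = t := by
  have := OnePoint.coe_injective h
  exact Prod.mk.inj this

theorem pt_ne_base (i : Fin n) (t : ℝ) : pt i t ≠ base n := OnePoint.coe_ne_infty _

theorem eq_base_or_exists_pt (x : Wedge n) : x = base n ∨ ∃ i t, x = pt i t := by
  induction x using OnePoint.rec with
  | infty => exact Or.inl rfl
  | coe p => exact Or.inr ⟨p.1, p.2, rfl⟩

theorem continuous_pt : Continuous fun p : Fin n × ℝ => pt p.1 p.2 := OnePoint.continuous_coe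

theorem isOpen_image_pt (s : Set (Fin n × ℝ)) (hs : IsOpen s) :
    IsOpen ((fun p : Fin n × ℝ => pt p.1 p.2) '' s) :=
  OnePoint.isOpenEmbedding_coe.isOpenMap s hs

/-- The branches of a map of the wedge that follows a pattern. -/
theorem FollowsPattern.exists_branches {f : Wedge n → Wedge n} (hf : Continuous f)
    {χ : Letter n → List (Letter n)} (h : FollowsPattern f χ) :
    ∃ q : Cell (wordLen χ) → ℝ → ℝ, IsLineSystem (letterOri χ) q ∧
      (∀ s, IsOpen (range (q s))) ∧ (∀ s y, f (pt s.1 (q s y)) = pt (letterTgt χ s) y) ∧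
      ∀ i t, f (pt i t) ≠ base n → ∃ j y, t = q ⟨i, j⟩ y := by
  choose J hJ hg using fun i => (h i).1
  choose g hg1 hg2 hg3 hg4 using hg
  have hcomp : ∀ i j, ∃ t, J i j = connectedComponentIn {t : ℝ | f (pt i t) ≠ base n} t := by
    intro i j
    obtain ⟨t, -, ht⟩ := ((hJ i).1 (J i j)).1 ⟨j, rfl⟩
    exact ⟨t, ht⟩
  have hopen : ∀ i, IsOpen {t : ℝ | f (pt i t) ≠ base n} := by
    intro i
    have h1 : Continuous fun t : ℝ => f (pt i t) :=
      hf.comp (continuous_pt.comp (continuous_const.prodMk continuous_id))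
    exact (isOpen_compl_singleton (x := base n)).preimage h1
  have hord : ∀ i j, OrdConnected (J i j) := by
    intro i j
    obtain ⟨t, ht⟩ := hcomp i j
    rw [ht]; exact isPreconnected_connectedComponentIn.ordConnected
  have hJo : ∀ i j, IsOpen (J i j) := by
    intro i j
    obtain ⟨t, ht⟩ := hcomp i j
    rw [ht]; exact (hopen i).connectedComponentIn
  choose q hq1 hq2 hq3 hq4 hq5 hq6 using fun s : Cell (wordLen χ) =>
    exists_inverse_branch (hord s.1 s.2) (hg2 s.1 s.2) _ (hg3 s.1 s.2) (hg4 s.1 s.2)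
  have hmem : ∀ s y, q s y ∈ J s.1 s.2 := fun s y => hq2 s ▸ mem_range_self y
  refine ⟨q, ⟨hq5, hq6, hq1, fun i j j' hjj x y => ?_⟩, fun s => ?_, fun s y => ?_,
    fun i t ht => ?_⟩
  · exact (hJ i).2 j j' hjj _ (hmem ⟨i, j⟩ x) _ (hmem ⟨i, j'⟩ y)
  · rw [hq2]; exact hJo _ _
  · rw [hg1 _ _ _ (hmem s y), hq3]; rfl
  · obtain ⟨j, hj⟩ := ((hJ i).1 _).2 ⟨t, ht, rfl⟩
    have h1 : t ∈ J i j := by rw [hj]; exact mem_connectedComponentIn ht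
    exact ⟨j, g i j t, (hq4 ⟨i, j⟩ t h1).symm⟩

/-- The shift homeomorphism of the inverse limit without the base point. -/
def invLimitShift {f : Wedge n → Wedge n} (hf : Continuous f) (hb : f (base n) = base n) :
    ↥(invLimit f \ {basePoint n}) ≃ₜ ↥(invLimit f \ {basePoint n}) where
  toFun x := ⟨fun k => f (x.1 k), fun k => congrArg f (x.2.1 k), fun h => x.2.2 (by
    funext k
    rw [← x.2.1 k]
    exact congrFun h (k + 1))⟩
  invFun x := ⟨fun k => x.1 (k + 1), fun k => x.2.1 (k + 1), fun h => x.2.2 (by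
    funext k
    rw [← x.2.1 k, show x.1 (k + 1) = base n from congrFun h k, hb]
    rfl)⟩
  left_inv x := Subtype.ext (funext fun k => x.2.1 k)
  right_inv x := Subtype.ext (funext fun k => x.2.1 k)
  continuous_toFun := by
    refine Continuous.subtype_mk (continuous_pi fun k => ?_) _
    exact hf.comp ((continuous_apply k).comp continuous_subtype_val)
  continuous_invFun := by
    refine Continuous.subtype_mk (continuous_pi fun k => ?_) _
    exact (continuous_apply (k + 1)).comp continuous_subtype_val

theorem IsLineSystem.cell_ext {len : Fin n → ℕ} {ori : Cell len → Bool} {q : Cell len → ℝ → ℝ}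
    (hq : IsLineSystem ori q) {s s' : Cell len} (h : s.1 = s'.1) {x y : ℝ} (hxy : q s x = q s' y) :
    s = s' := by
  obtain ⟨i, j⟩ := s
  obtain ⟨i', j'⟩ := s'
  obtain rfl : i = i' := h
  rcases lt_trichotomy j j' with h1 | rfl | h1
  · exact absurd hxy (hq.order i j j' h1 x y).ne
  · rfl
  · exact absurd hxy (hq.order i j' j h1 y x).ne'

/-- The inverse limit of a map of the wedge that follows a pattern is a lamination away from the
base point. -/
theorem FollowsPattern.exists_lamination {f : Wedge n → Wedge n} (hf : Continuous f)
    (hb : f (base n) = base n) {χ : Letter n → List (Letter n)} (h : FollowsPattern f χ) :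
    ∃ q : Cell (wordLen χ) → ℝ → ℝ, IsLineSystem (letterOri χ) q ∧
      ∃ T : ↥(invLimit f \ {basePoint n}) ≃ₜ ↥(invLimit f \ {basePoint n}), ∃ E,
        IsLamination (letterTgt χ) q T E := by
  obtain ⟨q, hq, hqo, hfq, hcov⟩ := h.exists_branches hf
  -- The symbol `σ k` is the branch through the coordinate of index `k + 1`; hence that coordinate
  -- lies on the circle `(σ k).1`, which is the target of `σ (k + 1)`.
  have hE0 : ∀ (σ : Itinerary (letterTgt χ)) x k,
      f (pt (letterTgt χ (σ.1 (k + 1))) (lineIter q σ.1 x (k + 1))) =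
        pt (letterTgt χ (σ.1 k)) (lineIter q σ.1 x k) := by
    intro σ x k
    rw [← σ.2 k]
    exact hfq _ _
  let E : Itinerary (letterTgt χ) × ℝ → ↥(invLimit f \ {basePoint n}) := fun p =>
    ⟨fun k => pt (letterTgt χ (p.1.1 k)) (lineIter q p.1.1 p.2 k), fun k => hE0 p.1 p.2 k,
      fun h => pt_ne_base _ _ (congrFun h 0)⟩
  have hEc : Continuous E := by
    refine Continuous.subtype_mk (continuous_pi fun k => ?_) _
    refine continuous_pt.comp (Continuous.prodMk ?_ (continuous_lineIter (fun s =>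
      (hq.emb s).continuous) k))
    exact (continuous_of_discreteTopology (f := letterTgt χ)).comp
      ((continuous_apply k).comp (continuous_subtype_val.comp continuous_fst))
  -- If `y 0 ≠ b`, no later coordinate equals `b`, since `b` is fixed; so every backward step runs
  -- along a branch.
  have hrange : range E = {y | y.1 0 ≠ base n} := by
    ext y
    constructor
    · rintro ⟨p, rfl⟩; exact pt_ne_base _ _
    · intro hy
      have hne : ∀ k, y.1 k ≠ base n := by
        intro k
        induction k with
        | zero => exact hy
        | succ k ih => intro h1; exact ih (by rw [← y.2.1 k, h1, hb])
      choose i t hit using fun k => (eq_base_or_exists_pt (y.1 k)).resolve_left (hne k)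
      choose j u hju using fun k => hcov (i (k + 1)) (t (k + 1)) (by
        rw [← hit, y.2.1 k]; exact hne k)
      have hstep : ∀ k, letterTgt χ ⟨i (k + 1), j k⟩ = i k ∧ u k = t k := by
        intro k
        have h1 := y.2.1 k
        rw [hit, hju, hit k] at h1
        exact pt_injective ((hfq ⟨i (k + 1), j k⟩ (u k)).symm.trans h1)
      let σ : Itinerary (letterTgt χ) := ⟨fun k => ⟨i (k + 1), j k⟩, fun k =>
        (hstep (k + 1)).1.symm⟩
      refine ⟨(σ, t 0), Subtype.ext (funext fun k => ?_)⟩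
      have h2 : lineIter q σ.1 (t 0) k = t k := by
        induction k with
        | zero => rfl
        | succ k ih => rw [hju k, (hstep k).2, ← ih]; rfl
      rw [hit k]
      change pt (letterTgt χ ⟨i (k + 1), j k⟩) (lineIter q σ.1 (t 0) k) = _
      rw [h2, (hstep k).1]
  have hcoord : ∀ k, Continuous fun y : ↥(invLimit f \ {basePoint n}) => y.1 k := fun k =>
    (continuous_apply k).comp continuous_subtype_val
  refine ⟨q, hq, invLimitShift hf hb, E, ?_, ?_, ?_⟩
  · refine isOpenEmbedding_of_code hEc ?_ (fun k s => ?_) fun W hW => ?_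
    · rw [hrange]
      exact (isOpen_compl_singleton (x := base n)).preimage (hcoord 0)
    · refine ⟨{y | y.1 (k + 1) ∈ (fun p : Fin n × ℝ => pt p.1 p.2) '' ({s.1} ×ˢ range (q s))},
        (isOpen_image_pt _ ((isOpen_discrete _).prod (hqo s))).preimage (hcoord (k + 1)),
        fun σ x => ⟨?_, ?_⟩⟩
      · rintro ⟨⟨i, _⟩, ⟨hi, z, rfl⟩, h1⟩
        obtain ⟨h2, h3⟩ := pt_injective h1
        dsimp only at h2 h3
        refine hq.cell_ext ?_ h3.symm
        rw [σ.2 k, ← h2]; exact hi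
      · rintro rfl
        refine ⟨((σ.1 k).1, lineIter q σ.1 x (k + 1)), ⟨rfl, ⟨_, rfl⟩⟩, ?_⟩
        change pt _ _ = pt _ _
        rw [σ.2 k]
    · refine ⟨{y | y.1 0 ∈ (fun p : Fin n × ℝ => pt p.1 p.2) '' (univ ×ˢ W)},
        (isOpen_image_pt _ (isOpen_univ.prod hW)).preimage (hcoord 0), fun σ x => ⟨?_, ?_⟩⟩
      · rintro ⟨⟨i, z⟩, ⟨-, hz⟩, h1⟩
        obtain ⟨-, h3⟩ := pt_injective h1
        dsimp only at h3
        exact (show z = x from h3) ▸ hz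
      · intro hx
        exact ⟨(_, x), ⟨mem_univ _, hx⟩, rfl⟩
  · intro y
    have h1 : ∃ N, y.1 N ≠ base n := by
      by_contra! h1
      exact y.2.2 (funext h1)
    obtain ⟨N, hN⟩ := h1
    have hsymm : ∀ N k, (((invLimitShift hf hb).symm)^[N] y).1 k = y.1 (k + N) := by
      intro N
      induction N with
      | zero => exact fun k => rfl
      | succ N ih =>
        intro k
        rw [Function.iterate_succ_apply']
        exact (ih (k + 1)).trans (by rw [add_assoc, add_comm 1 N])
    have h2 : ((invLimitShift hf hb).symm)^[N] y ∈ range E := by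
      rw [hrange]
      change _ ≠ _
      rw [hsymm, zero_add]
      exact hN
    obtain ⟨p, hp⟩ := h2
    refine ⟨N, p, ?_⟩
    rw [hp]
    exact (Function.LeftInverse.iterate (invLimitShift hf hb).right_inv N) y
  · intro σ x
    refine Subtype.ext (funext fun k => ?_)
    change f (pt (letterTgt χ (σ.1 (k + 1))) (lineIter q (fun l => σ.1 (l + 1)) (q (σ.1 0) x) k)) = _
    rw [lineIter_shift, hE0]

/-! ### Nested intersections -/

/-- If disjoint open sets split the intersection, then by compactness they already cover, and hence
split, some `A N`. -/
theorem isPreconnected_iInter_of_antitone {X : Type*} [TopologicalSpace X] [T2Space X]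
    {A : ℕ → Set X} (hA : Antitone A) (hc : ∀ N, IsCompact (A N)) (hp : ∀ N, IsPreconnected (A N)) :
    IsPreconnected (⋂ N, A N) := by
  have hcl : ∀ N, IsClosed (A N) := fun N => (hc N).isClosed
  have hcpt : IsCompact (⋂ N, A N) := (hc 0).of_isClosed_subset (isClosed_iInter hcl)
    (iInter_subset _ 0)
  rw [isPreconnected_closed_iff]
  intro B C hB hC hsub hBn hCn
  by_contra hemp
  rw [not_nonempty_iff_eq_empty] at hemp
  obtain ⟨U, W, hU, hW, hBU, hCW, hUW⟩ := SeparatedNhds.of_isCompact_isCompact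
    (hcpt.inter_right hB) (hcpt.inter_right hC) (by
      rw [disjoint_iff_inter_eq_empty, ← hemp]
      ext x; simp only [mem_inter_iff]; tauto)
  obtain ⟨N, hN⟩ := exists_subset_nhds_of_isCompact' (directed_of_isDirected_le hA) hc hcl
    (U := U ∪ W) (fun x hx => (hU.union hW).mem_nhds ((hsub hx).imp
      (fun h => hBU ⟨hx, h⟩) fun h => hCW ⟨hx, h⟩))
  obtain ⟨x, hx⟩ := hBn
  obtain ⟨y, hy⟩ := hCn
  obtain ⟨z, -, hzU, hzW⟩ := hp N U W hU hW hN ⟨x, mem_iInter.1 hx.1 N, hBU hx⟩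
    ⟨y, mem_iInter.1 hy.1 N, hCW hy⟩
  exact disjoint_left.1 hUW hzU hzW

theorem isPreconnected_of_ordConnected_itv {I : Set Itv} (hI : OrdConnected I) :
    IsPreconnected I := by
  rw [← IsInducing.subtypeVal.isPreconnected_image]
  refine OrdConnected.isPreconnected ⟨?_⟩
  rintro _ ⟨x, hx, rfl⟩ _ ⟨y, hy, rfl⟩ z hz
  exact ⟨⟨z, x.2.1.trans hz.1, hz.2.trans y.2.2⟩, hI.out hx hy hz, rfl⟩

theorem isPreconnected_prod_univ {d : ℕ} {I : Set Itv} (hI : OrdConnected I) :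
    IsPreconnected (I ×ˢ (univ : Set (Fin d → Itv))) := by
  refine (isPreconnected_of_ordConnected_itv hI).prod ?_
  rw [← pi_univ univ]
  exact isPreconnected_univ_pi fun _ => isPreconnected_of_ordConnected_itv ordConnected_univ

/-! ### Rectangles and their first coordinates -/

/-- The points whose whole orbit stays in the rectangles. -/
def coreSet {n d : ℕ} {M : Type*} [TopologicalSpace M] (F : M ≃ₜ M) (φ : Fin n → Box d → M) :
    Set M :=
  {z | (∀ l, F^[l] z ∈ rects φ) ∧ ∀ l, F.symm^[l] z ∈ rects φ}

/-- The points whose backward orbit stays in the rectangles. -/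
def pastSet {n d : ℕ} {M : Type*} [TopologicalSpace M] (F : M ≃ₜ M) (φ : Fin n → Box d → M) :
    Set M :=
  {z | ∀ l, F.symm^[l] z ∈ rects φ}

/-- `w` and `z` are backward asymptotic. -/
def Asymptotic {M : Type*} [EMetricSpace M] (F : M ≃ₜ M) (w z : M) : Prop :=
  Tendsto (fun N : ℕ => edist (F.symm^[N] w) (F.symm^[N] z)) atTop (𝓝 0)

/-- The part of a rectangle that lies over `J s`. -/
def cellSet {n d : ℕ} {M : Type*} {len : Fin n → ℕ} (φ : Fin n → Box d → M)
    (J : Cell len → Set Itv) (s : Cell len) : Set M := φ s.1 '' (J s ×ˢ univ)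

/-- Two points lie in the same cell. -/
def SameCell {n d : ℕ} {M : Type*} {len : Fin n → ℕ} (φ : Fin n → Box d → M)
    (J : Cell len → Set Itv) (z w : M) : Prop := ∃ s, z ∈ cellSet φ J s ∧ w ∈ cellSet φ J s

/-- The topological properties of a system of Markov rectangles whose induced map on the first
coordinates has the branches `g s : J s → [-1, 1]`. -/
structure IsRectSystem {n d : ℕ} {M : Type*} [EMetricSpace M] {len : Fin n → ℕ} (F : M ≃ₜ M)
    (φ : Fin n → Box d → M) (tgt : Cell len → Fin n) (J : Cell len → Set Itv)
    (g : Cell len → Itv → Itv) : Prop where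
  emb : ∀ i, IsEmbedding (φ i)
  disjoint : ∀ i j, i ≠ j → Disjoint (range (φ i)) (range (φ j))
  closed : ∀ s, IsClosed (J s)
  ord : ∀ s, OrdConnected (J s)
  disj : ∀ s s' : Cell len, s.1 = s'.1 → ∀ t, t ∈ J s → t ∈ J s' → s = s'
  mono : ∀ s, MonotoneOn (g s) (J s) ∨ AntitoneOn (g s) (J s)
  surj : ∀ s, g s '' J s = univ
  map : ∀ s t x, t ∈ J s → F (φ s.1 (t, x)) ∈ fiber φ (tgt s) (g s t)
  cover : ∀ i t x, F (φ i (t, x)) ∈ rects φ → ∃ s : Cell len, s.1 = i ∧ t ∈ J s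
  zero : ∀ T ⊆ coreSet F φ, IsPreconnected T → T.Subsingleton
  nonempty : ∀ i, (range (φ i) ∩ coreSet F φ).Nonempty
  transverse : ∀ i, ∀ w ∈ coreSet F φ, w ∈ range (φ i) → ∀ T ⊆ range (φ i), IsPreconnected T →
    w ∈ T → (∀ y ∈ T, Asymptotic F y w) → ∀ t, (T ∩ fiber φ i t).Subsingleton

section

set_option linter.unusedSectionVars false

variable {n d : ℕ} {M : Type*} [EMetricSpace M] {len : Fin n → ℕ} {F : M ≃ₜ M}
  {φ : Fin n → Box d → M} {tgt : Cell len → Fin n} {J : Cell len → Set Itv}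
  {g : Cell len → Itv → Itv}

theorem mem_rects_iff {z : M} : z ∈ rects φ ↔ ∃ i t, z ∈ fiber φ i t := by
  simp only [rects, mem_iUnion, fiber, mem_range, Prod.exists]

theorem mem_rects_of_mem_fiber {z : M} {i : Fin n} {t : Itv} (h : z ∈ fiber φ i t) :
    z ∈ rects φ := mem_rects_iff.2 ⟨i, t, h⟩

theorem fiber_subset_range (i : Fin n) (t : Itv) : fiber φ i t ⊆ range (φ i) := by
  rintro _ ⟨x, rfl⟩; exact mem_range_self _

theorem mem_range_iff_fiber {z : M} {i : Fin n} : z ∈ range (φ i) ↔ ∃ t, z ∈ fiber φ i t := by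
  simp only [fiber, mem_range, Prod.exists]

theorem fiber_nonempty (i : Fin n) (t : Itv) : (fiber φ i t).Nonempty :=
  ⟨φ i (t, fun _ => t), mem_range_self _⟩

theorem mem_cellSet_iff {z : M} {s : Cell len} :
    z ∈ cellSet φ J s ↔ ∃ t ∈ J s, z ∈ fiber φ s.1 t := by
  constructor
  · rintro ⟨⟨t, x⟩, ⟨ht, -⟩, rfl⟩
    exact ⟨t, ht, x, rfl⟩
  · rintro ⟨t, ht, x, rfl⟩
    exact ⟨(t, x), ⟨ht, mem_univ _⟩, rfl⟩

theorem cellSet_subset_range (s : Cell len) : cellSet φ J s ⊆ range (φ s.1) := image_subset_range _ _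

theorem iterate_apply_symm_iterate (F : M ≃ₜ M) (N : ℕ) (z : M) : F^[N] (F.symm^[N] z) = z :=
  (Function.LeftInverse.iterate F.right_inv N) z

theorem symm_iterate_apply_iterate (F : M ≃ₜ M) (N : ℕ) (z : M) : F.symm^[N] (F^[N] z) = z :=
  (Function.LeftInverse.iterate F.left_inv N) z

theorem apply_symm_iterate_succ (F : M ≃ₜ M) (N : ℕ) (z : M) :
    F (F.symm^[N + 1] z) = F.symm^[N] z := by
  rw [Function.iterate_succ_apply', F.apply_symm_apply]

namespace IsRectSystem

theorem range_unique (h : IsRectSystem F φ tgt J g) {z : M} {i j : Fin n} (hi : z ∈ range (φ i))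
    (hj : z ∈ range (φ j)) : i = j := by
  by_contra hne
  exact disjoint_left.1 (h.disjoint i j hne) hi hj

theorem fiber_unique (h : IsRectSystem F φ tgt J g) {z : M} {i j : Fin n} {t u : Itv}
    (hi : z ∈ fiber φ i t) (hj : z ∈ fiber φ j u) : i = j ∧ t = u := by
  obtain rfl := h.range_unique (fiber_subset_range _ _ hi) (fiber_subset_range _ _ hj)
  obtain ⟨x, hx⟩ := hi
  obtain ⟨y, hy⟩ := hj
  exact ⟨rfl, (Prod.mk.inj ((h.emb i).injective (hx.trans hy.symm))).1⟩

theorem map_fiber (h : IsRectSystem F φ tgt J g) {z : M} {s : Cell len} {t : Itv} (ht : t ∈ J s)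
    (hz : z ∈ fiber φ s.1 t) : F z ∈ fiber φ (tgt s) (g s t) := by
  obtain ⟨x, rfl⟩ := hz
  exact h.map s t x ht

theorem map_cellSet (h : IsRectSystem F φ tgt J g) {z : M} {s : Cell len}
    (hz : z ∈ cellSet φ J s) : F z ∈ range (φ (tgt s)) := by
  obtain ⟨t, ht, hz⟩ := mem_cellSet_iff.1 hz
  exact fiber_subset_range _ _ (h.map_fiber ht hz)

theorem cellSet_subset_rects {s : Cell len} : cellSet φ J s ⊆ rects φ := fun _ hz =>
  mem_iUnion.2 ⟨s.1, cellSet_subset_range s hz⟩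

theorem exists_cell_of_fiber (h : IsRectSystem F φ tgt J g) {z : M} {i : Fin n} {t : Itv}
    (hz : z ∈ fiber φ i t) (hF : F z ∈ rects φ) : ∃ s : Cell len, s.1 = i ∧ t ∈ J s := by
  obtain ⟨x, rfl⟩ := hz
  exact h.cover i t x hF

theorem exists_cell (h : IsRectSystem F φ tgt J g) {z : M} (hz : z ∈ rects φ)
    (hF : F z ∈ rects φ) : ∃ s, z ∈ cellSet φ J s := by
  obtain ⟨i, t, hz⟩ := mem_rects_iff.1 hz
  obtain ⟨s, rfl, hs⟩ := h.exists_cell_of_fiber hz hF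
  exact ⟨s, mem_cellSet_iff.2 ⟨t, hs, hz⟩⟩

theorem cell_unique (h : IsRectSystem F φ tgt J g) {z : M} {s s' : Cell len}
    (hs : z ∈ cellSet φ J s) (hs' : z ∈ cellSet φ J s') : s = s' := by
  obtain ⟨t, ht, hz⟩ := mem_cellSet_iff.1 hs
  obtain ⟨t', ht', hz'⟩ := mem_cellSet_iff.1 hs'
  obtain ⟨h1, rfl⟩ := h.fiber_unique hz hz'
  exact h.disj s s' h1 t ht ht'

theorem continuous_symm_iterate (N : ℕ) : Continuous F.symm^[N] := F.symm.continuous.iterate N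

theorem continuous_iterate (N : ℕ) : Continuous F^[N] := F.continuous.iterate N

theorem isCompact_range (h : IsRectSystem F φ tgt J g) (i : Fin n) : IsCompact (range (φ i)) :=
  _root_.isCompact_range (h.emb i).continuous

theorem isCompact_rects (h : IsRectSystem F φ tgt J g) : IsCompact (rects φ) :=
  isCompact_iUnion h.isCompact_range

theorem isCompact_fiber (h : IsRectSystem F φ tgt J g) (i : Fin n) (t : Itv) :
    IsCompact (fiber φ i t) :=
  _root_.isCompact_range ((h.emb i).continuous.comp (by fun_prop))

theorem isCompact_cellSet (h : IsRectSystem F φ tgt J g) (s : Cell len) :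
    IsCompact (cellSet φ J s) :=
  ((h.closed s).isCompact.prod isCompact_univ).image (h.emb s.1).continuous

end IsRectSystem

/-- The sets that lie over an interval of first coordinates. -/
def IsStrip (φ : Fin n → Box d → M) (X : Set M) : Prop :=
  ∃ (i : Fin n) (I : Set Itv), OrdConnected I ∧ X = φ i '' (I ×ˢ univ)

/-! ### Strips and itineraries -/

namespace IsRectSystem

theorem isPreconnected_strip (h : IsRectSystem F φ tgt J g) {X : Set M} (hX : IsStrip φ X) :
    IsPreconnected X := by
  obtain ⟨i, I, hI, rfl⟩ := hX
  exact (isPreconnected_prod_univ hI).image _ (h.emb i).continuous.continuousOn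

theorem isStrip_cellSet (h : IsRectSystem F φ tgt J g) (s : Cell len) :
    IsStrip φ (cellSet φ J s) := ⟨s.1, J s, h.ord s, rfl⟩

/-- Fibers go into fibers, so membership in the pullback depends on the first coordinate only;
monotonicity of the branch pulls intervals back to intervals. -/
theorem isStrip_pullback (h : IsRectSystem F φ tgt J g) (s : Cell len) {X : Set M}
    (hX : IsStrip φ X) : IsStrip φ (cellSet φ J s ∩ F ⁻¹' X) := by
  obtain ⟨i, I, hI, rfl⟩ := hX
  refine ⟨s.1, {t | t ∈ J s ∧ tgt s = i ∧ g s t ∈ I}, ⟨?_⟩, ?_⟩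
  · rintro t ⟨ht, hi, hgt⟩ u ⟨hu, -, hgu⟩ v hv
    have hvJ := (h.ord s).out ht hu hv
    refine ⟨hvJ, hi, ?_⟩
    rcases h.mono s with hm | hm
    · exact hI.out hgt hgu ⟨hm ht hvJ hv.1, hm hvJ hu hv.2⟩
    · exact hI.out hgu hgt ⟨hm hvJ hu hv.2, hm ht hvJ hv.1⟩
  · ext z
    constructor
    · rintro ⟨⟨⟨t, x⟩, ⟨ht, -⟩, rfl⟩, ⟨u, y⟩, ⟨hu, -⟩, hy⟩
      have h1 := h.map s t x ht
      obtain ⟨h2, h3⟩ := h.fiber_unique h1 ⟨y, hy⟩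
      exact ⟨(t, x), ⟨⟨ht, h2, by rw [h3]; exact hu⟩, mem_univ _⟩, rfl⟩
    · rintro ⟨⟨t, x⟩, ⟨⟨ht, rfl, hgt⟩, -⟩, rfl⟩
      obtain ⟨y, hy⟩ := h.map s t x ht
      exact ⟨⟨(t, x), ⟨ht, mem_univ _⟩, rfl⟩, (g s t, y), ⟨hgt, mem_univ _⟩, hy⟩

/-- The set of points with a prescribed past in a decreasing sequence of strips is connected. -/
theorem isPreconnected_past (h : IsRectSystem F φ tgt J g) {X : ℕ → Set M}
    (hX : ∀ N, IsStrip φ (X N)) (hc : ∀ N, IsCompact (X N)) (hanti : Antitone X)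
    (b : ℕ → Cell len) :
    IsPreconnected {y | (∀ N, y ∈ X N) ∧ ∀ l, F.symm^[l + 1] y ∈ cellSet φ J (b l)} := by
  let A : ℕ → Set M := fun N => {y | y ∈ X N ∧ ∀ l < N, F.symm^[l + 1] y ∈ cellSet φ J (b l)}
  have hA : {y | (∀ N, y ∈ X N) ∧ ∀ l, F.symm^[l + 1] y ∈ cellSet φ J (b l)} = ⋂ N, A N := by
    ext y
    simp only [mem_ofPred_eq, mem_iInter, A]
    exact ⟨fun hy N => ⟨hy.1 N, fun l _ => hy.2 l⟩,
      fun hy => ⟨fun N => (hy N).1, fun l => (hy (l + 1)).2 l (Nat.lt_succ_self l)⟩⟩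
  rw [hA]
  refine isPreconnected_iInter_of_antitone (fun N N' hN y hy => ⟨hanti hN hy.1, fun l hl =>
    hy.2 l (hl.trans_le hN)⟩) (fun N => ?_) fun N => ?_
  · refine (hc N).of_isClosed_subset ?_ fun y hy => hy.1
    have : A N = X N ∩ ⋂ l, ⋂ _ : l < N, F.symm^[l + 1] ⁻¹' cellSet φ J (b l) := by
      ext y; simp [A]
    rw [this]
    exact (hc N).isClosed.inter (isClosed_iInter fun l => isClosed_iInter fun _ =>
      (h.isCompact_cellSet _).isClosed.preimage (continuous_symm_iterate _))
  -- Pulling a strip back through the past cells one by one gives a strip `W`; then `A N` is the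
  -- image of `W` under `F^[N]`.
  · have key : ∀ K Y, IsStrip φ Y → ∃ W, IsStrip φ W ∧ ∀ y, F.symm^[K] y ∈ W ↔
        (y ∈ Y ∧ ∀ l < K, F.symm^[l + 1] y ∈ cellSet φ J (b l)) := by
      intro K Y hY
      induction K with
      | zero => exact ⟨Y, hY, fun y => by simp⟩
      | succ K ih =>
        obtain ⟨W, hW, hWy⟩ := ih
        refine ⟨_, h.isStrip_pullback (b K) hW, fun y => ?_⟩
        rw [mem_inter_iff, mem_preimage, apply_symm_iterate_succ, hWy]
        constructor
        · rintro ⟨h1, h2, h3⟩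
          refine ⟨h2, fun l hl => ?_⟩
          rcases Nat.lt_succ_iff_lt_or_eq.1 hl with h4 | rfl
          · exact h3 l h4
          · exact h1
        · rintro ⟨h1, h2⟩
          exact ⟨h2 K (Nat.lt_succ_self K), h1, fun l hl => h2 l (hl.trans (Nat.lt_succ_self K))⟩
    obtain ⟨W, hW, hWy⟩ := key N (X N) (hX N)
    have : A N = F^[N] '' W := by
      ext y
      constructor
      · intro hy
        exact ⟨F.symm^[N] y, (hWy y).2 hy, iterate_apply_symm_iterate F N y⟩
      · rintro ⟨w, hw, rfl⟩
        refine (hWy _).1 ?_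
        rwa [symm_iterate_apply_iterate]
    rw [this]
    exact (h.isPreconnected_strip hW).image _ (continuous_iterate N).continuousOn

theorem isStrip_future (h : IsRectSystem F φ tgt J g) (N : ℕ) (a : ℕ → Cell len) :
    IsStrip φ {y | ∀ l ≤ N, F^[l] y ∈ cellSet φ J (a l)} := by
  induction N generalizing a with
  | zero =>
    convert h.isStrip_cellSet (a 0) using 1
    ext y; simp
  | succ N ih =>
    convert h.isStrip_pullback (a 0) (ih fun l => a (l + 1)) using 1
    ext y
    constructor
    · intro hy
      exact ⟨hy 0 (Nat.zero_le _), fun l hl => hy (l + 1) (Nat.succ_le_succ hl)⟩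
    · rintro ⟨h1, h2⟩ l hl
      rcases l with _ | l
      · exact h1
      · exact h2 l (Nat.le_of_succ_le_succ hl)

theorem isCompact_future (h : IsRectSystem F φ tgt J g) (N : ℕ) (a : ℕ → Cell len) :
    IsCompact {y | ∀ l ≤ N, F^[l] y ∈ cellSet φ J (a l)} := by
  refine (h.isCompact_cellSet (a 0)).of_isClosed_subset ?_ fun y hy => hy 0 (Nat.zero_le _)
  have : {y | ∀ l ≤ N, F^[l] y ∈ cellSet φ J (a l)} =
      ⋂ l, ⋂ _ : l ≤ N, F^[l] ⁻¹' cellSet φ J (a l) := by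
    ext y; simp
  rw [this]
  exact isClosed_iInter fun l => isClosed_iInter fun _ =>
    (h.isCompact_cellSet _).isClosed.preimage (continuous_iterate _)

/-- A point of the core is determined by its two-sided itinerary. -/
theorem eq_of_sameCell (h : IsRectSystem F φ tgt J g) {z w : M}
    (hf : ∀ l, SameCell φ J (F^[l] z) (F^[l] w))
    (hb : ∀ l, SameCell φ J (F.symm^[l + 1] z) (F.symm^[l + 1] w)) : z = w := by
  choose a haz haw using hf
  choose b hbz hbw using hb
  -- The points with the common two-sided itinerary form a connected set, which lies in the core and
  -- so has at most one point.
  have hp := h.isPreconnected_past (fun N => h.isStrip_future N a) (fun N => h.isCompact_future N a)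
    (fun N N' hN y hy l hl => hy l (hl.trans hN)) b
  refine h.zero _ ?_ hp ⟨fun N l _ => haz l, hbz⟩ ⟨fun N l _ => haw l, hbw⟩
  rintro y ⟨hy1, hy2⟩
  refine ⟨fun l => cellSet_subset_rects (hy1 l l le_rfl), fun l => ?_⟩
  rcases l with _ | l
  · exact cellSet_subset_rects (hy1 0 0 le_rfl)
  · exact cellSet_subset_rects (hy2 l)

/-- Every admissible backward itinerary is realized in every fiber of its rectangle. -/
theorem exists_mem_fiber (h : IsRectSystem F φ tgt J g) (σ : Itinerary tgt) (t : Itv) :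
    ∃ z ∈ fiber φ (tgt (σ.1 0)) t, ∀ l, F.symm^[l + 1] z ∈ cellSet φ J (σ.1 l) := by
  choose r hrJ hr using fun s y => (h.surj s ▸ mem_univ y : y ∈ g s '' J s)
  -- Successive preimages of `t` under the branches of `σ`. The fibers over `u l`, moved by `F^[l]`,
  -- decrease inside the given fiber.
  let u : ℕ → Itv := fun l => Nat.rec t (fun l ul => r (σ.1 l) ul) l
  have huJ : ∀ l, u (l + 1) ∈ J (σ.1 l) := fun l => hrJ _ _
  have hug : ∀ l, g (σ.1 l) (u (l + 1)) = u l := fun l => hr _ _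
  let D : ℕ → Set M := fun l => F^[l] '' fiber φ (tgt (σ.1 l)) (u l)
  have hanti : ∀ l, D (l + 1) ⊆ D l := by
    rintro l _ ⟨z, hz, rfl⟩
    rw [← σ.2 l] at hz
    refine ⟨F z, ?_, by rw [← Function.iterate_succ_apply]⟩
    have := h.map_fiber (huJ l) hz
    rwa [hug] at this
  have hcpt : ∀ l, IsCompact (D l) := fun l =>
    (h.isCompact_fiber _ _).image (continuous_iterate l)
  obtain ⟨z, hz⟩ := IsCompact.nonempty_iInter_of_sequence_nonempty_isCompact_isClosed D hanti
    (fun l => (fiber_nonempty _ _).image _) (hcpt 0) fun l => (hcpt l).isClosed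
  have hzl : ∀ l, F.symm^[l] z ∈ fiber φ (tgt (σ.1 l)) (u l) := by
    intro l
    obtain ⟨y, hy, hyz⟩ := mem_iInter.1 hz l
    rw [← hyz, symm_iterate_apply_iterate]
    exact hy
  refine ⟨z, hzl 0, fun l => mem_cellSet_iff.2 ⟨u (l + 1), huJ l, ?_⟩⟩
  rw [σ.2 l]
  exact hzl (l + 1)

/-- Whether a point of a rectangle returns to the rectangles, and to which fiber, depends only on
its first coordinate; so one orbit staying in the rectangles carries its whole fiber along. -/
theorem forward_fiber (h : IsRectSystem F φ tgt J g) {z y : M} {i : Fin n} {t : Itv}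
    (hz : z ∈ fiber φ i t) (hy : y ∈ fiber φ i t) {N : ℕ} (hN : ∀ l ≤ N, F^[l] z ∈ rects φ) :
    ∃ j u, F^[N] z ∈ fiber φ j u ∧ F^[N] y ∈ fiber φ j u := by
  induction N with
  | zero => exact ⟨i, t, hz, hy⟩
  | succ N ih =>
    obtain ⟨j, u, h1, h2⟩ := ih fun l hl => hN l (hl.trans (Nat.le_succ N))
    have h3 := hN (N + 1) le_rfl
    rw [Function.iterate_succ_apply'] at h3
    obtain ⟨s, rfl, hs⟩ := h.exists_cell_of_fiber h1 h3
    rw [Function.iterate_succ_apply', Function.iterate_succ_apply']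
    exact ⟨_, _, h.map_fiber hs h1, h.map_fiber hs h2⟩

theorem forward_sameCell (h : IsRectSystem F φ tgt J g) {z y : M} {i : Fin n} {t : Itv}
    (hz : z ∈ fiber φ i t) (hy : y ∈ fiber φ i t) (hN : ∀ l, F^[l] z ∈ rects φ) (N : ℕ) :
    SameCell φ J (F^[N] z) (F^[N] y) := by
  obtain ⟨j, u, h1, h2⟩ := h.forward_fiber hz hy (N := N) fun l _ => hN l
  have h3 := hN (N + 1)
  rw [Function.iterate_succ_apply'] at h3
  obtain ⟨s, rfl, hs⟩ := h.exists_cell_of_fiber h1 h3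
  exact ⟨s, mem_cellSet_iff.2 ⟨u, hs, h1⟩, mem_cellSet_iff.2 ⟨u, hs, h2⟩⟩

theorem exists_itinerary (h : IsRectSystem F φ tgt J g) {z : M} (hz : z ∈ pastSet F φ) :
    ∃ σ : Itinerary tgt, z ∈ range (φ (tgt (σ.1 0))) ∧
      ∀ l, F.symm^[l + 1] z ∈ cellSet φ J (σ.1 l) := by
  choose σ hσ using fun l => h.exists_cell (hz (l + 1)) (by
    rw [apply_symm_iterate_succ]; exact hz l)
  have h1 : ∀ l, F.symm^[l] z ∈ range (φ (tgt (σ l))) := by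
    intro l
    have := h.map_cellSet (hσ l)
    rwa [apply_symm_iterate_succ] at this
  exact ⟨⟨σ, fun l => h.range_unique (cellSet_subset_range _ (hσ l)) (h1 (l + 1))⟩, h1 0, hσ⟩

theorem mem_pastSet (h : IsRectSystem F φ tgt J g) {z : M} {b : ℕ → Cell len}
    (hb : ∀ l, F.symm^[l + 1] z ∈ cellSet φ J (b l)) : z ∈ pastSet F φ := by
  rintro (_ | l)
  · have := h.map_cellSet (hb 0)
    rw [apply_symm_iterate_succ] at this
    exact mem_iUnion.2 ⟨_, this⟩
  · exact cellSet_subset_rects (hb l)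

theorem coreSet_subset_pastSet : coreSet F φ ⊆ pastSet F φ := fun _ hz => hz.2

/-- A point with the same future as a point of the core lies in the same fiber. -/
theorem mem_fiber_of_sameCell (h : IsRectSystem F φ tgt J g) {z y : M} (hz : z ∈ coreSet F φ)
    (hf : ∀ l, SameCell φ J (F^[l] z) (F^[l] y)) {i : Fin n} {t : Itv} (ht : z ∈ fiber φ i t) :
    y ∈ fiber φ i t := by
  obtain ⟨σ, hi, hσ⟩ := h.exists_itinerary (coreSet_subset_pastSet hz)
  obtain ⟨s, hsz, hsy⟩ := hf 0
  have hi' := h.range_unique (fiber_subset_range _ _ ht) hi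
  have hi'' := h.range_unique hi (cellSet_subset_range _ hsz)
  obtain ⟨u, hu⟩ := mem_range_iff_fiber.1 (cellSet_subset_range _ hsy)
  rw [← hi''] at hu
  obtain ⟨w, hw, hwσ⟩ := h.exists_mem_fiber σ u
  have hfy : ∀ l, F^[l] y ∈ rects φ := fun l => cellSet_subset_rects (hf l).choose_spec.2
  -- `w` has the past of `z` and lies on the fiber of `y`, so it has the future of `y`, which is
  -- that of `z`.
  have hzw : z = w := by
    refine h.eq_of_sameCell (fun l => ?_) fun l => ⟨_, hσ l, hwσ l⟩
    obtain ⟨s1, h1, h2⟩ := hf l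
    obtain ⟨s2, h3, h4⟩ := h.forward_sameCell hu hw hfy l
    obtain rfl := h.cell_unique h2 h3
    exact ⟨_, h1, h4⟩
  subst hzw
  obtain ⟨rfl, rfl⟩ := h.fiber_unique ht hw
  exact hu

end IsRectSystem
end
-- Points determined by their past and their fiber
section

set_option linter.unusedSectionVars false

variable {n d : ℕ} {M : Type*} [EMetricSpace M] {len : Fin n → ℕ} {F : M ≃ₜ M}
  {φ : Fin n → Box d → M} {tgt : Cell len → Fin n} {J : Cell len → Set Itv}
  {g : Cell len → Itv → Itv}

namespace IsRectSystem

/-- Long itineraries determine points of the core uniformly. -/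
theorem exists_cylinder_subset (h : IsRectSystem F φ tgt J g) {W : Set (M × M)}
    (hW : ∀ z, W ∈ 𝓝 (z, z)) : ∃ N, ∀ z w, (∀ l ≤ N, SameCell φ J (F^[l] z) (F^[l] w)) →
      (∀ l ≤ N, SameCell φ J (F.symm^[l + 1] z) (F.symm^[l + 1] w)) → (z, w) ∈ W := by
  let C : Set (M × M) := ⋃ s, cellSet φ J s ×ˢ cellSet φ J s
  have hC : ∀ z w, SameCell φ J z w ↔ (z, w) ∈ C := fun z w => by
    simp only [SameCell, C, mem_iUnion, mem_prod]
  have hCc : IsCompact C := isCompact_iUnion fun s => (h.isCompact_cellSet s).prod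
    (h.isCompact_cellSet s)
  -- Pairs sharing their cells up to time `N` in both directions: a decreasing sequence of compact
  -- sets whose intersection lies in the diagonal.
  let D : ℕ → Set (M × M) := fun N => ⋂ l, ⋂ _ : l ≤ N,
    (Prod.map F^[l] F^[l] ⁻¹' C ∩ Prod.map F.symm^[l + 1] F.symm^[l + 1] ⁻¹' C)
  have hD : ∀ N, IsClosed (D N) := fun N => isClosed_iInter fun l => isClosed_iInter fun _ =>
    (hCc.isClosed.preimage ((continuous_iterate l).prodMap (continuous_iterate l))).inter
      (hCc.isClosed.preimage ((continuous_symm_iterate _).prodMap (continuous_symm_iterate _)))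
  have hDmem : ∀ N z w, (z, w) ∈ D N ↔ ∀ l ≤ N, SameCell φ J (F^[l] z) (F^[l] w) ∧
      SameCell φ J (F.symm^[l + 1] z) (F.symm^[l + 1] w) := by
    intro N z w
    simp only [D, mem_iInter, mem_inter_iff, mem_preimage, Prod.map_apply, hC]
  have hanti : Antitone D := by
    rintro N N' hN ⟨z, w⟩ hzw
    rw [hDmem] at hzw ⊢
    exact fun l hl => hzw l (hl.trans hN)
  have hDc : ∀ N, IsCompact (D N) := by
    intro N
    refine hCc.of_isClosed_subset (hD N) ?_
    rintro ⟨z, w⟩ hzw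
    exact (hC z w).1 (((hDmem N z w).1 hzw 0 (Nat.zero_le _)).1)
  obtain ⟨N, hN⟩ := exists_subset_nhds_of_isCompact' (directed_of_isDirected_le hanti) hDc hD
    (U := W) (by
      rintro ⟨z, w⟩ hzw
      rw [mem_iInter] at hzw
      obtain rfl : z = w := h.eq_of_sameCell
        (fun l => (((hDmem l z w).1 (hzw l)) l le_rfl).1)
        (fun l => (((hDmem l z w).1 (hzw l)) l le_rfl).2)
      exact hW z)
  exact ⟨N, fun z w h1 h2 => hN ((hDmem N z w).2 fun l hl => ⟨h1 l hl, h2 l hl⟩)⟩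

/-- Points with the same past are backward asymptotic. -/
theorem asymptotic_of_sameCell (h : IsRectSystem F φ tgt J g) {z w : M}
    (hb : ∀ l, SameCell φ J (F.symm^[l + 1] z) (F.symm^[l + 1] w)) : Asymptotic F z w := by
  refine ENNReal.tendsto_nhds_zero.2 fun ε hε => ?_
  obtain ⟨N, hN⟩ := h.exists_cylinder_subset (W := {p : M × M | edist p.1 p.2 < ε}) (fun z =>
    (isOpen_lt (by fun_prop) continuous_const).mem_nhds (by simpa using hε))
  filter_upwards [eventually_ge_atTop (N + 1)] with K hK
  -- As `K > N`, the first `N + 1` future cells of `F.symm^[K] z` and `F.symm^[K] w` still belong to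
  -- the pasts of `z` and `w`.
  refine (hN (F.symm^[K] z) (F.symm^[K] w) (fun l hl => ?_) fun l _ => ?_).le
  · have h1 : ∀ y, F^[l] (F.symm^[K] y) = F.symm^[(K - l - 1) + 1] y := by
      intro y
      conv_lhs => rw [show K = l + ((K - l - 1) + 1) by omega, Function.iterate_add_apply]
      exact iterate_apply_symm_iterate F l _
    rw [h1, h1]
    exact hb _
  · rw [← Function.iterate_add_apply, ← Function.iterate_add_apply,
      show l + 1 + K = (l + K) + 1 by ring]
    exact hb _

/-- A point is determined by its fiber and its past. -/
theorem eq_of_mem_fiber (h : IsRectSystem F φ tgt J g) {z w : M} {i : Fin n} {t : Itv}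
    (hz : z ∈ fiber φ i t) (hw : w ∈ fiber φ i t)
    (hb : ∀ l, SameCell φ J (F.symm^[l + 1] z) (F.symm^[l + 1] w)) : z = w := by
  obtain ⟨σ, hi, hσ⟩ := h.exists_itinerary (h.mem_pastSet fun l => (hb l).choose_spec.1)
  have hσw : ∀ l, F.symm^[l + 1] w ∈ cellSet φ J (σ.1 l) := by
    intro l
    obtain ⟨s, h1, h2⟩ := hb l
    rwa [h.cell_unique (hσ l) h1]
  obtain rfl := h.range_unique (fiber_subset_range _ _ hz) hi
  -- A point `y` of the core is assembled from the future of a core point `c` in the same rectangle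
  -- and the past `σ` of `z`. All points of the rectangle with past `σ` are backward asymptotic to
  -- `y`, so transversality applies to them.
  obtain ⟨c, hcr, hc⟩ := h.nonempty (tgt (σ.1 0))
  obtain ⟨u, hu⟩ := mem_range_iff_fiber.1 hcr
  obtain ⟨y, hy, hyσ⟩ := h.exists_mem_fiber σ u
  have hyc : y ∈ coreSet F φ := by
    refine ⟨fun l => ?_, h.mem_pastSet hyσ⟩
    obtain ⟨j, v, -, h2⟩ := h.forward_fiber hu hy (N := l) fun l _ => hc.1 l
    exact mem_rects_of_mem_fiber h2
  have hstrip : IsStrip φ (range (φ (tgt (σ.1 0)))) :=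
    ⟨tgt (σ.1 0), univ, ordConnected_univ, by rw [univ_prod_univ, image_univ]⟩
  have hT := h.isPreconnected_past (X := fun _ => range (φ (tgt (σ.1 0)))) (fun _ => hstrip)
    (fun _ => h.isCompact_range _) (fun _ _ _ => le_rfl) σ.1
  exact h.transverse _ y hyc (fiber_subset_range _ _ hy) _ (fun x hx => hx.1 0) hT
    ⟨fun _ => fiber_subset_range _ _ hy, hyσ⟩
    (fun x hx => h.asymptotic_of_sameCell fun l => ⟨_, hx.2 l, hyσ l⟩) t
    ⟨⟨fun _ => fiber_subset_range _ _ hz, hσ⟩, hz⟩ ⟨⟨fun _ => fiber_subset_range _ _ hw, hσw⟩, hw⟩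

/-- The branches of the induced map are injective. -/
theorem injOn (h : IsRectSystem F φ tgt J g) (s : Cell len) : InjOn (g s) (J s) := by
  intro t ht u hu htu
  obtain ⟨c, hcr, hc⟩ := h.nonempty s.1
  obtain ⟨σ, hi, hσ⟩ := h.exists_itinerary (coreSet_subset_pastSet hc)
  have hs := h.range_unique hcr hi
  -- Points with the same past are placed over `t` and `u`; if the branch identifies `t` and `u`,
  -- their images have the same fiber and the same past.
  obtain ⟨z, hz, hzσ⟩ := h.exists_mem_fiber σ t
  obtain ⟨w, hw, hwσ⟩ := h.exists_mem_fiber σ u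
  rw [← hs] at hz hw
  have hzw : F z = F w := by
    refine h.eq_of_mem_fiber (h.map_fiber ht hz) (htu ▸ h.map_fiber hu hw) fun l => ?_
    rw [Function.iterate_succ_apply, Function.iterate_succ_apply, F.symm_apply_apply,
      F.symm_apply_apply]
    rcases l with _ | l
    · exact ⟨s, mem_cellSet_iff.2 ⟨t, ht, hz⟩, mem_cellSet_iff.2 ⟨u, hu, hw⟩⟩
    · exact ⟨_, hzσ l, hwσ l⟩
  have hzw' := F.injective hzw
  subst hzw'
  exact (h.fiber_unique hz hw).2

/-- A point of `pastSet` is backward asymptotic to a point of the core. -/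
theorem exists_asymptotic (h : IsRectSystem F φ tgt J g) {z : M} (hz : z ∈ pastSet F φ) :
    ∃ w ∈ coreSet F φ, Asymptotic F z w := by
  obtain ⟨σ, hi, hσ⟩ := h.exists_itinerary hz
  obtain ⟨c, hcr, hc⟩ := h.nonempty (tgt (σ.1 0))
  obtain ⟨u, hu⟩ := mem_range_iff_fiber.1 hcr
  obtain ⟨y, hy, hyσ⟩ := h.exists_mem_fiber σ u
  refine ⟨y, ⟨fun l => ?_, h.mem_pastSet hyσ⟩, h.asymptotic_of_sameCell fun l =>
    ⟨_, hσ l, hyσ l⟩⟩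
  obtain ⟨j, v, -, h2⟩ := h.forward_fiber hu hy (N := l) fun l _ => hc.1 l
  exact mem_rects_of_mem_fiber h2

theorem isClosed_coreSet (h : IsRectSystem F φ tgt J g) : IsClosed (coreSet F φ) := by
  have : coreSet F φ = (⋂ l, F^[l] ⁻¹' rects φ) ∩ ⋂ l, F.symm^[l] ⁻¹' rects φ := by
    ext z; simp [coreSet]
  rw [this]
  exact (isClosed_iInter fun l => h.isCompact_rects.isClosed.preimage (continuous_iterate l)).inter
    (isClosed_iInter fun l => h.isCompact_rects.isClosed.preimage (continuous_symm_iterate l))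

theorem isClosed_pastSet (h : IsRectSystem F φ tgt J g) : IsClosed (pastSet F φ) := by
  have : pastSet F φ = ⋂ l, F.symm^[l] ⁻¹' rects φ := by
    ext z; simp [pastSet]
  rw [this]
  exact isClosed_iInter fun l => h.isCompact_rects.isClosed.preimage (continuous_symm_iterate l)

theorem isCompact_coreSet (h : IsRectSystem F φ tgt J g) : IsCompact (coreSet F φ) :=
  h.isCompact_rects.of_isClosed_subset h.isClosed_coreSet fun _ hz => hz.1 0

theorem isCompact_pastSet (h : IsRectSystem F φ tgt J g) : IsCompact (pastSet F φ) :=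
  h.isCompact_rects.of_isClosed_subset h.isClosed_pastSet fun _ hz => hz 0

theorem symm_iterate_mem_coreSet {z : M} (hz : z ∈ coreSet F φ) (N : ℕ) :
    F.symm^[N] z ∈ coreSet F φ := by
  refine ⟨fun l => ?_, fun l => ?_⟩
  · rcases le_total l N with h1 | h1
    · obtain ⟨k, rfl⟩ := Nat.exists_eq_add_of_le h1
      rw [Function.iterate_add_apply, iterate_apply_symm_iterate]
      exact hz.2 k
    · obtain ⟨k, rfl⟩ := Nat.exists_eq_add_of_le h1
      rw [add_comm, Function.iterate_add_apply, iterate_apply_symm_iterate]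
      exact hz.1 k
  · rw [← Function.iterate_add_apply]
    exact hz.2 _

/-- A point asymptotic to a point of the core has a backward orbit that ends in the interior of
the rectangles. -/
theorem eventually_mem_interior (h : IsRectSystem F φ tgt J g)
    (hint : coreSet F φ ⊆ interior (rects φ)) {z w : M} (hw : w ∈ coreSet F φ)
    (hzw : Asymptotic F z w) : ∀ᶠ N in atTop, F.symm^[N] z ∈ interior (rects φ) := by
  obtain ⟨δ, hδ, hsub⟩ := h.isCompact_coreSet.exists_thickening_subset_open isOpen_interior hint
  have h1 : ∀ᶠ N in atTop, edist (F.symm^[N] z) (F.symm^[N] w) < ENNReal.ofReal δ :=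
    hzw.eventually_lt_const (by simpa using hδ)
  filter_upwards [h1] with N hN
  refine hsub ?_
  rw [Metric.mem_thickening_iff_exists_edist_lt]
  exact ⟨_, symm_iterate_mem_coreSet hw N, hN⟩

end IsRectSystem

/-- The points whose backward orbit is eventually in the rectangles. -/
def unstableSet (F : M ≃ₜ M) (φ : Fin n → Box d → M) : Set M :=
  {z | ∃ N, F.symm^[N] z ∈ pastSet F φ}

end

/-! ### Parametrization of the open interval -/

/-- An increasing parametrization of `(-1, 1)` by the line. -/
noncomputable def lineItv (x : ℝ) : Itv :=
  ⟨orderIsoIooNegOneOne ℝ x, (orderIsoIooNegOneOne ℝ x).2.1.le, (orderIsoIooNegOneOne ℝ x).2.2.le⟩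

theorem lineItv_strictMono : StrictMono lineItv := fun _ _ h =>
  Subtype.mk_lt_mk.2 (Subtype.coe_lt_coe.2 ((orderIsoIooNegOneOne ℝ).strictMono h))

theorem range_lineItv : range lineItv = {t : Itv | -1 < (t : ℝ) ∧ (t : ℝ) < 1} := by
  ext t
  constructor
  · rintro ⟨x, rfl⟩
    exact (orderIsoIooNegOneOne ℝ x).2
  · intro ht
    refine ⟨(orderIsoIooNegOneOne ℝ).symm ⟨t, ht⟩, Subtype.ext ?_⟩
    simp [lineItv]

theorem isOpenEmbedding_lineItv : IsOpenEmbedding lineItv := by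
  refine ⟨lineItv_strictMono.isEmbedding_of_ordConnected ?_, ?_⟩
  · rw [range_lineItv]
    exact ⟨fun x hx y hy z hz => ⟨hx.1.trans_le hz.1, (show (z : ℝ) ≤ y from hz.2).trans_lt hy.2⟩⟩
  · rw [range_lineItv]
    exact (isOpen_lt continuous_const continuous_subtype_val).inter
      (isOpen_lt continuous_subtype_val continuous_const)

theorem isOpen_range_of_strictMono {q : ℝ → ℝ} (hq : Continuous q) (hm : StrictMono q) :
    IsOpen (range q) := by
  refine isOpen_iff_mem_nhds.2 ?_
  rintro _ ⟨x, rfl⟩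
  refine mem_of_superset (Ioo_mem_nhds (hm (show x - 1 < x by linarith))
    (hm (show x < x + 1 by linarith))) ?_
  exact (intermediate_value_Ioo (by linarith) hq.continuousOn).trans (image_subset_range _ _)

theorem isOpen_range_of_strictAnti {q : ℝ → ℝ} (hq : Continuous q) (hm : StrictAnti q) :
    IsOpen (range q) := by
  refine isOpen_iff_mem_nhds.2 ?_
  rintro _ ⟨x, rfl⟩
  refine mem_of_superset (Ioo_mem_nhds (hm (show x < x + 1 by linarith))
    (hm (show x - 1 < x by linarith))) ?_
  exact (intermediate_value_Ioo' (by linarith) hq.continuousOn).trans (image_subset_range _ _)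

/-- The values `±1` are attained on `J`; a point with a value strictly between them lies strictly
between the two points where they are attained. -/
theorem mem_range_lineItv_of_injOn {J : Set Itv} {g : Itv → Itv} (hs : g '' J = univ)
    (hm : StrictMonoOn g J ∨ StrictAntiOn g J) {t : Itv} (ht : t ∈ J)
    (hgt : g t ∈ range lineItv) : t ∈ range lineItv := by
  rw [range_lineItv] at *
  obtain ⟨u, hu, hgu⟩ := (hs.symm ▸ mem_univ (⟨-1, ⟨le_rfl, neg_le_self zero_le_one⟩⟩ : Itv) :
    (⟨-1, ⟨le_rfl, neg_le_self zero_le_one⟩⟩ : Itv) ∈ g '' J)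
  obtain ⟨v, hv, hgv⟩ := (hs.symm ▸ mem_univ (⟨1, ⟨neg_le_self zero_le_one, le_rfl⟩⟩ : Itv) :
    (⟨1, ⟨neg_le_self zero_le_one, le_rfl⟩⟩ : Itv) ∈ g '' J)
  have h1 : g u < g t := by rw [hgu]; exact hgt.1
  have h2 : g t < g v := by rw [hgv]; exact hgt.2
  rcases hm with hm | hm
  · exact ⟨u.2.1.trans_lt ((hm.lt_iff_lt hu ht).1 h1), lt_of_lt_of_le ((hm.lt_iff_lt ht hv).1 h2) v.2.2⟩
  · exact ⟨v.2.1.trans_lt ((hm.lt_iff_gt ht hv).1 h2), lt_of_lt_of_le ((hm.lt_iff_gt hu ht).1 h1) u.2.2⟩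

/-- Projection along the compact space `K` is a closed map. -/
theorem continuous_of_isClosed_graph {A B : Type*} [TopologicalSpace A] [TopologicalSpace B]
    {K : Set B} (hK : IsCompact K) {Z : A → B} (hZ : ∀ a, Z a ∈ K)
    (hG : IsClosed {p : A × B | p.2 = Z p.1}) : Continuous Z := by
  have : CompactSpace K := isCompact_iff_compactSpace.1 hK
  suffices h : Continuous fun a => (⟨Z a, hZ a⟩ : K) from continuous_subtype_val.comp h
  refine continuous_iff_isClosed.2 fun C hC => ?_
  have h1 : IsClosed {p : A × K | (p.2 : B) = Z p.1 ∧ p.2 ∈ C} :=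
    (hG.preimage (continuous_fst.prodMk (continuous_subtype_val.comp continuous_snd))).inter
      (hC.preimage continuous_snd)
  convert isClosedMap_fst_of_compactSpace _ h1 using 1
  ext a
  constructor
  · intro ha
    exact ⟨(a, ⟨Z a, hZ a⟩), ⟨rfl, ha⟩, rfl⟩
  · rintro ⟨⟨a, b⟩, ⟨h2, h3⟩, rfl⟩
    have : b = ⟨Z a, hZ a⟩ := Subtype.ext h2
    rw [mem_preimage, ← this]
    exact h3

/-! ### The unstable set as a lamination -/

section

set_option linter.unusedSectionVars false

variable {n d : ℕ} {M : Type*} [EMetricSpace M] {len : Fin n → ℕ} {F : M ≃ₜ M}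
  {φ : Fin n → Box d → M} {tgt : Cell len → Fin n} {J : Cell len → Set Itv}
  {g : Cell len → Itv → Itv}

namespace IsRectSystem

/-- The branches of the induced map, read on the line. -/
theorem exists_branches (h : IsRectSystem F φ tgt J g) {ori : Cell len → Bool}
    (hmono : ∀ s, ori s = true → MonotoneOn (g s) (J s))
    (hanti : ∀ s, ori s = false → AntitoneOn (g s) (J s))
    (horder : ∀ i (j j' : Fin (len i)), j < j' → ∀ t ∈ J ⟨i, j⟩, ∀ u ∈ J ⟨i, j'⟩, t < u) :
    ∃ q : Cell len → ℝ → ℝ, IsLineSystem ori q ∧ (∀ s, IsOpen (range (q s))) ∧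
      ∀ s x, lineItv (q s x) ∈ J s ∧ g s (lineItv (q s x)) = lineItv x := by
  -- The hypothesis gives weak monotonicity; strictness comes from the injectivity of the branches.
  have hm : ∀ s, ori s = true → StrictMonoOn (g s) (J s) := fun s hs =>
    (hmono s hs).strictMonoOn_of_injOn (h.injOn s)
  have ha : ∀ s, ori s = false → StrictAntiOn (g s) (J s) := fun s hs =>
    (hanti s hs).strictAntiOn_of_injOn (h.injOn s)
  have hma : ∀ s, StrictMonoOn (g s) (J s) ∨ StrictAntiOn (g s) (J s) := by
    intro s
    cases hs : ori s with
    | true => exact Or.inl (hm s hs)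
    | false => exact Or.inr (ha s hs)
  have hinv : ∀ x, Function.invFun lineItv (lineItv x) = x :=
    Function.leftInverse_invFun lineItv_strictMono.injective
  let gR : Cell len → ℝ → ℝ := fun s x => Function.invFun lineItv (g s (lineItv x))
  -- The parameters whose image under the branch misses the endpoints `±1`.
  let JR : Cell len → Set ℝ := fun s => {x | lineItv x ∈ J s ∧ g s (lineItv x) ∈ range lineItv}
  have hgR : ∀ s, ∀ x ∈ JR s, lineItv (gR s x) = g s (lineItv x) := by
    rintro s x ⟨-, y, hy⟩
    simp only [gR, ← hy, hinv]
  have hoc : OrdConnected (range lineItv) := by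
    rw [range_lineItv]
    exact ⟨fun x hx y hy z hz => ⟨hx.1.trans_le hz.1, (show (z : ℝ) ≤ y from hz.2).trans_lt hy.2⟩⟩
  have hJR : ∀ s, OrdConnected (JR s) := by
    intro s
    refine ⟨fun x hx y hy z hz => ?_⟩
    have h1 : lineItv z ∈ J s := (h.ord s).out hx.1 hy.1
      ⟨lineItv_strictMono.monotone hz.1, lineItv_strictMono.monotone hz.2⟩
    refine ⟨h1, ?_⟩
    rcases h.mono s with hh | hh
    · exact hoc.out hx.2 hy.2 ⟨hh hx.1 h1 (lineItv_strictMono.monotone hz.1),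
        hh h1 hy.1 (lineItv_strictMono.monotone hz.2)⟩
    · exact hoc.out hy.2 hx.2 ⟨hh h1 hy.1 (lineItv_strictMono.monotone hz.2),
        hh hx.1 h1 (lineItv_strictMono.monotone hz.1)⟩
  have hsurj : ∀ s, gR s '' JR s = univ := by
    intro s
    refine eq_univ_of_forall fun y => ?_
    obtain ⟨t, ht, hgt⟩ := (h.surj s ▸ mem_univ (lineItv y) : lineItv y ∈ g s '' J s)
    obtain ⟨x, rfl⟩ := mem_range_lineItv_of_injOn (h.surj s) (hma s) ht ⟨y, hgt.symm⟩
    exact ⟨x, ⟨ht, y, hgt.symm⟩, by simp only [gR, hgt, hinv]⟩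
  choose q hq1 hq2 hq3 hq4 hq5 hq6 using fun s =>
    exists_inverse_branch (hJR s) (hsurj s) (ori s)
      (fun hs x hx y hy hxy => by
        rw [← lineItv_strictMono.lt_iff_lt, hgR s x hx, hgR s y hy]
        exact hm s hs hx.1 hy.1 (lineItv_strictMono hxy))
      (fun hs x hx y hy hxy => by
        rw [← lineItv_strictMono.lt_iff_lt, hgR s x hx, hgR s y hy]
        exact ha s hs hx.1 hy.1 (lineItv_strictMono hxy))
  have hmem : ∀ s x, q s x ∈ JR s := fun s x => hq2 s ▸ mem_range_self x
  refine ⟨q, ⟨hq5, hq6, hq1, fun i j j' hj x y => ?_⟩, fun s => ?_, fun s x =>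
    ⟨(hmem s x).1, ?_⟩⟩
  · exact lineItv_strictMono.lt_iff_lt.1 (horder i j j' hj _ (hmem _ x).1 _ (hmem _ y).1)
  · cases hs : ori s with
    | true => exact isOpen_range_of_strictMono (hq1 s).continuous (hq5 s hs)
    | false => exact isOpen_range_of_strictAnti (hq1 s).continuous (hq6 s hs)
  · rw [← hgR s _ (hmem s x), hq3]

/-- The set of points over a closed set of first coordinates is closed. -/
theorem isClosed_image_prod (h : IsRectSystem F φ tgt J g) (i : Fin n) {C : Set Itv}
    (hC : IsClosed C) : IsClosed (φ i '' (C ×ˢ univ)) :=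
  ((hC.isCompact.prod isCompact_univ).image (h.emb i).continuous).isClosed

theorem mem_image_prod_iff (h : IsRectSystem F φ tgt J g) {z : M} {i j : Fin n} {t : Itv}
    {C : Set Itv} (hz : z ∈ fiber φ i t) : z ∈ φ j '' (C ×ˢ univ) ↔ i = j ∧ t ∈ C := by
  constructor
  · rintro ⟨⟨u, x⟩, ⟨hu, -⟩, rfl⟩
    obtain ⟨rfl, rfl⟩ := h.fiber_unique hz ⟨x, rfl⟩
    exact ⟨rfl, hu⟩
  · rintro ⟨rfl, ht⟩
    obtain ⟨x, rfl⟩ := hz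
    exact ⟨(t, x), ⟨ht, mem_univ _⟩, rfl⟩

/-- The point with given itinerary and first coordinate. -/
theorem exists_continuous_param (h : IsRectSystem F φ tgt J g) :
    ∃ Z : Itinerary tgt × Itv → M, Continuous Z ∧
      (∀ p, Z p ∈ fiber φ (tgt (p.1.1 0)) p.2) ∧
      ∀ p l, F.symm^[l + 1] (Z p) ∈ cellSet φ J (p.1.1 l) := by
  choose Z hZ hZσ using fun p : Itinerary tgt × Itv => h.exists_mem_fiber p.1 p.2
  refine ⟨Z, continuous_of_isClosed_graph h.isCompact_pastSet
    (fun p => h.mem_pastSet (hZσ p)) ?_, hZ, hZσ⟩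
  -- Itinerary and first coordinate are closed conditions that determine the point, so the graph is
  -- closed.
  have hG : {p : (Itinerary tgt × Itv) × M | p.2 = Z p.1} =
      (⋃ i, {p : (Itinerary tgt × Itv) × M | tgt (p.1.1.1 0) = i ∧
        (p.1.2, p.2) ∈ range fun y : Box d => (y.1, φ i y)}) ∩
      ⋂ l, ⋃ s, {p : (Itinerary tgt × Itv) × M | p.1.1.1 l = s ∧
        F.symm^[l + 1] p.2 ∈ cellSet φ J s} := by
    ext ⟨p, z⟩
    simp only [mem_ofPred_eq, mem_inter_iff, mem_iUnion, mem_iInter]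
    constructor
    · rintro rfl
      obtain ⟨x, hx⟩ := hZ p
      exact ⟨⟨_, rfl, (p.2, x), Prod.ext rfl hx⟩, fun l => ⟨_, rfl, hZσ p l⟩⟩
    · rintro ⟨⟨i, rfl, ⟨t, x⟩, hx⟩, h2⟩
      obtain ⟨h3, h4⟩ := Prod.mk.inj hx
      dsimp only at h3
      subst h3
      refine h.eq_of_mem_fiber (⟨x, h4⟩ : z ∈ fiber φ (tgt (p.1.1 0)) _) (hZ p) fun l => ?_
      obtain ⟨s, rfl, hs⟩ := h2 l
      exact ⟨_, hs, hZσ p l⟩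
  rw [hG]
  have hcoord : ∀ l, Continuous fun p : (Itinerary tgt × Itv) × M => p.1.1.1 l := fun l =>
    (continuous_apply l).comp (continuous_subtype_val.comp (continuous_fst.comp continuous_fst))
  refine (isClosed_iUnion_of_finite fun i => ?_).inter (isClosed_iInter fun l =>
    isClosed_iUnion_of_finite fun s => ?_)
  · refine IsClosed.inter ((isClosed_discrete {i}).preimage
      ((continuous_of_discreteTopology (f := tgt)).comp (hcoord 0))) ?_
    have h1 : IsClosed (range fun y : Box d => (y.1, φ i y)) :=
      (_root_.isCompact_range (continuous_fst.prodMk (h.emb i).continuous)).isClosed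
    exact h1.preimage ((continuous_snd.comp continuous_fst).prodMk continuous_snd)
  · exact ((isClosed_discrete {s}).preimage (hcoord l)).inter
      ((h.isCompact_cellSet s).isClosed.preimage ((continuous_symm_iterate _).comp continuous_snd))

theorem symm_mem_pastSet {z : M} (hz : z ∈ pastSet F φ) (N : ℕ) : F.symm^[N] z ∈ pastSet F φ :=
  fun l => by rw [← Function.iterate_add_apply]; exact hz _

theorem mem_unstableSet_iff_apply (z : M) : z ∈ unstableSet F φ ↔ F z ∈ unstableSet F φ := by
  constructor
  · rintro ⟨N, hN⟩
    refine ⟨N + 1, ?_⟩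
    rwa [Function.iterate_succ_apply, F.symm_apply_apply]
  · rintro ⟨N, hN⟩
    refine ⟨N, ?_⟩
    have := symm_mem_pastSet hN 1
    rwa [Function.iterate_one, ← Function.iterate_succ_apply' F.symm N,
      Function.iterate_succ_apply, F.symm_apply_apply] at this

/-- A point of `unstableSet` that lies in a rectangle has its whole past in the rectangles. -/
theorem mem_pastSet_of_mem_rects
    (hr5 : ∀ z ∈ rects φ, F z ∉ rects φ → ∀ l : ℕ, 1 ≤ l → F^[l] z ∉ rects φ) {z : M}
    (hz : z ∈ unstableSet F φ) (hzr : z ∈ rects φ) : z ∈ pastSet F φ := by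
  obtain ⟨N, hN⟩ := hz
  induction N with
  | zero => exact hN
  | succ N ih =>
    refine ih fun l => ?_
    rcases l with _ | l
    -- If the orbit left the rectangles between times `-(N + 1)` and `-N`, it could not be back at
    -- time `0`.
    · by_contra hcon
      refine hr5 (F.symm^[N + 1] z) (hN 0) ?_ (N + 1) (by omega) ?_
      · rw [apply_symm_iterate_succ]; exact hcon
      · rw [iterate_apply_symm_iterate]; exact hzr
    · rw [Function.iterate_succ_apply, ← Function.iterate_succ_apply' F.symm N]
      exact hN l

/-- The unstable set of a system of rectangles is a lamination. -/
theorem exists_lamination (h : IsRectSystem F φ tgt J g) {ori : Cell len → Bool}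
    (hmono : ∀ s, ori s = true → MonotoneOn (g s) (J s))
    (hanti : ∀ s, ori s = false → AntitoneOn (g s) (J s))
    (horder : ∀ i (j j' : Fin (len i)), j < j' → ∀ t ∈ J ⟨i, j⟩, ∀ u ∈ J ⟨i, j'⟩, t < u)
    (hint : coreSet F φ ⊆ interior (rects φ))
    (hr5 : ∀ z ∈ rects φ, F z ∉ rects φ → ∀ l : ℕ, 1 ≤ l → F^[l] z ∉ rects φ)
    (hend : ∀ z ∈ pastSet F φ, ∃ N i, ∃ t ∈ range lineItv, F.symm^[N] z ∈ fiber φ i t) :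
    ∃ q : Cell len → ℝ → ℝ, IsLineSystem ori q ∧
      ∃ T : ↥(unstableSet F φ) ≃ₜ ↥(unstableSet F φ), ∃ E, IsLamination tgt q T E := by
  obtain ⟨q, hq, hqo, hqg⟩ := h.exists_branches hmono hanti horder
  obtain ⟨Z, hZc, hZ, hZσ⟩ := h.exists_continuous_param
  have hZV : ∀ p, Z p ∈ pastSet F φ := fun p => h.mem_pastSet (hZσ p)
  have hVU : pastSet F φ ⊆ unstableSet F φ := fun z hz => ⟨0, hz⟩
  let E : Itinerary tgt × ℝ → ↥(unstableSet F φ) := fun p =>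
    ⟨Z (p.1, lineItv p.2), hVU (hZV _)⟩
  have hEc : Continuous E := (hZc.comp (continuous_fst.prodMk
    (isOpenEmbedding_lineItv.continuous.comp continuous_snd))).subtype_mk _
  let T : ↥(unstableSet F φ) ≃ₜ ↥(unstableSet F φ) := F.subtype mem_unstableSet_iff_apply
  have hstep : ∀ σ x, T (E (σ.shift, q (σ.1 0) x)) = E (σ, x) := by
    intro σ x
    refine Subtype.ext ?_
    change F (Z (σ.shift, lineItv (q (σ.1 0) x))) = Z (σ, lineItv x)
    have h1 := hZ (σ.shift, lineItv (q (σ.1 0) x))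
    have h2 : tgt (σ.shift.1 0) = (σ.1 0).1 := (σ.2 0).symm
    dsimp only at h1
    rw [h2] at h1
    have h3 := h.map_fiber (hqg (σ.1 0) x).1 h1
    rw [(hqg (σ.1 0) x).2] at h3
    refine h.eq_of_mem_fiber h3 (hZ (σ, lineItv x)) fun l => ?_
    rw [Function.iterate_succ_apply, F.symm_apply_apply]
    rcases l with _ | l
    · exact ⟨σ.1 0, mem_cellSet_iff.2 ⟨_, (hqg (σ.1 0) x).1, h1⟩, hZσ (σ, lineItv x) 0⟩
    · exact ⟨σ.1 (l + 1), hZσ (σ.shift, _) l, hZσ (σ, lineItv x) (l + 1)⟩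
  have hrange : ∀ z : M, (∃ p, (E p : M) = z) ↔
      z ∈ pastSet F φ ∧ ∃ i, ∃ t ∈ range lineItv, z ∈ fiber φ i t := by
    intro z
    constructor
    · rintro ⟨p, rfl⟩
      exact ⟨hZV _, _, _, ⟨p.2, rfl⟩, hZ (p.1, lineItv p.2)⟩
    · rintro ⟨hz, i, _, ⟨x, rfl⟩, hzi⟩
      obtain ⟨σ, hi, hσ⟩ := h.exists_itinerary hz
      obtain rfl := h.range_unique (fiber_subset_range _ _ hzi) hi
      exact ⟨(σ, x), h.eq_of_mem_fiber (hZ _) hzi fun l => ⟨_, hZσ _ l, hσ l⟩⟩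
  -- Near `F.symm (E p)`, a point of `pastSet` lies in the same rectangle, over the open image of
  -- the branch leading to `E p`; so its image has first coordinate in the open interval.
  have hone : ∀ p, ∃ O : Set M, IsOpen O ∧ F.symm (E p) ∈ O ∧
      ∀ w ∈ pastSet F φ, w ∈ O → ∃ p', (E p' : M) = F w := by
    rintro ⟨σ, x⟩
    have h1 : (F.symm (E (σ, x)) : M) = Z (σ.shift, lineItv (q (σ.1 0) x)) := by
      rw [← hstep σ x]
      exact F.symm_apply_apply _
    have h2 := hZ (σ.shift, lineItv (q (σ.1 0) x))
    rw [← h1] at h2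
    dsimp only at h2
    rw [show tgt (σ.shift.1 0) = (σ.1 0).1 from (σ.2 0).symm] at h2
    have hopen : IsOpen (lineItv '' range (q (σ.1 0))) :=
      isOpenEmbedding_lineItv.isOpenMap _ (hqo _)
    refine ⟨(⋃ j : Fin n, φ j '' ({t | j = (σ.1 0).1 → t ∉ lineItv '' range (q (σ.1 0))} ×ˢ univ))ᶜ,
      (isClosed_iUnion_of_finite fun j => h.isClosed_image_prod j ?_).isOpen_compl, ?_, ?_⟩
    · by_cases hj : j = (σ.1 0).1
      · simp only [hj, true_imp_iff]
        exact hopen.isClosed_compl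
      · simp [hj]
    · simp only [mem_compl_iff, mem_iUnion, not_exists]
      intro j hj
      obtain ⟨rfl, h3⟩ := (h.mem_image_prod_iff h2).1 hj
      exact h3 rfl ⟨_, ⟨x, rfl⟩, rfl⟩
    · intro w hw hwO
      have hwr : w ∈ rects φ := hw 0
      obtain ⟨j, t, hjt⟩ := mem_rects_iff.1 hwr
      simp only [mem_compl_iff, mem_iUnion, not_exists] at hwO
      have h3 := hwO j
      rw [h.mem_image_prod_iff hjt] at h3
      simp only [mem_ofPred_eq, true_and, not_forall, not_not] at h3
      obtain ⟨rfl, _, ⟨y, rfl⟩, rfl⟩ := h3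
      have h4 := h.map_fiber (hqg _ y).1 hjt
      rw [(hqg _ y).2] at h4
      refine (hrange _).2 ⟨fun l => ?_, _, _, ⟨y, rfl⟩, h4⟩
      rcases l with _ | l
      · exact mem_rects_of_mem_fiber h4
      · rw [Function.iterate_succ_apply, F.symm_apply_apply]
        exact hw l
  -- `E p` may be a boundary point of the rectangles, so openness of the range is tested at a remote
  -- past time.
  have hmany : ∀ N p, ∃ O : Set M, IsOpen O ∧ F.symm^[N] (E p) ∈ O ∧
      ∀ w ∈ pastSet F φ, w ∈ O → ∃ p', (E p' : M) = F^[N] w := by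
    intro N
    induction N with
    | zero =>
      intro p
      refine ⟨(⋃ j : Fin n, φ j '' ((range lineItv)ᶜ ×ˢ univ))ᶜ,
        (isClosed_iUnion_of_finite fun j => h.isClosed_image_prod j
          isOpenEmbedding_lineItv.isOpen_range.isClosed_compl).isOpen_compl, ?_, ?_⟩
      · simp only [mem_compl_iff, mem_iUnion, not_exists]
        intro j hj
        exact ((h.mem_image_prod_iff (hZ (p.1, lineItv p.2))).1 hj).2 ⟨p.2, rfl⟩
      · intro w hw hwO
        have hwr : w ∈ rects φ := hw 0
        obtain ⟨j, t, hjt⟩ := mem_rects_iff.1 hwr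
        simp only [mem_compl_iff, mem_iUnion, not_exists] at hwO
        have h3 := hwO j
        rw [h.mem_image_prod_iff hjt] at h3
        simp only [mem_compl_iff, true_and, not_not] at h3
        exact (hrange _).2 ⟨hw, j, t, h3, hjt⟩
    | succ N ih =>
      rintro ⟨σ, x⟩
      obtain ⟨O₂, hO₂, hm₂, hO₂'⟩ := hone (σ, x)
      obtain ⟨O₁, hO₁, hm₁, hO₁'⟩ := ih (σ.shift, q (σ.1 0) x)
      have h1 : (E (σ.shift, q (σ.1 0) x) : M) = F.symm (E (σ, x)) := by
        rw [← hstep σ x]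
        exact (F.symm_apply_apply _).symm
      rw [h1] at hm₁
      refine ⟨O₁ ∩ F^[N] ⁻¹' O₂, hO₁.inter (hO₂.preimage (continuous_iterate N)), ⟨hm₁, ?_⟩, ?_⟩
      · rw [mem_preimage, Function.iterate_succ_apply, iterate_apply_symm_iterate]
        exact hm₂
      · rintro w hw ⟨hw1, hw2⟩
        obtain ⟨p', hp'⟩ := hO₁' w hw hw1
        obtain ⟨p'', hp''⟩ := hO₂' (F^[N] w) (hp' ▸ hZV _) hw2
        exact ⟨p'', by rw [hp'', Function.iterate_succ_apply']⟩
  refine ⟨q, hq, T, E, isOpenEmbedding_of_code hEc ?_ (fun k s => ?_) fun W hW => ?_, ?_, hstep⟩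
  -- For some `N` the point `F.symm^[N] (E p)` is interior to the rectangles. Nearby points of the
  -- unstable set are then in the rectangles at time `-N`, hence in `pastSet` by R5, and `hmany`
  -- returns them to the range.
  · refine isOpen_iff_mem_nhds.2 ?_
    rintro _ ⟨p, rfl⟩
    obtain ⟨w, hw, hpw⟩ := h.exists_asymptotic (hZV (p.1, lineItv p.2))
    obtain ⟨N, hN⟩ := (h.eventually_mem_interior hint hw hpw).exists
    obtain ⟨O, hO, hm, hO'⟩ := hmany N p
    have hnhds : {y : ↥(unstableSet F φ) | F.symm^[N] (y : M) ∈ O ∩ interior (rects φ)} ∈ 𝓝 (E p) :=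
      ((hO.inter isOpen_interior).preimage ((continuous_symm_iterate N).comp
        continuous_subtype_val)).mem_nhds ⟨hm, hN⟩
    refine mem_of_superset hnhds ?_
    rintro y ⟨hy1, hy2⟩
    have h1 : F.symm^[N] (y : M) ∈ unstableSet F φ := by
      obtain ⟨K, hK⟩ := y.2
      refine ⟨K, ?_⟩
      rw [← Function.iterate_add_apply, add_comm, Function.iterate_add_apply]
      exact symm_mem_pastSet hK N
    obtain ⟨p', hp'⟩ := hO' _ (mem_pastSet_of_mem_rects hr5 h1 (interior_subset hy2)) hy1
    rw [iterate_apply_symm_iterate] at hp'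
    exact ⟨p', Subtype.ext hp'⟩
  -- Cells are closed, so an open test for a symbol is to avoid the finitely many other cells.
  · refine ⟨{y | F.symm^[k + 1] (y : M) ∉ ⋃ s', ⋃ _ : s' ≠ s, cellSet φ J s'}, ?_, fun σ x => ?_⟩
    · exact ((isClosed_iUnion_of_finite fun s' => isClosed_iUnion_of_finite fun _ =>
        (h.isCompact_cellSet s').isClosed).isOpen_compl).preimage
        ((continuous_symm_iterate _).comp continuous_subtype_val)
    · have h1 := hZσ (σ, lineItv x) k
      simp only [mem_ofPred_eq, mem_iUnion, not_exists, E]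
      constructor
      · intro h2
        by_contra h3
        exact h2 _ h3 h1
      · rintro rfl s' hs' h2
        exact hs' (h.cell_unique h2 h1)
  · refine ⟨{y | (y : M) ∉ ⋃ j, φ j '' ((lineItv '' W)ᶜ ×ˢ univ)}, ?_, fun σ x => ?_⟩
    · exact ((isClosed_iUnion_of_finite fun j => h.isClosed_image_prod j
        (isOpenEmbedding_lineItv.isOpenMap W hW).isClosed_compl).isOpen_compl).preimage
        continuous_subtype_val
    · simp only [mem_ofPred_eq, mem_iUnion, not_exists]
      have h1 : ∀ j, (E (σ, x) : M) ∈ φ j '' ((lineItv '' W)ᶜ ×ˢ univ) ↔ _ := fun j =>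
        h.mem_image_prod_iff (hZ (σ, lineItv x))
      simp only [h1, mem_compl_iff, lineItv_strictMono.injective.mem_set_image]
      simp
  · intro y
    obtain ⟨N, hN⟩ := y.2
    obtain ⟨K, i, t, ht, hK⟩ := hend _ hN
    obtain ⟨p, hp⟩ := (hrange _).2 ⟨symm_mem_pastSet hN K, i, t, ht, hK⟩
    refine ⟨K + N, p, Subtype.ext ?_⟩
    have h1 : ∀ L (u : ↥(unstableSet F φ)), ((T^[L] u : ↥(unstableSet F φ)) : M) = F^[L] u := by
      intro L
      induction L with
      | zero => exact fun u => rfl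
      | succ L ih =>
        intro u
        rw [Function.iterate_succ_apply, ih, Function.iterate_succ_apply]
        rfl
    rw [h1, hp, ← Function.iterate_add_apply, iterate_apply_symm_iterate]

end IsRectSystem

end

/-! ### Points near a saddle with one unstable direction -/

/-- The coordinates `u`, `s` on the open set `S` describe the unstable and the stable part of `H`
near its fixed point `x` up to radius `r`: the cone `s < K |u|` is invariant and expanded, and
points outside the cone do not leave the box of radius `r`. -/
structure IsSaddleChart {M : Type*} [TopologicalSpace M] (H : M → M) (x : M) (u s : M → ℝ)
    (S : Set M) (K ν r : ℝ) : Prop where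
  isOpen : IsOpen S
  contu : ContinuousOn u S
  conts : ContinuousOn s S
  cone : ∀ y ∈ S, |u y| < r → s y < r → s y < K * |u y| →
    2 * |u y| ≤ |u (H y)| ∧ 0 < ν * u y * u (H y) ∧ s (H y) < K * |u (H y)|
  noncone : ∀ y ∈ S, |u y| < r → s y < r → K * |u y| ≤ s y →
    H y ∈ S ∧ |u (H y)| < r ∧ s (H y) < r
  exists_pos : ∀ U ∈ 𝓝 x, ∃ p ∈ U, s p < K * |u p| ∧ 0 < u p
  exists_neg : ∀ U ∈ 𝓝 x, ∃ p ∈ U, s p < K * |u p| ∧ u p < 0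

/-- The box of a saddle chart. -/
def saddleBox {M : Type*} (u s : M → ℝ) (S : Set M) (r : ℝ) : Set M :=
  {y | y ∈ S ∧ |u y| < r ∧ s y < r}

/-- The points that stay in the box of a saddle chart separate it locally. -/
theorem IsSaddleChart.not_isPreconnected_diff {M : Type*} [TopologicalSpace M] {H : M → M}
    (hH : Continuous H) {x : M} {u s : M → ℝ} {S : Set M} {K ν r : ℝ}
    (hs0 : ∀ y, 0 ≤ s y) (h : IsSaddleChart H x u s S K ν r) {U D : Set M} (hU : U ∈ 𝓝 x)
    (hUB : U ⊆ saddleBox u s S r) (hD : ∀ y ∈ U, y ∈ D → ∀ l, H^[l] y ∈ saddleBox u s S r)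
    (hnD : ∀ y ∈ U, y ∉ D → ∃ l, H^[l] y ∉ saddleBox u s S r) : ¬ IsPreconnected (U \ D) := by
  intro hconn
  set B := saddleBox u s S r
  have hcont2 : ContinuousOn (fun y => (u y, s y)) S := h.contu.prodMk h.conts
  have hBo : IsOpen B := by
    have h1 : IsOpen ({p : ℝ × ℝ | |p.1| < r} ∩ {p : ℝ × ℝ | p.2 < r}) :=
      (isOpen_lt (by fun_prop) (by fun_prop)).inter (isOpen_lt (by fun_prop) (by fun_prop))
    exact hcont2.isOpen_inter_preimage h.isOpen h1
  let C : ℝ → Set M := fun c => {y | y ∈ B ∧ s y < K * |u y| ∧ 0 < c * u y}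
  have hCo : ∀ c, IsOpen (C c) := by
    intro c
    have h1 : IsOpen ({p : ℝ × ℝ | p.2 < K * |p.1|} ∩ {p : ℝ × ℝ | 0 < c * p.1}) :=
      (isOpen_lt (by fun_prop) (by fun_prop)).inter (isOpen_lt (by fun_prop) (by fun_prop))
    convert hBo.inter (hcont2.isOpen_inter_preimage h.isOpen h1) using 1
    ext y
    simp only [C, mem_ofPred_eq, mem_inter_iff, mem_preimage]
    exact ⟨fun h1 => ⟨h1.1, h1.1.1, h1.2⟩, fun h1 => ⟨h1.1, h1.2.2⟩⟩
  -- The points that, before leaving the box, enter the half of the cone given by the sign of `c`.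
  -- The factor `ν ^ k` accounts for iterates that exchange the two halves when `ν < 0`.
  let E : ℝ → Set M := fun c => ⋃ k, {y | (∀ j ≤ k, H^[j] y ∈ B) ∧ H^[k] y ∈ C (c * ν ^ k)}
  have hEo : ∀ c, IsOpen (E c) := by
    intro c
    refine isOpen_iUnion fun k => ?_
    have h1 : {y | (∀ j ≤ k, H^[j] y ∈ B) ∧ H^[k] y ∈ C (c * ν ^ k)} =
        (⋂ j ∈ Finset.range (k + 1), H^[j] ⁻¹' B) ∩ H^[k] ⁻¹' C (c * ν ^ k) := by
      ext y
      simp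
    rw [h1]
    exact (isOpen_biInter_finset fun j _ => hBo.preimage (hH.iterate j)).inter
      ((hCo _).preimage (hH.iterate k))
  have hstep : ∀ c y k, H^[k] y ∈ C (c * ν ^ k) → H^[k + 1] y ∈ B →
      H^[k + 1] y ∈ C (c * ν ^ (k + 1)) := by
    rintro c y k ⟨h1, h2, h3⟩ h4
    obtain ⟨-, h6, h7⟩ := h.cone _ h1.1 h1.2.1 h1.2.2 h2
    rw [Function.iterate_succ_apply'] at h4 ⊢
    refine ⟨h4, h7, ?_⟩
    have h8 : 0 < (c * ν ^ (k + 1) * u (H (H^[k] y))) * (u (H^[k] y)) ^ 2 := by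
      have := mul_pos h3 h6
      calc _ < _ := this
        _ = _ := by ring
    by_contra hcon
    exact absurd h8 (not_lt.2 (mul_nonpos_of_nonpos_of_nonneg (not_lt.1 hcon) (sq_nonneg _)))
  have hpers : ∀ c y k, H^[k] y ∈ C (c * ν ^ k) → ∀ k', k ≤ k' → (∀ j ≤ k', H^[j] y ∈ B) →
      H^[k'] y ∈ C (c * ν ^ k') := by
    intro c y k hk k' hkk'
    induction k', hkk' using Nat.le_induction with
    | base => exact fun _ => hk
    | succ m hm ih =>
      intro hj
      exact hstep c y m (ih fun j hjm => hj j (hjm.trans (Nat.le_succ m))) (hj (m + 1) le_rfl)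
  -- In the cone `|u|` at least doubles, so no such orbit can stay in the box.
  have hgrow : ∀ y, s y < K * |u y| → ¬ ∀ l, H^[l] y ∈ B := by
    intro y hy hl
    have hu0 : 0 < |u y| := by
      by_contra hcon
      have h1 : |u y| = 0 := le_antisymm (not_lt.1 hcon) (abs_nonneg _)
      rw [h1, mul_zero] at hy
      exact absurd hy (not_lt.2 (hs0 y))
    have h1 : ∀ l : ℕ, s (H^[l] y) < K * |u (H^[l] y)| ∧ 2 ^ l * |u y| ≤ |u (H^[l] y)| := by
      intro l
      induction l with
      | zero => exact ⟨hy, by simp⟩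
      | succ l ih =>
        obtain ⟨h2, -, h4⟩ := h.cone _ (hl l).1 (hl l).2.1 (hl l).2.2 ih.1
        rw [Function.iterate_succ_apply']
        refine ⟨h4, le_trans ?_ h2⟩
        rw [pow_succ]
        linarith [ih.2]
    obtain ⟨l, hl2⟩ := pow_unbounded_of_one_lt (r / |u y|) (one_lt_two : (1 : ℝ) < 2)
    rw [div_lt_iff₀ hu0] at hl2
    linarith [(h1 l).2, (hl l).2.1]
  have hdisj : Disjoint (E 1) (E (-1)) := by
    rw [disjoint_left]
    intro y h1 h2
    obtain ⟨k, h3, h4⟩ := mem_iUnion.1 h1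
    obtain ⟨k', h5, h6⟩ := mem_iUnion.1 h2
    obtain ⟨m, h7, h8⟩ : ∃ m, H^[m] y ∈ C (1 * ν ^ m) ∧ H^[m] y ∈ C (-1 * ν ^ m) := by
      rcases le_total k k' with hk | hk
      · exact ⟨k', hpers 1 y k h4 k' hk h5, h6⟩
      · exact ⟨k, h4, hpers (-1) y k' h6 k hk h3⟩
    have := h7.2.2
    have := h8.2.2
    linarith
  -- The last point before the exit is in the cone, since points outside the cone do not leave the
  -- box.
  have hcov : U \ D ⊆ E 1 ∪ E (-1) := by
    rintro y ⟨hyU, hyD⟩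
    classical
    have hex := hnD y hyU hyD
    have hspec := Nat.find_spec hex
    obtain ⟨k, hk⟩ : ∃ k, Nat.find hex = k + 1 := by
      refine Nat.exists_eq_succ_of_ne_zero fun h0 => ?_
      rw [h0] at hspec
      exact hspec (hUB hyU)
    rw [hk] at hspec
    have hj : ∀ j ≤ k, H^[j] y ∈ B := fun j hj => not_not.1 (Nat.find_min hex (by omega))
    have hkB := hj k le_rfl
    have hcone : s (H^[k] y) < K * |u (H^[k] y)| := by
      by_contra hcon
      have := h.noncone _ hkB.1 hkB.2.1 hkB.2.2 (not_lt.1 hcon)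
      rw [Function.iterate_succ_apply'] at hspec
      exact hspec this
    have hune : u (H^[k] y) ≠ 0 := by
      intro h0
      rw [h0, abs_zero, mul_zero] at hcone
      exact absurd hcone (not_lt.2 (hs0 _))
    have hνne : ν ≠ 0 := by
      rintro rfl
      have := (h.cone _ hkB.1 hkB.2.1 hkB.2.2 hcone).2.1
      simp at this
    have hne : ν ^ k * u (H^[k] y) ≠ 0 := mul_ne_zero (pow_ne_zero _ hνne) hune
    rcases lt_or_gt_of_ne hne with h1 | h1
    · exact Or.inr (mem_iUnion.2 ⟨k, hj, hkB, hcone, by linarith⟩)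
    · exact Or.inl (mem_iUnion.2 ⟨k, hj, hkB, hcone, by linarith⟩)
  have hmem : ∀ c p, p ∈ U → s p < K * |u p| → 0 < c * u p → p ∈ (U \ D) ∩ E c := by
    intro c p hpU hp1 hp2
    refine ⟨⟨hpU, fun hpD => hgrow p hp1 (hD p hpU hpD)⟩, mem_iUnion.2 ⟨0, fun j hj => ?_, ?_⟩⟩
    · obtain rfl : j = 0 := by omega
      exact hUB hpU
    · exact ⟨hUB hpU, hp1, by simpa using hp2⟩
  obtain ⟨p, hpU, hp1, hp2⟩ := h.exists_pos U hU
  obtain ⟨p', hpU', hp1', hp2'⟩ := h.exists_neg U hU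
  obtain ⟨z, -, hz1, hz2⟩ := hconn (E 1) (E (-1)) (hEo 1) (hEo (-1)) hcov
    ⟨p, hmem 1 p hpU hp1 (by linarith)⟩ ⟨p', hmem (-1) p' hpU' hp1' (by linarith)⟩
  exact disjoint_left.1 hdisj hz1 hz2

/-- Estimates near a fixed point of a map whose derivative is hyperbolic with one unstable
direction. -/
theorem exists_saddle_estimates {E : Type*} [NormedAddCommGroup E] [NormedSpace ℝ E] {h : E → E}
    {C pr : E →L[ℝ] E} {ℓ : E →L[ℝ] ℝ} {v e : E} {ν : ℝ} (hh : HasFDerivAt h C e) (he : h e = e)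
    (hν : 4 ≤ |ν|) (hℓ : ∀ w, ℓ (C w) = ν * ℓ w) (hpr : ∀ w, ‖pr (C w)‖ ≤ 1 / 4 * ‖pr w‖)
    (hdec : ∀ w, w = pr w + ℓ w • v) {N : Set E} (hN : N ∈ 𝓝 e) :
    ∃ K r : ℝ, 0 < K ∧ 0 < r ∧ ∀ y, |ℓ (y - e)| < r → ‖pr (y - e)‖ < r → y ∈ N ∧
      (‖pr (y - e)‖ < K * |ℓ (y - e)| → 2 * |ℓ (y - e)| ≤ |ℓ (h y - e)| ∧
        0 < ν * ℓ (y - e) * ℓ (h y - e) ∧ ‖pr (h y - e)‖ < K * |ℓ (h y - e)|) ∧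
      (K * |ℓ (y - e)| ≤ ‖pr (y - e)‖ → |ℓ (h y - e)| < r ∧ ‖pr (h y - e)‖ < r) := by
  -- This `K` gives `|ν u| ≤ s / 4` outside the cone. The linearization error is made at most `η (s
  -- + |u|)`, that is, at most `|u| / 8` inside the cone and `s / 4` outside it; `A` converts the
  -- norm into the two coordinates.
  set K : ℝ := 4 * |ν| with hKdef
  have hK : 0 < K := by linarith
  set η : ℝ := 1 / (8 * (K + 1)) with hηdef
  have hη : 0 < η := by positivity
  have hηK : η * (K + 1) = 1 / 8 := by
    rw [hηdef]; field_simp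
  set A : ℝ := (‖ℓ‖ + ‖pr‖ + 1) * (1 + ‖v‖) with hAdef
  have hA : 0 < A := by positivity
  have hsmall := (hasFDerivAt_iff_isLittleO_nhds_zero.1 hh).def (div_pos hη hA)
  have hev : ∀ᶠ y in 𝓝 e, y ∈ N ∧ ‖h y - e - C (y - e)‖ ≤ η / A * ‖y - e‖ := by
    have h1 : Tendsto (fun y => y - e) (𝓝 e) (𝓝 0) := by
      have : ContinuousAt (fun y : E => y - e) e := by fun_prop
      simpa [ContinuousAt] using this
    filter_upwards [hN, h1.eventually hsmall] with y hy1 hy2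
    refine ⟨hy1, ?_⟩
    rwa [add_sub_cancel, he] at hy2
  obtain ⟨δ, hδ, hball⟩ := Metric.eventually_nhds_iff.1 hev
  have hnorm : ∀ w : E, ‖w‖ ≤ (‖pr w‖ + |ℓ w|) * (1 + ‖v‖) := by
    intro w
    have h1 : ‖w‖ ≤ ‖pr w‖ + |ℓ w| * ‖v‖ := by
      calc ‖w‖ = ‖pr w + ℓ w • v‖ := by rw [← hdec w]
        _ ≤ ‖pr w‖ + ‖ℓ w • v‖ := norm_add_le _ _
        _ = _ := by rw [norm_smul, Real.norm_eq_abs]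
    have h2 : 0 ≤ ‖pr w‖ * ‖v‖ := by positivity
    have h3 := abs_nonneg (ℓ w)
    linarith
  have hv1 : 0 < 1 + ‖v‖ := by positivity
  refine ⟨K, δ / (2 * (1 + ‖v‖)), hK, by positivity, fun y hyu hys => ?_⟩
  set u := ℓ (y - e) with hu
  set s := ‖pr (y - e)‖ with hs
  have hs0 : 0 ≤ s := norm_nonneg _
  have hu0 : 0 ≤ |u| := abs_nonneg _
  have hdist : dist y e < δ := by
    rw [dist_eq_norm]
    refine (hnorm (y - e)).trans_lt ?_
    have : s + |u| < δ / (2 * (1 + ‖v‖)) + δ / (2 * (1 + ‖v‖)) := add_lt_add hys hyu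
    calc (s + |u|) * (1 + ‖v‖) < (δ / (2 * (1 + ‖v‖)) + δ / (2 * (1 + ‖v‖))) * (1 + ‖v‖) :=
          mul_lt_mul_of_pos_right this hv1
      _ = δ := by field_simp; ring
  obtain ⟨hyN, hR⟩ := hball hdist
  have hRb : ‖h y - e - C (y - e)‖ * (‖ℓ‖ + ‖pr‖ + 1) ≤ η * (s + |u|) := by
    calc ‖h y - e - C (y - e)‖ * (‖ℓ‖ + ‖pr‖ + 1)
        ≤ η / A * ((s + |u|) * (1 + ‖v‖)) * (‖ℓ‖ + ‖pr‖ + 1) := by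
          refine mul_le_mul_of_nonneg_right (hR.trans ?_) (by positivity)
          exact mul_le_mul_of_nonneg_left (hnorm _) (by positivity)
      _ = η * (s + |u|) := by rw [hAdef]; field_simp
  have hRl : |ℓ (h y - e) - ν * u| ≤ η * (s + |u|) := by
    have h1 : ℓ (h y - e) - ν * u = ℓ (h y - e - C (y - e)) := by
      rw [map_sub ℓ (h y - e), hℓ]
    rw [h1, ← Real.norm_eq_abs]
    refine (ℓ.le_opNorm _).trans (le_trans ?_ hRb)
    rw [mul_comm]
    exact mul_le_mul_of_nonneg_left (by linarith [norm_nonneg pr]) (norm_nonneg _)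
  have hRp : ‖pr (h y - e)‖ ≤ 1 / 4 * s + η * (s + |u|) := by
    have h1 : pr (h y - e) = pr (C (y - e)) + pr (h y - e - C (y - e)) := by
      rw [← map_add]; congr 1; abel
    rw [h1]
    refine (norm_add_le _ _).trans (add_le_add (hpr _) ?_)
    refine (pr.le_opNorm _).trans (le_trans ?_ hRb)
    rw [mul_comm]
    exact mul_le_mul_of_nonneg_left (by linarith [norm_nonneg ℓ]) (norm_nonneg _)
  refine ⟨hyN, fun hcone => ?_, fun hnon => ?_⟩
  · have hupos : 0 < |u| := by
      by_contra hcon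
      have h1 : |u| = 0 := le_antisymm (not_lt.1 hcon) hu0
      rw [h1, mul_zero] at hcone
      linarith
    have h1 : η * (s + |u|) ≤ 1 / 8 * |u| := by
      calc η * (s + |u|) ≤ η * (K * |u| + |u|) :=
            mul_le_mul_of_nonneg_left (by linarith) hη.le
        _ = η * (K + 1) * |u| := by ring
        _ = _ := by rw [hηK]
    have h2 : |ν| * |u| - 1 / 8 * |u| ≤ |ℓ (h y - e)| := by
      have h3 := abs_sub_abs_le_abs_sub (ν * u) (ℓ (h y - e))
      rw [abs_mul, abs_sub_comm] at h3
      linarith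
    have h4 : 4 * |u| ≤ |ν| * |u| := mul_le_mul_of_nonneg_right hν hu0
    refine ⟨by linarith, ?_, ?_⟩
    · have h5 : |ν * u * (ℓ (h y - e) - ν * u)| ≤ |ν| * |u| * (1 / 8 * |u|) := by
        rw [abs_mul, abs_mul]
        exact mul_le_mul_of_nonneg_left (hRl.trans h1) (by positivity)
      have h6 : ν * u * ℓ (h y - e) = (|ν| * |u|) ^ 2 + ν * u * (ℓ (h y - e) - ν * u) := by
        rw [mul_pow, sq_abs, sq_abs]; ring
      have h7 := (abs_le.1 h5).1
      have h8 : 0 < |ν| * |u| := by positivity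
      rw [h6]
      nlinarith
    · have h5 : K * (3 * |u|) ≤ K * |ℓ (h y - e)| :=
        mul_le_mul_of_nonneg_left (by linarith) hK.le
      have h6 : 16 * |u| ≤ K * |u| := mul_le_mul_of_nonneg_right (by linarith) hu0
      linarith
  · have h0 : |u| ≤ s := by
      have : 1 * |u| ≤ K * |u| := mul_le_mul_of_nonneg_right (by linarith) hu0
      linarith
    have hη8 : η ≤ 1 / 8 := by nlinarith
    have h1 : η * (s + |u|) ≤ 1 / 8 * (s + s) :=
      mul_le_mul hη8 (by linarith) (by linarith) (by norm_num)
    have h2 : |ν| * |u| ≤ s / 4 := by rw [hKdef] at hnon; linarith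
    have h3 : |ℓ (h y - e)| ≤ |ν| * |u| + η * (s + |u|) := by
      have h3 := abs_sub_abs_le_abs_sub (ℓ (h y - e)) (ν * u)
      rw [abs_mul] at h3
      linarith
    exact ⟨by linarith, by linarith⟩

/-! ### Periodic points of hyperbolic sets -/

/-- Coordinates adapted to a hyperbolic splitting with one unstable direction. -/
theorem exists_saddle_coordinates {E : Type*} [NormedAddCommGroup E] [NormedSpace ℝ E]
    [FiniteDimensional ℝ E] {Vs Vu : Submodule ℝ E} (hcompl : IsCompl Vs Vu)
    (hrank : Module.finrank ℝ Vu = 1) {A : E →L[ℝ] E}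
    (hs : ∀ v ∈ Vs, A v ∈ Vs ∧ ‖A v‖ ≤ 1 / 4 * ‖v‖)
    (hu : ∀ v ∈ Vu, A v ∈ Vu ∧ ‖v‖ ≤ 1 / 4 * ‖A v‖) :
    ∃ (pr : E →L[ℝ] E) (ℓ : E →L[ℝ] ℝ) (v : E) (ν : ℝ), 4 ≤ |ν| ∧
      (∀ w, ℓ (A w) = ν * ℓ w) ∧ (∀ w, ‖pr (A w)‖ ≤ 1 / 4 * ‖pr w‖) ∧
      (∀ w, w = pr w + ℓ w • v) ∧ pr v = 0 ∧ ℓ v = 1 := by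
  obtain ⟨⟨v, hvVu⟩, hv0, hspan⟩ := finrank_eq_one_iff'.1 hrank
  have hvne : v ≠ 0 := fun h0 => hv0 (Subtype.ext h0)
  have hvpos : 0 < ‖v‖ := norm_pos_iff.2 hvne
  have hspan' : ∀ w ∈ Vu, ∃ c : ℝ, c • v = w := by
    intro w hw
    obtain ⟨c, hc⟩ := hspan ⟨w, hw⟩
    exact ⟨c, congrArg Subtype.val hc⟩
  obtain ⟨ν, hν⟩ := hspan' _ (hu v hvVu).1
  have hν4 : 4 ≤ |ν| := by
    have h1 := (hu v hvVu).2
    rw [← hν, norm_smul, Real.norm_eq_abs] at h1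
    by_contra hcon
    nlinarith
  -- `ℓ w` is to be the coefficient of `v` in the `Vu`-component of `w`; a functional with `g v =
  -- ‖v‖` reads it off.
  obtain ⟨g, -, hg⟩ := exists_dual_vector ℝ v hvpos.ne'
  have hgv : g v = ‖v‖ := by simpa using hg
  let pr : E →L[ℝ] E := LinearMap.toContinuousLinearMap (Vs.projection Vu hcompl)
  have hprVs : ∀ w, pr w ∈ Vs := fun w => Submodule.projection_apply_mem hcompl w
  have hprVu : ∀ w, w - pr w ∈ Vu := fun w => Submodule.sub_projection_mem hcompl w
  have hpr_left : ∀ w ∈ Vs, pr w = w := fun w hw => Submodule.projection_apply_of_mem_left hcompl hw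
  have hpr_right : ∀ w ∈ Vu, pr w = 0 := fun w hw =>
    (Submodule.projection_apply_eq_zero_iff hcompl).2 hw
  let ℓ : E →L[ℝ] ℝ := ‖v‖⁻¹ • g.comp (ContinuousLinearMap.id ℝ E - pr)
  have hℓapp : ∀ w, ℓ w = ‖v‖⁻¹ * g (w - pr w) := fun w => rfl
  have hdec : ∀ w, w - pr w = ℓ w • v := by
    intro w
    obtain ⟨c, hc⟩ := hspan' _ (hprVu w)
    have h1 : ℓ w = c := by
      rw [hℓapp, ← hc, map_smul, hgv, smul_eq_mul]
      field_simp
    rw [h1, hc]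
  have hsplit : ∀ w, w = pr w + ℓ w • v := fun w => by rw [← hdec]; abel
  have hAw : ∀ w, A w = A (pr w) + (ν * ℓ w) • v := by
    intro w
    conv_lhs => rw [hsplit w, map_add, map_smul, ← hν, smul_smul, mul_comm]
  have hprA : ∀ w, pr (A w) = A (pr w) := by
    intro w
    rw [hAw, map_add, hpr_left _ (hs _ (hprVs w)).1, hpr_right _ (Vu.smul_mem _ hvVu), add_zero]
  refine ⟨pr, ℓ, v, ν, hν4, fun w => ?_, fun w => ?_, hsplit, hpr_right v hvVu, ?_⟩
  · have h1 := hdec (A w)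
    rw [hprA] at h1
    conv_lhs at h1 => rw [hAw, add_sub_cancel_left]
    exact (smul_left_injective ℝ hvne h1).symm
  · rw [hprA]
    exact (hs _ (hprVs w)).2
  · rw [hℓapp, hpr_right v hvVu, sub_zero, hgv]
    field_simp

/-! ### Saddle charts from the derivative at a periodic point -/

section

set_option linter.unusedSectionVars false

variable {k : ℕ} {M : Type*} [EMetricSpace M] [ChartedSpace (EuclideanSpace ℝ (Fin k)) M]

/-- The derivative, at a point fixed by `f`, read on the model space. -/
noncomputable def derivAt (f : M → M) (x : M) :
    EuclideanSpace ℝ (Fin k) →L[ℝ] EuclideanSpace ℝ (Fin k) := mfderiv (𝓡 k) (𝓡 k) f x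

section Norm

variable [RiemannianBundle (fun x : M => TangentSpace (𝓡 k) x)]

/-- The Riemannian norm of a tangent vector at `x`, read on the model space. -/
noncomputable def tangentNorm (x : M) (v : EuclideanSpace ℝ (Fin k)) : ℝ :=
  ‖(show TangentSpace (𝓡 k) x from v)‖

/-- The fiber norm induces the topology of the model space, so the identity is bounded both ways.
That `c` depends on `x` is harmless, because only return maps to a periodic point are estimated. -/
theorem exists_norm_bound (x : M) : ∃ c : ℝ, 0 < c ∧ ∀ v : EuclideanSpace ℝ (Fin k),
    ‖v‖ ≤ c * tangentNorm x v ∧ tangentNorm x v ≤ c * ‖v‖ := by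
  let A : EuclideanSpace ℝ (Fin k) →L[ℝ] TangentSpace (𝓡 k) x :=
    ContinuousLinearMap.id ℝ (EuclideanSpace ℝ (Fin k))
  let B : TangentSpace (𝓡 k) x →L[ℝ] EuclideanSpace ℝ (Fin k) :=
    ContinuousLinearMap.id ℝ (EuclideanSpace ℝ (Fin k))
  refine ⟨‖A‖ + ‖B‖ + 1, by positivity, fun v => ⟨?_, ?_⟩⟩
  · have h1 : ‖v‖ ≤ ‖B‖ * tangentNorm x v := B.le_opNorm v
    have h2 : 0 ≤ tangentNorm x v := norm_nonneg _
    refine h1.trans (mul_le_mul_of_nonneg_right ?_ h2)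
    linarith [norm_nonneg A]
  · have h1 : tangentNorm x v ≤ ‖A‖ * ‖v‖ := A.le_opNorm v
    refine h1.trans (mul_le_mul_of_nonneg_right ?_ (norm_nonneg _))
    linarith [norm_nonneg B]

end Norm

/-- A map with a hyperbolic derivative at a fixed point has saddle charts there. -/
theorem exists_saddleChart_of_derivAt {H : M → M} {x : M}
    (hH : MDifferentiableAt (𝓡 k) (𝓡 k) H x) (hHc : Continuous H) (hfix : H x = x)
    {pr : EuclideanSpace ℝ (Fin k) →L[ℝ] EuclideanSpace ℝ (Fin k)}
    {ℓ : EuclideanSpace ℝ (Fin k) →L[ℝ] ℝ} {v : EuclideanSpace ℝ (Fin k)} {ν : ℝ}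
    (hν : 4 ≤ |ν|) (hℓ : ∀ w, ℓ (derivAt (k := k) H x w) = ν * ℓ w)
    (hpr : ∀ w, ‖pr (derivAt (k := k) H x w)‖ ≤ 1 / 4 * ‖pr w‖)
    (hdec : ∀ w, w = pr w + ℓ w • v) (hprv : pr v = 0) (hℓv : ℓ v = 1) {O : Set M}
    (hO : O ∈ 𝓝 x) : ∃ (u s : M → ℝ) (S : Set M) (K r : ℝ), (∀ y, 0 ≤ s y) ∧
      saddleBox u s S r ∈ 𝓝 x ∧ saddleBox u s S r ⊆ O ∧ IsSaddleChart H x u s S K ν r := by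
  set ψ := extChartAt (𝓡 k) x with hψ
  set e := ψ x with he
  have hxS : x ∈ ψ.source := mem_extChartAt_source x
  have hSo : IsOpen ψ.source := isOpen_extChartAt_source x
  have hψc : ContinuousOn ψ ψ.source := continuousOn_extChartAt x
  have hsymm : ContinuousAt ψ.symm e := continuousAt_extChartAt_symm x
  have hsx : ψ.symm e = x := ψ.left_inv hxS
  let h : EuclideanSpace ℝ (Fin k) → EuclideanSpace ℝ (Fin k) := fun w => ψ (H (ψ.symm w))
  have hh : HasFDerivAt h (derivAt (k := k) H x) e := by
    have h1 : HasFDerivWithinAt (writtenInExtChartAt (𝓡 k) (𝓡 k) x H) (derivAt (k := k) H x)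
        (range (𝓡 k)) e := hH.hasMFDerivAt.2
    rw [ModelWithCorners.range_eq_univ, hasFDerivWithinAt_univ] at h1
    -- Since `x` is fixed, the chart at `H x` is the chart at `x`.
    have h2 : writtenInExtChartAt (𝓡 k) (𝓡 k) x H = h := by
      funext w
      simp only [writtenInExtChartAt, hfix, Function.comp_apply, h, hψ]
    rw [h2] at h1
    exact h1
  have hhe : h e = e := by
    change ψ (H (ψ.symm e)) = e
    rw [hsx, hfix]
  have hN : {w | ψ.symm w ∈ O ∩ ψ.source ∩ H ⁻¹' ψ.source ∧ w ∈ ψ.target} ∈ 𝓝 e := by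
    have h1 : O ∩ ψ.source ∩ H ⁻¹' ψ.source ∈ 𝓝 x :=
      inter_mem (inter_mem hO (hSo.mem_nhds hxS))
        ((hSo.preimage hHc).mem_nhds (by rw [mem_preimage, hfix]; exact hxS))
    refine inter_mem (hsymm.preimage_mem_nhds (by rw [hsx]; exact h1)) ?_
    exact extChartAt_target_mem_nhds x
  obtain ⟨K, r, hK, hr, hest⟩ := exists_saddle_estimates hh hhe hν hℓ hpr hdec hN
  have key : ∀ y ∈ ψ.source, |ℓ (ψ y - e)| < r → ‖pr (ψ y - e)‖ < r →
      y ∈ O ∧ H y ∈ ψ.source ∧ h (ψ y) = ψ (H y) := by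
    intro y hy h1 h2
    have h3 := (hest (ψ y) h1 h2).1
    simp only [mem_ofPred_eq, ψ.left_inv hy] at h3
    exact ⟨h3.1.1.1, h3.1.2, by simp only [h, ψ.left_inv hy]⟩
  have hcu : ContinuousOn (fun y => ℓ (ψ y - e)) ψ.source :=
    ℓ.continuous.comp_continuousOn (hψc.sub continuousOn_const)
  have hcs : ContinuousOn (fun y => ‖pr (ψ y - e)‖) ψ.source :=
    (pr.continuous.comp_continuousOn (hψc.sub continuousOn_const)).norm
  -- Moving from `e` along `±v` gives points with zero stable part on either side.
  have hex : ∀ c : ℝ, |c| = 1 → ∀ U ∈ 𝓝 x, ∃ p ∈ U, ‖pr (ψ p - e)‖ < K * |ℓ (ψ p - e)| ∧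
      0 < c * ℓ (ψ p - e) := by
    intro c hc U hU
    have hcur : Tendsto (fun t : ℝ => e + (t * c) • v) (𝓝[>] 0) (𝓝 e) := by
      have : Continuous fun t : ℝ => e + (t * c) • v := by fun_prop
      have h1 := this.tendsto 0
      simp only [zero_mul, zero_smul, add_zero] at h1
      exact h1.mono_left nhdsWithin_le_nhds
    have hU' : ψ.symm ⁻¹' U ∈ 𝓝 e := hsymm.preimage_mem_nhds (by rw [hsx]; exact hU)
    have ht : ψ.target ∈ 𝓝 e := extChartAt_target_mem_nhds x
    obtain ⟨t, ⟨ht1, ht2⟩, ht3⟩ := ((hcur.eventually (inter_mem hU' ht)).and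
      self_mem_nhdsWithin).exists
    have ht0 : (0 : ℝ) < t := ht3
    have h1 : ψ (ψ.symm (e + (t * c) • v)) - e = (t * c) • v := by
      rw [ψ.right_inv ht2, add_sub_cancel_left]
    have hcc : c * c = 1 := by rw [← abs_mul_abs_self, hc, mul_one]
    refine ⟨_, ht1, ?_, ?_⟩
    · rw [h1, map_smul, hprv, smul_zero, norm_zero, map_smul, hℓv, smul_eq_mul, mul_one, abs_mul,
        hc, mul_one]
      exact mul_pos hK (abs_pos.2 ht0.ne')
    · rw [h1, map_smul, hℓv, smul_eq_mul, mul_one]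
      have : c * (t * c) = t := by rw [mul_left_comm, hcc, mul_one]
      rw [this]
      exact ht0
  refine ⟨fun y => ℓ (ψ y - e), fun y => ‖pr (ψ y - e)‖, ψ.source, K, r, fun y => norm_nonneg _,
    ?_, fun y hy => (key y hy.1 hy.2.1 hy.2.2).1, hSo, hcu, hcs, ?_, ?_, ?_, ?_⟩
  · have hu := (hcu.abs.continuousAt (hSo.mem_nhds hxS)).eventually_lt_const (u := r)
      (by simpa [he] using hr)
    have hs := (hcs.continuousAt (hSo.mem_nhds hxS)).eventually_lt_const (u := r)
      (by simpa [he] using hr)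
    filter_upwards [hSo.mem_nhds hxS, hu, hs] with y h1 h2 h3 using ⟨h1, h2, h3⟩
  · intro y hy h1 h2 h3
    have h4 := (hest (ψ y) h1 h2).2.1 h3
    rwa [(key y hy h1 h2).2.2] at h4
  · intro y hy h1 h2 h3
    have h4 := (hest (ψ y) h1 h2).2.2 h3
    rw [(key y hy h1 h2).2.2] at h4
    exact ⟨(key y hy h1 h2).2.1, h4⟩
  · intro U hU
    obtain ⟨p, hp, h1, h2⟩ := hex 1 abs_one U hU
    exact ⟨p, hp, h1, by simpa using h2⟩
  · intro U hU
    obtain ⟨p, hp, h1, h2⟩ := hex (-1) (by simp) U hU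
    exact ⟨p, hp, h1, by linarith⟩

variable [IsManifold (𝓡 k) 1 M]

theorem mdifferentiableAt_iterate (F : M ≃ₘ^1⟮𝓡 k, 𝓡 k⟯ M) (N : ℕ) (x : M) :
    MDifferentiableAt (𝓡 k) (𝓡 k) F^[N] x :=
  (F.contMDiff.iterate N).mdifferentiable one_ne_zero x

theorem iterate_mem_of_image_eq {F : M ≃ₘ^1⟮𝓡 k, 𝓡 k⟯ M} {Λ : Set M} (h : F '' Λ = Λ) {x : M}
    (hx : x ∈ Λ) (N : ℕ) : F^[N] x ∈ Λ := by
  induction N with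
  | zero => exact hx
  | succ N ih =>
    rw [Function.iterate_succ_apply']
    exact h ▸ mem_image_of_mem F ih

theorem mfderiv_iterate_mem {F : M ≃ₘ^1⟮𝓡 k, 𝓡 k⟯ M} {Λ : Set M} (h : F '' Λ = Λ)
    {V : ∀ x : M, Submodule ℝ (TangentSpace (𝓡 k) x)}
    (hV : ∀ x ∈ Λ, (V x).map (mfderiv (𝓡 k) (𝓡 k) F x).toLinearMap = V (F x)) {x : M}
    (hx : x ∈ Λ) {v : TangentSpace (𝓡 k) x} (hv : v ∈ V x) (N : ℕ) :
    mfderiv (𝓡 k) (𝓡 k) F^[N] x v ∈ V (F^[N] x) := by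
  induction N with
  | zero =>
    have h1 : mfderiv (𝓡 k) (𝓡 k) F^[0] x v = v := by
      rw [Function.iterate_zero, mfderiv_id]; rfl
    rw [h1]
    exact hv
  | succ N ih =>
    have h1 : mfderiv (𝓡 k) (𝓡 k) F^[N + 1] x v =
        mfderiv (𝓡 k) (𝓡 k) F (F^[N] x) (mfderiv (𝓡 k) (𝓡 k) F^[N] x v) := by
      rw [Function.iterate_succ', mfderiv_comp x (F.contMDiff.mdifferentiable one_ne_zero _)
        (mdifferentiableAt_iterate F N x)]
      rfl
    have h2 := Submodule.mem_map_of_mem (f := (mfderiv (𝓡 k) (𝓡 k) F (F^[N] x)).toLinearMap) ih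
    rw [hV _ (iterate_mem_of_image_eq h hx N)] at h2
    rw [h1, Function.iterate_succ_apply']
    exact h2

theorem derivAt_symm_derivAt (F : M ≃ₘ^1⟮𝓡 k, 𝓡 k⟯ M) {x : M} {N : ℕ} (hN : F^[N] x = x)
    (v : EuclideanSpace ℝ (Fin k)) : derivAt F.symm^[N] x (derivAt F^[N] x v) = v := by
  have h1 : F.symm^[N] ∘ F^[N] = id :=
    funext fun y => (Function.LeftInverse.iterate F.symm_apply_apply N) y
  have h2 := mfderiv_comp (I := 𝓡 k) (I' := 𝓡 k) (I'' := 𝓡 k) x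
    (mdifferentiableAt_iterate F.symm N (F^[N] x)) (mdifferentiableAt_iterate F N x)
  rw [h1, mfderiv_id] at h2
  have h3 : ∀ y, y = x → derivAt F.symm^[N] y (derivAt F^[N] x v) =
      derivAt F.symm^[N] x (derivAt F^[N] x v) := by
    rintro _ rfl; rfl
  rw [← h3 _ hN]
  exact (DFunLike.congr_fun h2 v).symm

variable [RiemannianBundle (fun x : M => TangentSpace (𝓡 k) x)]

/-- The hyperbolic splitting at a periodic point, in terms of the norm of the model space. -/
theorem IsHyperbolicSet.exists_splitting {F : M ≃ₘ^1⟮𝓡 k, 𝓡 k⟯ M} {Λ : Set M}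
    (h : IsHyperbolicSet F Λ) {x : M} (hx : x ∈ Λ) :
    ∃ (Vs Vu : Submodule ℝ (EuclideanSpace ℝ (Fin k))) (C lam : ℝ), 0 < lam ∧ lam < 1 ∧
      IsCompl Vs Vu ∧ Module.finrank ℝ Vu = 1 ∧ ∀ N, F^[N] x = x →
        (∀ v ∈ Vs, derivAt F^[N] x v ∈ Vs ∧ ‖derivAt F^[N] x v‖ ≤ C * lam ^ N * ‖v‖) ∧
        ∀ v ∈ Vu, derivAt F^[N] x v ∈ Vu ∧ ‖v‖ ≤ C * lam ^ N * ‖derivAt F^[N] x v‖ := by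
  obtain ⟨-, hinv, Es, Eu, C, lam, hC, hl0, hl1, hsplit⟩ := h
  obtain ⟨h1, h2, -, -, h5, h6⟩ := hsplit x hx
  obtain ⟨c, hc, hcb⟩ := exists_norm_bound (k := k) x
  have hmem : ∀ V : ∀ x : M, Submodule ℝ (TangentSpace (𝓡 k) x),
      (∀ x ∈ Λ, (V x).map (mfderiv (𝓡 k) (𝓡 k) F x).toLinearMap = V (F x)) →
      ∀ N, F^[N] x = x → ∀ v : EuclideanSpace ℝ (Fin k), v ∈ (V x : Submodule ℝ
        (EuclideanSpace ℝ (Fin k))) →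
      derivAt F^[N] x v ∈ (V x : Submodule ℝ (EuclideanSpace ℝ (Fin k))) := by
    intro V hV N hN v hv
    have h7 := mfderiv_iterate_mem hinv hV hx (v := v) hv N
    -- The equality `F^[N] x = x` is not definitional; a variable base point `y` allows the subspace
    -- at `F^[N] x` to be replaced by that at `x`.
    have h8 : ∀ y, y = x → derivAt F^[N] x v ∈ (V y : Submodule ℝ (EuclideanSpace ℝ (Fin k))) →
        derivAt F^[N] x v ∈ (V x : Submodule ℝ (EuclideanSpace ℝ (Fin k))) := by
      rintro _ rfl h; exact h
    exact h8 _ hN h7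
  have hnorm : ∀ (y : M) (w : EuclideanSpace ℝ (Fin k)), y = x →
      tangentNorm y w = tangentNorm x w := by
    rintro _ w rfl; rfl
  have hbound : ∀ N (w v : EuclideanSpace ℝ (Fin k)), tangentNorm x w ≤ C * lam ^ N *
      tangentNorm x v → ‖w‖ ≤ c * C * c * lam ^ N * ‖v‖ := by
    intro N w v hwv
    calc ‖w‖ ≤ c * tangentNorm x w := (hcb w).1
      _ ≤ c * (C * lam ^ N * tangentNorm x v) := mul_le_mul_of_nonneg_left hwv hc.le
      _ ≤ c * (C * lam ^ N * (c * ‖v‖)) := by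
        refine mul_le_mul_of_nonneg_left ?_ hc.le
        exact mul_le_mul_of_nonneg_left (hcb v).2 (by positivity)
      _ = _ := by ring
  refine ⟨Es x, Eu x, c * C * c, lam, hl0, hl1, h1, h2, fun N hN => ⟨fun v hv => ⟨?_, ?_⟩,
    fun v hv => ⟨?_, ?_⟩⟩⟩
  · exact hmem Es (fun y hy => (hsplit y hy).2.2.1) N hN v hv
  · refine hbound N _ _ ?_
    rw [← hnorm _ _ hN]
    exact h5 v hv N
  · exact hmem Eu (fun y hy => (hsplit y hy).2.2.2.1) N hN v hv
  · have hN' : F.symm^[N] x = x := by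
      conv_lhs => rw [← hN]
      exact (Function.LeftInverse.iterate F.symm_apply_apply N) x
    have h7 := hmem Eu (fun y hy => (hsplit y hy).2.2.2.1) N hN v hv
    have h8 := hbound N (derivAt F.symm^[N] x (derivAt F^[N] x v)) (derivAt F^[N] x v) (by
      rw [← hnorm _ (derivAt F.symm^[N] x (derivAt F^[N] x v)) hN']
      exact h6 _ h7 N)
    rwa [derivAt_symm_derivAt F hN] at h8

/-- Periodic points of hyperbolic sets with one-dimensional unstable bundle have saddle charts
for some iterate. -/
theorem IsHyperbolicSet.exists_saddleChart {F : M ≃ₘ^1⟮𝓡 k, 𝓡 k⟯ M} {Λ : Set M}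
    (h : IsHyperbolicSet F Λ) {x : M} (hx : x ∈ Λ) {m : ℕ} (hm : 0 < m) (hper : F^[m] x = x) :
    ∃ q, 0 < q ∧ ∀ O ∈ 𝓝 x, ∃ (u s : M → ℝ) (S : Set M) (K ν r : ℝ), (∀ y, 0 ≤ s y) ∧
      saddleBox u s S r ∈ 𝓝 x ∧ saddleBox u s S r ⊆ O ∧
      IsSaddleChart F^[m * q] x u s S K ν r := by
  obtain ⟨Vs, Vu, C, lam, hl0, hl1, hcompl, hrank, hN⟩ := h.exists_splitting hx
  -- A high iterate absorbs the constant `C`, so no adapted norm is needed.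
  obtain ⟨q, hq0, hq⟩ : ∃ q, 0 < q ∧ C * lam ^ (m * q) ≤ 1 / 4 := by
    have h1 : Tendsto (fun q : ℕ => C * lam ^ (m * q)) atTop (𝓝 (C * 0)) := by
      refine Tendsto.const_mul C ((tendsto_pow_atTop_nhds_zero_of_lt_one hl0.le hl1).comp ?_)
      exact tendsto_id.const_mul_atTop' hm
    rw [mul_zero] at h1
    obtain ⟨q, hq1, hq2⟩ := ((h1.eventually (eventually_le_nhds (show (0 : ℝ) < 1 / 4 by
      norm_num))).and (eventually_gt_atTop 0)).exists
    exact ⟨q, hq2, hq1⟩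
  have hfix : F^[m * q] x = x := by
    rw [Function.iterate_mul]
    exact Function.iterate_fixed hper q
  obtain ⟨hs, hu⟩ := hN (m * q) hfix
  have hscale : ∀ a : ℝ, 0 ≤ a → C * lam ^ (m * q) * a ≤ 1 / 4 * a := fun a ha =>
    mul_le_mul_of_nonneg_right hq ha
  obtain ⟨pr, ℓ, v, ν, h1, h2, h3, h4, h5, h6⟩ := exists_saddle_coordinates hcompl hrank
    (A := derivAt (k := k) F^[m * q] x)
    (fun w hw => ⟨(hs w hw).1, (hs w hw).2.trans (hscale _ (norm_nonneg _))⟩)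
    (fun w hw => ⟨(hu w hw).1, (hu w hw).2.trans (hscale _ (norm_nonneg _))⟩)
  refine ⟨q, hq0, fun O hO => ?_⟩
  obtain ⟨u, s, S, K, r, h7, h8, h9, h10⟩ := exists_saddleChart_of_derivAt
    (mdifferentiableAt_iterate F (m * q) x) (F.continuous.iterate _) hfix h1 h2 h3 h4 h5 h6 hO
  exact ⟨u, s, S, K, ν, r, h7, h8, h9, h10⟩

end

/-! ### Boundary fibers -/

/-- Points on a boundary fiber of a box have small neighborhoods that the fiber does not
separate. -/
theorem exists_preconnected_diff_fiber {n d : ℕ} {M : Type*} [TopologicalSpace M]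
    {φ : Fin n → Box d → M} {i : Fin n} (hφ : IsEmbedding (φ i)) {e : Itv}
    (he : IsTop e ∨ IsBot e) {x : M} (hx : x ∈ fiber φ i e) (hr : range (φ i) ∈ 𝓝 x) {W : Set M}
    (hW : W ∈ 𝓝 x) : ∃ V ∈ 𝓝 x, V ⊆ W ∧ IsPreconnected (V \ fiber φ i e) := by
  obtain ⟨a, rfl⟩ := hx
  have h1 : φ i ⁻¹' W ∈ 𝓝 (e, a) := hφ.continuous.continuousAt.preimage_mem_nhds hW
  obtain ⟨I, hI, B, hB, hIB⟩ := mem_nhds_prod_iff.1 h1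
  rw [nhds_pi, Filter.mem_pi] at hB
  obtain ⟨D, hDf, t, ht, htB⟩ := hB
  let B' : Set (Fin d → Itv) := pi univ fun j => ordConnectedComponent (t j) (a j)
  have hB' : B' ∈ 𝓝 a := set_pi_mem_nhds finite_univ fun j _ =>
    ordConnectedComponent_mem_nhds.2 (ht j)
  have hB'B : B' ⊆ B := fun y hy => htB fun j _ => ordConnectedComponent_subset (hy j (mem_univ j))
  let I' := ordConnectedComponent I e
  have hI' : I' ∈ 𝓝 e := ordConnectedComponent_mem_nhds.2 hI
  refine ⟨φ i '' (I' ×ˢ B'), ?_, ?_, ?_⟩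
  · rw [← hφ.isInducing.map_nhds_of_mem _ hr]
    exact image_mem_map (prod_mem_nhds hI' hB')
  · rintro _ ⟨p, hp, rfl⟩
    exact hIB ⟨ordConnectedComponent_subset hp.1, hB'B hp.2⟩
  · have h2 : φ i '' (I' ×ˢ B') \ fiber φ i e = φ i '' ((I' \ {e}) ×ˢ B') := by
      ext y
      constructor
      · rintro ⟨⟨⟨s, b⟩, ⟨hs, hb⟩, rfl⟩, hy⟩
        refine ⟨(s, b), ⟨⟨hs, ?_⟩, hb⟩, rfl⟩
        rintro rfl
        exact hy ⟨b, rfl⟩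
      · rintro ⟨⟨s, b⟩, ⟨⟨hs, hse⟩, hb⟩, rfl⟩
        refine ⟨⟨(s, b), ⟨hs, hb⟩, rfl⟩, ?_⟩
        rintro ⟨c, hc⟩
        exact hse (congrArg Prod.fst (hφ.injective hc)).symm
    rw [h2]
    refine IsPreconnected.image ?_ _ hφ.continuous.continuousOn
    refine IsPreconnected.prod (isPreconnected_of_ordConnected_itv ⟨?_⟩)
      (isPreconnected_univ_pi fun j => isPreconnected_of_ordConnected_itv inferInstance)
    -- Removing an extreme point keeps an interval order connected: a point between `u` and `v` can
    -- be extreme only if `u` or `v` is.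
    rintro u ⟨hu, hue⟩ v ⟨hv, hve⟩ w hw
    refine ⟨OrdConnected.out inferInstance hu hv hw, ?_⟩
    rintro rfl
    rcases he with he | he
    · exact hve (le_antisymm (he v) hw.2)
    · exact hue (le_antisymm hw.1 (he u))

/-! ### Boundary fibers do not return into themselves -/

namespace IsRectSystem

section

set_option linter.unusedSectionVars false

variable {n d : ℕ} {M : Type*} [EMetricSpace M] {len : Fin n → ℕ} {F : M ≃ₜ M}
  {φ : Fin n → Box d → M} {tgt : Cell len → Fin n} {J : Cell len → Set Itv}
  {g : Cell len → Itv → Itv}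

theorem isPreconnected_fiber (h : IsRectSystem F φ tgt J g) (i : Fin n) (t : Itv) :
    IsPreconnected (fiber φ i t) := by
  have h1 : fiber φ i t = φ i '' ({t} ×ˢ univ) := by
    ext y; simp [fiber]
  rw [h1]
  exact (isPreconnected_prod_univ ordConnected_singleton).image _ (h.emb i).continuous.continuousOn

/-- A fiber that returns into itself contains a periodic point of the core, to which it shrinks. -/
theorem exists_periodic_of_return (h : IsRectSystem F φ tgt J g) {i : Fin n} {e : Itv} {m : ℕ}
    (hm : 0 < m) (hD : MapsTo F^[m] (fiber φ i e) (fiber φ i e))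
    (hr : ∀ y ∈ fiber φ i e, ∀ l ≤ m, F^[l] y ∈ rects φ) :
    ∃ x ∈ coreSet F φ, x ∈ fiber φ i e ∧ F^[m] x = x ∧
      ∀ O ∈ 𝓝 x, ∃ L, ∀ l ≥ L, ∀ y ∈ fiber φ i e, (F^[m])^[l] y ∈ O := by
  set D := fiber φ i e
  set H := F^[m] with hH
  let A : ℕ → Set M := fun l => H^[l] '' D
  have hHc : ∀ l, Continuous H^[l] := fun l => (continuous_iterate m).iterate l
  have hDl : ∀ l, MapsTo H^[l] D D := fun l => hD.iterate l
  have hanti : Antitone A := by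
    refine antitone_nat_of_succ_le fun l => ?_
    rintro _ ⟨y, hy, rfl⟩
    exact ⟨H y, hD hy, rfl⟩
  have hAc : ∀ l, IsCompact (A l) := fun l => (h.isCompact_fiber i e).image (hHc l)
  have hfw : ∀ y ∈ D, ∀ l, F^[l] y ∈ rects φ := by
    intro y hy l
    rw [← Nat.mod_add_div l m, Function.iterate_add_apply, Function.iterate_mul]
    exact hr _ (hDl _ hy) _ (Nat.mod_lt l hm).le
  have hcore : ⋂ l, A l ⊆ coreSet F φ := by
    intro y hy
    rw [mem_iInter] at hy
    refine ⟨fun l => ?_, fun l => ?_⟩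
    · obtain ⟨w, hw, rfl⟩ := hy 0
      exact hfw w hw l
    · obtain ⟨w, hw, rfl⟩ := hy l
      obtain ⟨k, hk⟩ := Nat.exists_eq_add_of_le (Nat.le_mul_of_pos_left l hm)
      rw [hH, ← Function.iterate_mul, hk, Function.iterate_add_apply, symm_iterate_apply_iterate]
      exact hfw w hw k
  -- The images of the fiber decrease to a connected subset of the core, hence to a single point,
  -- which is therefore fixed by `H`.
  have hsub := h.zero _ hcore (isPreconnected_iInter_of_antitone hanti hAc fun l =>
    (h.isPreconnected_fiber i e).image _ (hHc l).continuousOn)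
  obtain ⟨x, hx⟩ := IsCompact.nonempty_iInter_of_sequence_nonempty_isCompact_isClosed A
    (fun l => hanti (Nat.le_succ l)) (fun l => (fiber_nonempty i e).image _) (hAc 0)
    fun l => (hAc l).isClosed
  have hx' := mem_iInter.1 hx
  have hfix : H x = x := by
    refine hsub (mem_iInter.2 fun l => hanti (Nat.le_succ l) ?_) hx
    obtain ⟨w, hw, hwx⟩ := hx' l
    exact ⟨w, hw, by rw [Function.iterate_succ_apply', hwx]⟩
  refine ⟨x, hcore hx, ?_, hfix, fun O hO => ?_⟩
  · obtain ⟨w, hw, rfl⟩ := hx' 0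
    exact hw
  · obtain ⟨L, hL⟩ := exists_subset_nhds_of_isCompact' (directed_of_isDirected_le hanti) hAc
      (fun l => (hAc l).isClosed) (U := O) fun y hy => by rwa [hsub hy hx]
    exact ⟨L, fun l hl y hy => hL (hanti hl ⟨y, hy, rfl⟩)⟩

/-- Near `w` every point lies in some cell, and the finitely many closed cells that miss `w` can be
avoided. -/
theorem sameCell_mem_nhds (h : IsRectSystem F φ tgt J g) (hint : coreSet F φ ⊆ interior (rects φ))
    {w : M} (hw : w ∈ coreSet F φ) (hw' : F w ∈ coreSet F φ) : {y | SameCell φ J w y} ∈ 𝓝 w := by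
  obtain ⟨c, hc⟩ := h.exists_cell (hw.1 0) (hw.1 1)
  have h1 : (⋂ s ∈ {s : Cell len | s ≠ c}, (cellSet φ J s)ᶜ) ∈ 𝓝 w := by
    refine (biInter_mem (toFinite _)).2 fun s hs => ?_
    exact (h.isCompact_cellSet s).isClosed.isOpen_compl.mem_nhds fun h2 => hs (h.cell_unique h2 hc)
  have h2 : rects φ ∈ 𝓝 w := mem_interior_iff_mem_nhds.1 (hint hw)
  have h3 : F ⁻¹' rects φ ∈ 𝓝 w :=
    F.continuous.continuousAt.preimage_mem_nhds (mem_interior_iff_mem_nhds.1 (hint hw'))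
  filter_upwards [h1, h2, h3] with y hy1 hy2 hy3
  obtain ⟨s, hs⟩ := h.exists_cell hy2 hy3
  have hsc : s = c := by
    by_contra hne
    exact mem_iInter₂.1 hy1 s hne hs
  exact ⟨c, hc, hsc ▸ hs⟩

theorem iterate_mem_coreSet {z : M} (hz : z ∈ coreSet F φ) (N : ℕ) : F^[N] z ∈ coreSet F φ := by
  refine ⟨fun l => ?_, fun l => ?_⟩
  · rw [← Function.iterate_add_apply]
    exact hz.1 _
  · rcases le_total l N with h1 | h1
    · obtain ⟨k, rfl⟩ := Nat.exists_eq_add_of_le h1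
      rw [Function.iterate_add_apply, symm_iterate_apply_iterate]
      exact hz.1 k
    · obtain ⟨k, rfl⟩ := Nat.exists_eq_add_of_le h1
      rw [add_comm, Function.iterate_add_apply, symm_iterate_apply_iterate]
      exact hz.2 k

/-- Points that stay near a periodic point of the core lie in its fiber. -/
theorem exists_nhds_subset_fiber (h : IsRectSystem F φ tgt J g)
    (hint : coreSet F φ ⊆ interior (rects φ)) {x : M} (hx : x ∈ coreSet F φ) {m : ℕ} (hm : 0 < m)
    (hfix : F^[m] x = x) {i : Fin n} {e : Itv} (hxe : x ∈ fiber φ i e) :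
    ∃ O ∈ 𝓝 x, ∀ y, (∀ l, (F^[m])^[l] y ∈ O) → y ∈ fiber φ i e := by
  -- One period of conditions suffices: meeting them at all multiples of `m` means sharing the whole
  -- future of `x`.
  refine ⟨⋂ r ∈ Finset.range m, F^[r] ⁻¹' {y | SameCell φ J (F^[r] x) y}, ?_, fun y hy => ?_⟩
  · refine (biInter_finset_mem _).2 fun r _ => ?_
    refine (continuous_iterate r).continuousAt.preimage_mem_nhds ?_
    refine h.sameCell_mem_nhds hint (iterate_mem_coreSet hx r) ?_
    rw [← Function.iterate_succ_apply' F r x]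
    exact iterate_mem_coreSet hx (r + 1)
  · refine h.mem_fiber_of_sameCell hx (fun l => ?_) hxe
    rw [← Nat.mod_add_div l m, Function.iterate_add_apply, Function.iterate_mul,
      Function.iterate_add_apply, Function.iterate_mul, Function.iterate_fixed hfix]
    exact mem_iInter₂.1 (hy (l / m)) (l % m) (Finset.mem_range.2 (Nat.mod_lt l hm))

/-- If the periodic points of the core have saddle charts, then no boundary fiber returns into
itself. -/
theorem not_mapsTo_fiber (h : IsRectSystem F φ tgt J g)
    (hint : ∀ x ∈ coreSet F φ, ∀ i, x ∈ range (φ i) → range (φ i) ∈ 𝓝 x)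
    (hsaddle : ∀ x ∈ coreSet F φ, ∀ m, 0 < m → F^[m] x = x → ∃ q, 0 < q ∧ ∀ O ∈ 𝓝 x,
      ∃ (u s : M → ℝ) (S : Set M) (K ν r : ℝ), (∀ y, 0 ≤ s y) ∧ saddleBox u s S r ∈ 𝓝 x ∧
        saddleBox u s S r ⊆ O ∧ IsSaddleChart F^[m * q] x u s S K ν r)
    {i : Fin n} {e : Itv} (he : IsTop e ∨ IsBot e) {m : ℕ} (hm : 0 < m)
    (hr : ∀ y ∈ fiber φ i e, ∀ l ≤ m, F^[l] y ∈ rects φ) :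
    ¬ MapsTo F^[m] (fiber φ i e) (fiber φ i e) := by
  intro hD
  have hint' : coreSet F φ ⊆ interior (rects φ) := by
    intro x hx
    obtain ⟨j, hj⟩ := mem_iUnion.1 (hx.1 0)
    exact mem_interior_iff_mem_nhds.2 (mem_of_superset (hint x hx j hj)
      (subset_iUnion (fun i => range (φ i)) j))
  obtain ⟨x, hx, hxe, hfix, hshrink⟩ := h.exists_periodic_of_return hm hD hr
  obtain ⟨q, hq, hcharts⟩ := hsaddle x hx m hm hfix
  have hH : F^[m * q] = (F^[m])^[q] := Function.iterate_mul _ _ _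
  have hfix' : F^[m * q] x = x := by rw [hH]; exact Function.iterate_fixed hfix q
  obtain ⟨O, hO, hOD⟩ := h.exists_nhds_subset_fiber hint' hx (Nat.mul_pos hm hq) hfix' hxe
  obtain ⟨u, s, S, K, ν, r, hs0, hB, hBO, hchart⟩ := hcharts O hO
  set B := saddleBox u s S r
  obtain ⟨L, hL⟩ := hshrink B hB
  -- The first `L` iterates are kept in the box by the choice of neighbourhood; later iterates of
  -- points of the fiber are there because the fiber shrinks to `x`.
  have hW : (⋂ l ∈ Finset.range L, (F^[m * q])^[l] ⁻¹' B) ∩ B ∈ 𝓝 x := by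
    refine inter_mem ((biInter_finset_mem _).2 fun l _ => ?_) hB
    refine ((continuous_iterate _).iterate l).continuousAt.preimage_mem_nhds ?_
    rwa [Function.iterate_fixed hfix' l]
  obtain ⟨V, hV, hVW, hVp⟩ := exists_preconnected_diff_fiber (h.emb i) he hxe
    (hint x hx i (fiber_subset_range _ _ hxe)) hW
  refine hchart.not_isPreconnected_diff (continuous_iterate _) hs0 hV (hVW.trans inter_subset_right)
    (fun y hyV hyD l => ?_) (fun y _ hyD => ?_) hVp
  · rcases lt_or_ge l L with hl | hl
    · exact mem_iInter₂.1 (hVW hyV).1 l (Finset.mem_range.2 hl)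
    · rw [hH, ← Function.iterate_mul]
      exact hL _ (hl.trans (Nat.le_mul_of_pos_left l hq)) y hyD
  · by_contra! hcon
    exact hyD (hOD y fun l => hBO (hcon l))

/-- If the periodic points of the core have saddle charts, then every point whose backward orbit
stays in the rectangles has a preimage off the boundary fibers. -/
theorem exists_symm_iterate_mem_fiber (h : IsRectSystem F φ tgt J g)
    (hint : ∀ x ∈ coreSet F φ, ∀ i, x ∈ range (φ i) → range (φ i) ∈ 𝓝 x)
    (hsaddle : ∀ x ∈ coreSet F φ, ∀ m, 0 < m → F^[m] x = x → ∃ q, 0 < q ∧ ∀ O ∈ 𝓝 x,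
      ∃ (u s : M → ℝ) (S : Set M) (K ν r : ℝ), (∀ y, 0 ≤ s y) ∧ saddleBox u s S r ∈ 𝓝 x ∧
        saddleBox u s S r ⊆ O ∧ IsSaddleChart F^[m * q] x u s S K ν r)
    {z : M} (hz : z ∈ pastSet F φ) :
    ∃ N i, ∃ t ∈ range lineItv, F.symm^[N] z ∈ fiber φ i t := by
  by_contra! hcon
  choose i t hit using fun N => mem_rects_iff.1 (hz N)
  have hend : ∀ N, IsTop (t N) ∨ IsBot (t N) := by
    intro N
    by_contra! hne
    refine hcon N (i N) (t N) ?_ (hit N)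
    rw [range_lineItv]
    refine ⟨lt_of_not_ge fun h1 => hne.2 fun a => ?_, lt_of_not_ge fun h1 => hne.1 fun a => ?_⟩
    · exact Subtype.coe_le_coe.1 (h1.trans a.2.1)
    · exact Subtype.coe_le_coe.1 (a.2.2.trans h1)
  -- There are finitely many boundary fibers, so the backward orbit visits one of them twice.
  obtain ⟨N₁, N₂, hlt, heq⟩ : ∃ N₁ N₂, N₁ < N₂ ∧ (i N₁, IsTop (t N₁)) = (i N₂, IsTop (t N₂)) := by
    obtain ⟨a, b, hab, heq⟩ := Finite.exists_ne_map_eq_of_infinite fun N => (i N, IsTop (t N))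
    rcases lt_or_gt_of_ne hab with h1 | h1
    · exact ⟨a, b, h1, heq⟩
    · exact ⟨b, a, h1, heq.symm⟩
  obtain ⟨hi, htop⟩ := Prod.ext_iff.1 heq
  simp only [eq_iff_iff] at hi htop
  have ht : t N₁ = t N₂ := by
    rcases hend N₁ with h1 | h1
    · exact le_antisymm (htop.1 h1 _) (h1 _)
    · rcases hend N₂ with h2 | h2
      · exact le_antisymm (h2 _) (htop.2 h2 _)
      · exact le_antisymm (h1 _) (h2 _)
  obtain ⟨m, rfl⟩ := Nat.exists_eq_add_of_lt hlt
  have hiter : ∀ l ≤ N₁ + m + 1, F^[l] (F.symm^[N₁ + m + 1] z) = F.symm^[N₁ + m + 1 - l] z := by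
    intro l hl
    obtain ⟨k, hk⟩ := Nat.exists_eq_add_of_le hl
    rw [hk, Function.iterate_add_apply, iterate_apply_symm_iterate, Nat.add_sub_cancel_left]
  have hp := hit (N₁ + m + 1)
  rw [← hi, ← ht] at hp
  have hpr : ∀ l ≤ m + 1, F^[l] (F.symm^[N₁ + m + 1] z) ∈ rects φ := by
    intro l hl
    rw [hiter l (by omega)]
    exact hz _
  refine h.not_mapsTo_fiber hint hsaddle (hend N₁) (Nat.succ_pos m) (i := i N₁)
    (fun y hy l hl => ?_) fun y hy => ?_
  · obtain ⟨j, v, -, h2⟩ := h.forward_fiber hp hy (N := l) fun l' hl' => hpr l' (hl'.trans hl)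
    exact mem_rects_of_mem_fiber h2
  · obtain ⟨j, v, h1, h2⟩ := h.forward_fiber hp hy (N := m + 1) hpr
    rw [hiter _ (by omega), show N₁ + m + 1 - (m + 1) = N₁ by omega] at h1
    obtain ⟨rfl, rfl⟩ := h.fiber_unique h1 (hit N₁)
    exact h2

end

end IsRectSystem

/-! ### From Markov systems to systems of rectangles -/

theorem _root_.IsClosed.connectedComponentIn {X : Type*} [TopologicalSpace X] {D : Set X}
    (hD : IsClosed D) (x : X) : IsClosed (connectedComponentIn D x) := by
  by_cases hx : x ∈ D
  · refine isClosed_of_closure_subset ?_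
    exact isPreconnected_connectedComponentIn.closure.subset_connectedComponentIn
      (subset_closure (mem_connectedComponentIn hx))
      (closure_minimal (connectedComponentIn_subset D x) hD)
  · rw [connectedComponentIn_eq_empty hx]
    exact isClosed_empty

/-- Dimension zero provides a basis of clopen sets, and a connected set cannot be split by one of
them. -/
theorem subsingleton_of_hasSmallInductiveDimensionLE_zero {X : Type*} [TopologicalSpace X]
    [T2Space X] {Λ : Set X} (h : HasSmallInductiveDimensionLE Λ 0) {T : Set X} (hT : T ⊆ Λ)
    (hc : IsPreconnected T) : T.Subsingleton := by
  intro x hx y hy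
  by_contra hne
  have hb := hasSmallInductiveDimensionLT_one_iff.1 h
  have hxy : (⟨x, hT hx⟩ : Λ) ≠ ⟨y, hT hy⟩ := fun h1 => hne (congrArg Subtype.val h1)
  obtain ⟨U, hU, hxU, hUy⟩ := hb.mem_nhds_iff.1 (isOpen_compl_singleton.mem_nhds hxy)
  have hTc : IsPreconnected ((↑) ⁻¹' T : Set Λ) := by
    rw [← IsInducing.subtypeVal.isPreconnected_image, Subtype.image_preimage_coe,
      inter_eq_right.2 hT]
    exact hc
  exact hUy (hTc.subset_isClopen hU ⟨⟨x, hT hx⟩, hx, hxU⟩ (show (⟨y, hT hy⟩ : Λ) ∈ _ from hy)) rfl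

theorem isClosed_inducedDomain {n d : ℕ} {M : Type*} [TopologicalSpace M] [T2Space M] {F : M → M}
    (hF : Continuous F) {φ : Fin n → Box d → M} (hφ : ∀ i, Continuous (φ i)) (i : Fin n) :
    IsClosed (inducedDomain F φ i) := by
  have h1 : IsCompact (rects φ) := isCompact_iUnion fun i => isCompact_range (hφ i)
  have h2 : inducedDomain F φ i = Prod.fst '' ((fun p => F (φ i p)) ⁻¹' rects φ) := by
    ext t
    simp [inducedDomain]
  rw [h2]
  exact ((h1.isClosed.preimage (hF.comp (hφ i))).isCompact.image continuous_fst).isClosed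

section

variable {n d : ℕ} {M : Type*} [EMetricSpace M] [ChartedSpace (EuclideanSpace ℝ (Fin (d + 1))) M]
  {F : M ≃ₘ^1⟮𝓡 (d + 1), 𝓡 (d + 1)⟯ M} {φ : Fin n → Box d → M}

theorem iInter_zpow_image_rects :
    (⋂ l : ℤ, ⇑((F.toEquiv : Equiv.Perm M) ^ l) '' rects φ) = coreSet F.toHomeomorph φ := by
  have h1 : ∀ (l : ℤ) z, z ∈ ⇑((F.toEquiv : Equiv.Perm M) ^ l) '' rects φ ↔
      ((F.toEquiv : Equiv.Perm M) ^ (-l)) z ∈ rects φ := by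
    intro l z
    rw [Equiv.image_eq_preimage_symm, zpow_neg]
    rfl
  have h2 : ∀ (l : ℕ) z, ((F.toEquiv : Equiv.Perm M) ^ (l : ℤ)) z = F.toHomeomorph^[l] z := by
    intro l z
    rw [zpow_natCast]
    rfl
  have h3 : ∀ (l : ℕ) z, ((F.toEquiv : Equiv.Perm M) ^ (-(l : ℤ))) z =
      F.toHomeomorph.symm^[l] z := by
    intro l z
    rw [zpow_neg, ← inv_zpow, zpow_natCast]
    rfl
  ext z
  simp only [mem_iInter, h1]
  constructor
  · intro h
    refine ⟨fun l => ?_, fun l => ?_⟩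
    · have := h (-l)
      rwa [neg_neg, h2] at this
    · have := h l
      rwa [h3] at this
  · rintro ⟨h4, h5⟩ l
    obtain ⟨m, rfl | rfl⟩ := l.eq_nat_or_neg
    · rw [h3]
      exact h5 m
    · rw [neg_neg, h2]
      exact h4 m

/-- The unstable set of the core consists of the points whose backward orbit is eventually in the
rectangles. -/
theorem IsRectSystem.wuSet_coreSet {len : Fin n → ℕ} {tgt : Cell len → Fin n}
    {J : Cell len → Set Itv} {g : Cell len → Itv → Itv}
    (h : IsRectSystem F.toHomeomorph φ tgt J g)
    (hint : coreSet F.toHomeomorph φ ⊆ interior (rects φ)) :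
    WuSet F (coreSet F.toHomeomorph φ) = unstableSet F.toHomeomorph φ := by
  ext z
  constructor
  · intro hz
    obtain ⟨w, hw, hzw⟩ := mem_iUnion₂.1 hz
    obtain ⟨N, hN⟩ := eventually_atTop.1 (h.eventually_mem_interior hint hw (z := z) hzw)
    refine ⟨N, fun l => ?_⟩
    rw [← Function.iterate_add_apply]
    exact interior_subset (hN _ (Nat.le_add_left N l))
  · rintro ⟨N, hN⟩
    obtain ⟨w, hw, hzw⟩ := h.exists_asymptotic hN
    refine mem_iUnion₂.2 ⟨_, iterate_mem_coreSet hw N, ?_⟩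
    refine (tendsto_add_atTop_iff_nat N).1 (hzw.congr fun l => ?_)
    change edist (F.toHomeomorph.symm^[l] (F.toHomeomorph.symm^[N] z)) _ =
      edist (F.toHomeomorph.symm^[l + N] z) (F.toHomeomorph.symm^[l + N] (F.toHomeomorph^[N] w))
    rw [Function.iterate_add_apply, Function.iterate_add_apply, symm_iterate_apply_iterate]

variable [RiemannianBundle (fun x : M => TangentSpace (𝓡 (d + 1)) x)] {Λ : Set M}

theorem IsMarkovSystem.eq_coreSet (hF : IsMarkovSystem F Λ φ) : Λ = coreSet F.toHomeomorph φ :=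
  hF.r2_eq.trans iInter_zpow_image_rects

/-- A Markov system whose induced map has a pattern is a system of rectangles. -/
theorem IsMarkovSystem.exists_rectSystem (hF : IsMarkovSystem F Λ φ)
    {χ : Letter n → List (Letter n)} (hχ : IsSystemPattern F φ χ) :
    ∃ (J : Cell (wordLen χ) → Set Itv) (g : Cell (wordLen χ) → Itv → Itv),
      IsRectSystem F.toHomeomorph φ (letterTgt χ) J g ∧
      (∀ s, letterOri χ s = true → MonotoneOn (g s) (J s)) ∧
      (∀ s, letterOri χ s = false → AntitoneOn (g s) (J s)) ∧
      ∀ i (j j' : Fin (wordLen χ i)), j < j' → ∀ t ∈ J ⟨i, j⟩, ∀ u ∈ J ⟨i, j'⟩, t < u := by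
  choose J hJ hg using fun i => (hχ i).1
  choose g hind hsurj hmono hanti using hg
  have hcore := hF.eq_coreSet
  have hDc : ∀ i, IsClosed (inducedDomain F φ i) :=
    isClosed_inducedDomain F.continuous fun i => (hF.r1 i).continuous
  have hcomp : ∀ i j, ∃ t ∈ inducedDomain F φ i, J i j =
      connectedComponentIn (inducedDomain F φ i) t := fun i j => ((hJ i).1 _).1 ⟨j, rfl⟩
  refine ⟨fun s => J s.1 s.2, fun s => g s.1 s.2, ?_, fun s => hmono s.1 s.2,
    fun s => hanti s.1 s.2, fun i => (hJ i).2⟩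
  refine ⟨hF.r1, hF.disjoint, ?_, ?_, ?_, ?_, fun s => hsurj s.1 s.2, ?_, ?_, ?_, ?_, ?_⟩
  · rintro ⟨i, j⟩
    obtain ⟨t, -, ht⟩ := hcomp i j
    change IsClosed (J i j)
    rw [ht]
    exact (hDc i).connectedComponentIn t
  · rintro ⟨i, j⟩
    obtain ⟨t, -, ht⟩ := hcomp i j
    change OrdConnected (J i j)
    rw [ht]
    exact isPreconnected_connectedComponentIn.ordConnected
  · rintro ⟨i, j⟩ ⟨i', j'⟩ hi t ht ht'
    obtain rfl : i = i' := hi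
    rcases lt_trichotomy j j' with h1 | rfl | h1
    · exact absurd ((hJ i).2 _ _ h1 t ht t ht') (lt_irrefl t)
    · rfl
    · exact absurd ((hJ i).2 _ _ h1 t ht' t ht) (lt_irrefl t)
  · intro s
    cases hs : letterOri χ s with
    | true => exact Or.inl (hmono s.1 s.2 hs)
    | false => exact Or.inr (hanti s.1 s.2 hs)
  · intro s t x ht
    obtain ⟨y, y', hy⟩ := hind s.1 s.2 t ht
    -- `Induces` relates one pair of points; R3 extends the relation to the whole fiber.
    exact hF.r3 _ _ _ _ _ _ hy ⟨_, ⟨x, rfl⟩, rfl⟩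
  · intro i t x hx
    have ht : t ∈ inducedDomain F φ i := ⟨x, hx⟩
    obtain ⟨j, hj⟩ := ((hJ i).1 (connectedComponentIn (inducedDomain F φ i) t)).2 ⟨t, ht, rfl⟩
    refine ⟨⟨i, j⟩, rfl, ?_⟩
    change t ∈ J i j
    rw [hj]
    exact mem_connectedComponentIn ht
  · rw [← hcore]
    exact fun T hT hTc => subsingleton_of_hasSmallInductiveDimensionLE_zero hF.zero_dim hT hTc
  · rw [← hcore]
    exact hF.r2_nonempty
  · intro i w hw hwr T hT hTc hwT hTw t y hy y' hy'
    have h1 : T ⊆ WuRect F φ w i :=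
      hTc.subset_connectedComponentIn hwT fun y hy => ⟨hTw y hy, hT hy⟩
    exact (hF.r4_fiber i w (hcore ▸ hw) hwr t).unique ⟨h1 hy.1, hy.2⟩ ⟨h1 hy'.1, hy'.2⟩

theorem IsMarkovSystem.range_mem_nhds (hF : IsMarkovSystem F Λ φ) {x : M} (hx : x ∈ Λ) {i : Fin n}
    (hxi : x ∈ range (φ i)) : range (φ i) ∈ 𝓝 x := by
  obtain ⟨j, hj⟩ := mem_iUnion.1 (hF.subset_interior hx)
  obtain rfl : i = j := by
    by_contra hne
    exact disjoint_left.1 (hF.disjoint i j hne) hxi (interior_subset hj)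
  exact mem_interior_iff_mem_nhds.1 hj

/-- Both spaces are laminations over the same itineraries. Hyperbolicity enters through the saddle
charts at periodic points, which prevent backward orbits from staying on the boundary fibers. -/
theorem IsMarkovSystem.nonempty_homeomorph [IsManifold (𝓡 (d + 1)) 1 M]
    (hF : IsMarkovSystem F Λ φ) {χ : Letter n → List (Letter n)} (hχ : IsSystemPattern F φ χ)
    {f' : Wedge n → Wedge n} (hf' : Continuous f') (hb : f' (base n) = base n)
    (hpat : FollowsPattern f' χ) :
    Nonempty (↥(invLimit f' \ {basePoint n}) ≃ₜ ↥(WuSet F Λ)) := by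
  obtain ⟨J, g, h, hmono, hanti, horder⟩ := hF.exists_rectSystem hχ
  have hcore := hF.eq_coreSet
  have hint : ∀ x ∈ coreSet F.toHomeomorph φ, ∀ i, x ∈ range (φ i) → range (φ i) ∈ 𝓝 x :=
    fun x hx i hxi => hF.range_mem_nhds (hcore ▸ hx) hxi
  have hint' : coreSet F.toHomeomorph φ ⊆ interior (rects φ) := by
    rw [← hcore]
    exact hF.subset_interior.trans (iUnion_subset fun i =>
      interior_mono (subset_iUnion (fun i => range (φ i)) i))
  have hsaddle : ∀ x ∈ coreSet F.toHomeomorph φ, ∀ m, 0 < m → F.toHomeomorph^[m] x = x →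
      ∃ q, 0 < q ∧ ∀ O ∈ 𝓝 x, ∃ (u s : M → ℝ) (S : Set M) (K ν r : ℝ), (∀ y, 0 ≤ s y) ∧
        saddleBox u s S r ∈ 𝓝 x ∧ saddleBox u s S r ⊆ O ∧
        IsSaddleChart F.toHomeomorph^[m * q] x u s S K ν r := by
    rw [← hcore]
    exact fun x hx m hm hper => hF.hyperbolic.exists_saddleChart hx hm hper
  obtain ⟨q, hq, T, E, hE⟩ := h.exists_lamination hmono hanti horder hint' hF.r5
    fun z hz => h.exists_symm_iterate_mem_fiber hint hsaddle hz
  obtain ⟨q', hq', T', E', hE'⟩ := hpat.exists_lamination hf' hb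
  obtain ⟨e⟩ := hE'.nonempty_homeomorph hq' hq hE
  refine ⟨e.trans (Homeomorph.setCongr ?_)⟩
  rw [hcore, h.wuSet_coreSet hint']

end

end BJV

theorem proposition2p5 {n d : ℕ} {M : Type*} [EMetricSpace M]
    [ChartedSpace (EuclideanSpace ℝ (Fin (d + 1))) M] [IsManifold (𝓡 (d + 1)) 1 M]
    [RiemannianBundle (fun x : M => TangentSpace (𝓡 (d + 1)) x)]
    [IsContinuousRiemannianBundle (EuclideanSpace ℝ (Fin (d + 1)))
      (fun x : M => TangentSpace (𝓡 (d + 1)) x)]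
    [IsRiemannianManifold (𝓡 (d + 1)) M]
    (F : M ≃ₘ^1⟮𝓡 (d + 1), 𝓡 (d + 1)⟯ M) (Λ : Set M) (φ : Fin n → BJV.Box d → M)
    (hF : BJV.IsMarkovSystem F Λ φ)
    (χ : BJV.Letter n → List (BJV.Letter n)) (hχ : BJV.IsSystemPattern F φ χ)
    (f' : BJV.Wedge n → BJV.Wedge n) (hf' : BJV.MemM f') (hpat : BJV.FollowsPattern f' χ) :
    Nonempty (↥(BJV.invLimit f' \ {BJV.basePoint n}) ≃ₜ ↥(BJV.WuSet F Λ)) :=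
  hF.nonempty_homeomorph hχ hf'.continuous hf'.map_base hpat
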